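/- **Setting.** Let $d\ge 2$ and let $\overline\Omega\subset\mathbb R^d$ be a polytopic domain: a compact connected set which is the closure of its interior $\Omega$ and whose boundary $\partial\Omega$ lies in finitely many hyperplanes. Let $\partial\Omega=\partial\Omega_D\cup\partial\Omega_R\cup\partial\Omega_t$ be a disjoint decomposition, $T\in(0,\infty)$, $Q=[0,T]\times\overline\Omega$, and $A$ a non-empty compact metric space. A generalised face is the intersection of an open $(d-1)$-dimensional face of $\overline\Omega$ with one of the three boundary parts; $PC(\partial\Omega)$ is the space of bounded functions on $\partial\Omega$ that are continuous on each generalised face, with the supremum norm. Let $\alpha\mapsto(a^\alpha,b^\alpha,c^\alpha,f^\alpha)\in C(\overline\Omega)\times C(\overline\Omega,\mathbb R^d)\times C(\overline\Omega)\times C(\overline\Omega)$ and $\alpha\mapsto (b^\alpha_{\partial},c^\alpha_{\partial},g^\alpha)\in PC(\partial\Omega,\mathbb R^d)\times PC(\partial\Omega)\times PC(\partial\Omega)$ be continuous on $A$, $g\in C(\partial\Omega)$, $v_T\in C(\overline\Omega)$, with $a^\alpha,c^\alpha,c_\partial^\alpha,g^\alpha,g,v_T\ge0$ and $v_T=g$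 on $\partial\Omega_D$. Let $b_\partial^\alpha(x)\in K(x):=\{e:\exists\Lambda>0\ \forall\lambda\in[0,\Lambda]:x+\lambda e\in\overline\Omega\}$ for all $\alpha\in A$, $x\in\partial\Omega$. Put $$F(t,x,q,p,r,s)=\begin{cases}-r+\sup_\alpha(-a^\alpha(x)q-b^\alpha(x)\cdot p+c^\alpha(x)s-f^\alpha(x)),&t<T,\ x\in\Omega,\\-r+\sup_\alpha(-b^\alpha_\partial(x)\cdot p+c^\alpha_\partial(x)s-g^\alpha(x)),&t<T,\ x\in\partial\Omega_t,\\ \sup_\alpha(-b^\alpha_\partial(x)\cdot p+c^\alpha_\partial(x)s-g^\alpha(x)),&t<T,\ x\in\partial\Omega_R,\\ s-g(x),&t<T,\ x\in\partial\Omega_D,\\ s-v_T(x),&t=T,\ x\in\overline\Omega,\end{cases}$$ and let $F_*,F^*$ be its lower and upper semicontinuous envelopes in all variables on $Q\times\mathbb R\times\mathbb R^d\times\mathbb R\times\mathbb R$. A bounded $v:Q\to\mathbb R$ with semicontinuous envelopes $v^*$, $v_*$ is a *viscosity subsolution* (*supersolution*) if for every $\psi\in C^2(\mathbb R\times\mathbb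 R^d)$ and every $(t,x)\in Q$ at which $v^*-\psi$ has a local maximum ($v_*-\psi$ has a local minimum) relative to $Q$ one has $F_*(t,x,\Delta\psi,\nabla\psi,\partial_t\psi,v^*(t,x))\le0$ (respectively $F^*(t,x,\Delta\psi,\nabla\psi,\partial_t\psi,v_*(t,x))\ge0$), the derivatives being taken at $(t,x)$. Assume that for some $\alpha\in A$ there are $w\in C^2(\mathbb R\times\mathbb R^d)$ and $\varepsilon>0$ with $F^\alpha(t,x,\Delta w,\nabla w,\partial_tw,w)\ge\varepsilon$ on $Q$, where $F^\alpha$ is $F$ with the suprema replaced by the value at $\alpha$. **Scheme.** For $i\in\mathbb N$ let $\mathcal T_i$ be conforming simplicial meshes of $\overline\Omega$, uniformly shape-regular, such that the relative interior of each boundary face of the mesh lies in a generalised face, with mesh sizes tending to $0$. Let $V_i$ be the continuous functions on $\overline\Omega$ that are affine on each element, $\phi_y$ the hat function of the node $y$ and $\hat\phi_y=\phi_y/\|\phi_y\|_{L^1}$. Let $h_i=T/M_i\to0$ with integers $M_i\ge1$ and $s_i^k=kh_i$, $0\le k\le M_i$. Let $a_i^\alpha,c_i^\alpha,\bar a_i^\alpha,\bar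 c_i^\alpha,f_i^\alpha\in C(\overline\Omega)$, $b_i^\alpha,\bar b_i^\alpha\in C(\overline\Omega,\mathbb R^d)$, $c_{\partial,i}^\alpha,\bar c_{\partial,i}^\alpha,g_i^\alpha\in PC(\partial\Omega)$, $b_{\partial,i}^\alpha,\bar b_{\partial,i}^\alpha\in PC(\partial\Omega,\mathbb R^d)$ depend, for each $i$, continuously (in the supremum norms) on $\alpha$. For $w\in V_i$ and a node $y\in\Omega$ set $$(\mathsf E_i^\alpha w)_y=a_i^\alpha(y)\langle\nabla w,\nabla\hat\phi_y\rangle+\langle-b_i^\alpha\cdot\nabla w+c_i^\alpha w,\hat\phi_y\rangle,\quad(\mathsf I_i^\alpha w)_y=\bar a_i^\alpha(y)\langle\nabla w,\nabla\hat\phi_y\rangle+\langle-\bar b_i^\alpha\cdot\nabla w+\bar c_i^\alpha w,\hat\phi_y\rangle,\quad(\mathsf F_i^\alpha)_y=\langle f_i^\alpha,\hat\phi_y\rangle;$$ for a node $y\in\partial\Omega_t\cup\partial\Omega_R$ set $$(\mathsf E_i^\alpha w)_y=\partial_{-b_{\partial,i}^\alpha(y)}w(y)+c_{\partial,i}^\alpha(y)w(y),\quad(\mathsf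 I_i^\alpha w)_y=\partial_{-\bar b_{\partial,i}^\alpha(y)}w(y)+\bar c_{\partial,i}^\alpha(y)w(y),\quad(\mathsf F_i^\alpha)_y=g_i^\alpha(y),$$ with the lower Dini derivative $\partial_{-e}w(y)=\liminf_{\lambda\downarrow0}(w(y)-w(y+\lambda e))/\lambda$; for a node $y\in\partial\Omega_D$ set $(\mathsf E_i^\alpha w)_y=0$, $(\mathsf I_i^\alpha w)_y=w(y)$, $(\mathsf F_i^\alpha)_y=g(y)$. A numerical solution consists of $v_i(s_i^k,\cdot)\in V_i$, $0\le k\le M_i$, equal to $g$ at the nodes on $\partial\Omega_D$, with $v_i(T,y)=v_T(y)$ at all nodes, and $$-(d_iv_i(s_i^k,\cdot))_y+\sup_{\alpha\in A}\bigl(\mathsf E_i^\alpha v_i(s_i^{k+1},\cdot)+\mathsf I_i^\alpha v_i(s_i^k,\cdot)-\mathsf F_i^\alpha\bigr)_y=0\qquad(0\le k<M_i,\ y\text{ a node}),$$ where $(d_iw(s_i^k,\cdot))_y=(w(s_i^{k+1},y)-w(s_i^k,y))/h_i$ if $y\in\Omega\cup\partial\Omega_t$, and $0$ otherwise. **Assumptions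 on the discretisation.** 1. *Consistency.* As $i\to\infty$, uniformly in $\alpha\in A$: $b_i^\alpha+\bar b_i^\alpha\to b^\alpha$, $c_i^\alpha+\bar c_i^\alpha\to c^\alpha$, $f_i^\alpha\to f^\alpha$ uniformly on $\overline\Omega$; $b_{\partial,i}^\alpha+\bar b_{\partial,i}^\alpha\to b_\partial^\alpha$, $c_{\partial,i}^\alpha+\bar c_{\partial,i}^\alpha\to c_\partial^\alpha$, $g_i^\alpha\to g^\alpha$ uniformly on $\partial\Omega$; and $\|a^\alpha-(a_i^\alpha(y)+\bar a_i^\alpha(y))\|_{L^\infty(\operatorname{supp}\hat\phi_y)}\to0$ uniformly in the nodes $y\notin\partial\Omega_D$. Moreover $b_{\partial,i}^\alpha,\bar b_{\partial,i}^\alpha$ are bounded uniformly in $i$ and $\alpha$. 2. *Signs and directions.* $c_i^\alpha,\bar c_i^\alpha,f_i^\alpha,c_{\partial,i}^\alpha,\bar c_{\partial,i}^\alpha,g_i^\alpha\ge0$; $b_{\partial,i}^\alpha(y),\bar b_{\partial,i}^\alpha(y)\in K(y)$ at the nodes $y\in\partial\Omega_t\cup\partial\Omega_R$; on $\partial\Omega_R$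 one has $a_i^\alpha=c_i^\alpha=c_{\partial,i}^\alpha=0$, $b_i^\alpha=b_{\partial,i}^\alpha=0$ and $\bar c_{\partial,i}^\alpha>0$. 3. *Monotonicity.* For each $i$ there is $\theta_i\in(0,\frac\pi2)$ with $\nabla\phi_y\cdot\nabla\phi_z|_K\le-\sin\theta_i\,|\nabla\phi_y|_K|\nabla\phi_z|_K$ for all nodes $y\ne z$ and all $K\in\mathcal T_i$. For each $\alpha$ and each node $y\in\Omega$ there are $\nu,\bar\nu\ge0$ with $a_i^\alpha(y)\ge\nu$, $\bar a_i^\alpha(y)\ge\bar\nu$ and, for all $K\in\mathcal T_i$ with vertex $y$, $$|b_i^\alpha|_K+\operatorname{diam}(K)\|c_i^\alpha\|_{L^\infty(K)}\le\nu\sin\theta_i|\nabla\hat\phi_y|_K\operatorname{vol}(K),\qquad|\bar b_i^\alpha|_K+\operatorname{diam}(K)\|\bar c_i^\alpha\|_{L^\infty(K)}\le\bar\nu\sin\theta_i|\nabla\hat\phi_y|_K\operatorname{vol}(K),$$ where $|u|_K=(\sum_j\|u_j\|_{L^\infty(K)}^2)^{1/2}$. The time step satisfies $h_i(\mathsf E_i^\alpha\phi_y)_y\le1$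 for all $\alpha$ and all nodes $y\in\Omega\cup\partial\Omega_t$. 4. *Elliptic projection.* There are linear maps $P_i$ from $C^\infty(\mathbb R^d)$ to $V_i$ with $\langle\nabla P_iw,\nabla\hat\phi_y\rangle=\langle\nabla w,\nabla\hat\phi_y\rangle$ for all nodes $y\in\Omega$, with $\|P_iw\|_{W^{1,\infty}(\Omega)}\le C\|w\|_{W^{1,\infty}(\Omega)}$ for a constant $C$ independent of $i$ and $w$, and with $\|P_iw-w\|_{W^{1,\infty}(\Omega)}\to0$ for every $w$. **Theorem.** Let $v_i$ be the numerical solutions, and for $(t,x)\in Q$ let $$\overline v(t,x)=\limsup_{i\to\infty,\ (s_i^k,y)\to(t,x)}v_i(s_i^k,y),\qquad\underline v(t,x)=\liminf_{i\to\infty,\ (s_i^k,y)\to(t,x)}v_i(s_i^k,y),$$ where the limits are taken over all space-time nodes $(s_i^k,y)$ of level $i$. Then $\overline v$ and $\underline v$ are finite on $Q$, $\overline v$ is a viscosity subsolution and $\underline v$ is a viscosity supersolution (in particular both are bounded). -/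

import Mathlib

open Set Filter Topology MeasureTheory
open scoped ContDiff NNReal

noncomputable section

namespace HJB

/-- Euclidean space of dimension `d`. -/
abbrev Euc (d : ℕ) := EuclideanSpace ℝ (Fin d)

/-! ## Semicontinuous envelopes -/

/-- Upper semicontinuous envelope, relative to `S`, of a real function; extended-real valued. -/
def uscEnv {X : Type*} [TopologicalSpace X] (S : Set X) (u : X → ℝ) (x : X) : EReal :=
  limsup (fun y => ((u y : ℝ) : EReal)) (𝓝[S] x)

/-- Lower semicontinuous envelope, relative to `S`, of a real function; extended-real valued. -/
def lscEnv {X : Type*} [TopologicalSpace X] (S : Set X) (u : X → ℝ) (x : X) : EReal :=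
  liminf (fun y => ((u y : ℝ) : EReal)) (𝓝[S] x)

/-! ## Polytopic domains, faces, tangent cones -/

/-- A polytopic domain: a compact connected set, the closure of its interior, whose boundary lies
in finitely many hyperplanes. It need not be convex. -/
structure IsPolytopicDomain {d : ℕ} (Ω : Set (Euc d)) : Prop where
  isCompact : IsCompact Ω
  isConnected : IsConnected Ω
  closure_interior : closure (interior Ω) = Ω
  flat : ∃ S : Finset (Euc d × ℝ), (∀ q ∈ S, q.1 ≠ 0) ∧
    frontier Ω ⊆ ⋃ q ∈ S, {x | inner ℝ q.1 x = q.2}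

/-- The boundary points near which the boundary coincides with a hyperplane. -/
def flatBoundary {d : ℕ} (Ω : Set (Euc d)) : Set (Euc d) :=
  {x | x ∈ frontier Ω ∧ ∃ n : Euc d, n ≠ 0 ∧ ∃ c : ℝ, ∃ U ∈ 𝓝 x,
    frontier Ω ∩ U = {z | inner ℝ n z = c} ∩ U}

/-- The open `(d-1)`-dimensional faces: the connected components of the flat part of the boundary. -/
def openFacets {d : ℕ} (Ω : Set (Euc d)) : Set (Set (Euc d)) :=
  {Γ | ∃ x ∈ flatBoundary Ω, Γ = connectedComponentIn (flatBoundary Ω) x}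

/-- The tangent cone `K(x)`: directions in which a segment starting at `x` stays in `Ω`. -/
def tangentCone {d : ℕ} (Ω : Set (Euc d)) (x : Euc d) : Set (Euc d) :=
  {e | ∃ Λ : ℝ, 0 < Λ ∧ ∀ l ∈ Icc (0 : ℝ) Λ, x + l • e ∈ Ω}

/-- The lower Dini derivative of `w` at `x` in direction `-e`, computed from values at `x + l e`. -/
def diniDeriv {d : ℕ} (w : Euc d → ℝ) (x e : Euc d) : ℝ :=
  liminf (fun l : ℝ => (w x - w (x + l • e)) / l) (𝓝[>] (0 : ℝ))

/-! ## The Hamilton–Jacobi–Bellman problem -/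

/-- Data of the mixed final-time boundary-value problem. `Ω` is the closed domain; functions on
`Ω` or on its boundary are given by functions on the whole space, only the values on `Ω`,
respectively on `frontier Ω`, matter. -/
structure Problem (d : ℕ) (A : Type*) where
  Ω : Set (Euc d)
  T : ℝ
  bdD : Set (Euc d)
  bdR : Set (Euc d)
  bdT : Set (Euc d)
  a : A → Euc d → ℝ
  b : A → Euc d → Euc d
  c : A → Euc d → ℝ
  f : A → Euc d → ℝ
  bB : A → Euc d → Euc d
  cB : A → Euc d → ℝ
  gB : A → Euc d → ℝ
  g : Euc d → ℝ
  vT : Euc d → ℝ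

namespace Problem

variable {d : ℕ} {A : Type*} (P : Problem d A)

/-- The closed space-time cylinder `[0,T] × Ω`. -/
def Q : Set (ℝ × Euc d) := Icc 0 P.T ×ˢ P.Ω

/-- Generalised faces: intersections of an open facet with one of the three boundary regions. -/
def genFaces : Set (Set (Euc d)) :=
  {Γ | ∃ Γ' ∈ openFacets P.Ω, ∃ X ∈ ({P.bdD, P.bdR, P.bdT} : Set (Set (Euc d))), Γ = Γ' ∩ X}

/-- Piecewise continuous functions on the boundary: bounded everywhere, and continuous on each
generalised face. -/
def PC {F : Type*} [NormedAddCommGroup F] (u : Euc d → F) : Prop :=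
  (∃ C : ℝ, ∀ x ∈ frontier P.Ω, ‖u x‖ ≤ C) ∧ ∀ Γ ∈ P.genFaces, ContinuousOn u Γ

/-- `L^α(x,q,p,s)`. -/
def L (α : A) (x : Euc d) (q : ℝ) (p : Euc d) (s : ℝ) : ℝ :=
  -(P.a α x) * q - inner ℝ (P.b α x) p + P.c α x * s

/-- The boundary operator `(x,p,s) ↦ -b·p + c s` for the control `α`. -/
def LB (α : A) (x : Euc d) (p : Euc d) (s : ℝ) : ℝ :=
  -(inner ℝ (P.bB α x) p) + P.cB α x * s

open Classical in
/-- The operator `F` of the final-time boundary-value problem. -/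
def F (t : ℝ) (x : Euc d) (q : ℝ) (p : Euc d) (r s : ℝ) : ℝ :=
  if t = P.T then s - P.vT x
  else if x ∈ interior P.Ω then -r + ⨆ α, (P.L α x q p s - P.f α x)
  else if x ∈ P.bdT then -r + ⨆ α, (P.LB α x p s - P.gB α x)
  else if x ∈ P.bdR then ⨆ α, (P.LB α x p s - P.gB α x)
  else s - P.g x

open Classical in
/-- The operator of the linear problem with a fixed control `α`. -/
def Flin (α : A) (t : ℝ) (x : Euc d) (q : ℝ) (p : Euc d) (r s : ℝ) : ℝ :=
  if t = P.T then s - P.vT x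
  else if x ∈ interior P.Ω then -r + (P.L α x q p s - P.f α x)
  else if x ∈ P.bdT then -r + (P.LB α x p s - P.gB α x)
  else if x ∈ P.bdR then P.LB α x p s - P.gB α x
  else s - P.g x

/-- The arguments `(t,x,q,p,r,s)` of `F`, as a product space. -/
abbrev Arg (d : ℕ) := (ℝ × Euc d) × ℝ × Euc d × ℝ × ℝ

/-- The domain `[0,T] × Ω × ℝ × ℝ^d × ℝ × ℝ` of `F`. -/
def argSet : Set (Arg d) := {z | z.1 ∈ P.Q}

/-- `F` on the product space of its arguments. -/
def Farg (z : Arg d) : ℝ := P.F z.1.1 z.1.2 z.2.1 z.2.2.1 z.2.2.2.1 z.2.2.2.2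

/-- `F^*`, the upper semicontinuous envelope of `F` in all arguments. -/
def Fupper (z : Arg d) : EReal := uscEnv P.argSet P.Farg z

/-- `F_*`, the lower semicontinuous envelope of `F` in all arguments. -/
def Flower (z : Arg d) : EReal := lscEnv P.argSet P.Farg z

/-- The argument `((t,x), Δψ, ∇ψ, ∂_t ψ, s)` for a test function `ψ(t,x)`. -/
def jet (ψ : ℝ × Euc d → ℝ) (z : ℝ × Euc d) (s : ℝ) : Arg d :=
  (z, Laplacian.laplacian (fun x => ψ (z.1, x)) z.2, gradient (fun x => ψ (z.1, x)) z.2,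
    deriv (fun τ => ψ (τ, z.2)) z.1, s)

/-- `v^*` on `[0,T] × Ω` (a real function when `v` is bounded). -/
def upper (v : ℝ × Euc d → ℝ) (z : ℝ × Euc d) : ℝ := (uscEnv P.Q v z).toReal

/-- `v_*` on `[0,T] × Ω` (a real function when `v` is bounded). -/
def lower (v : ℝ × Euc d → ℝ) (z : ℝ × Euc d) : ℝ := (lscEnv P.Q v z).toReal

/-- Bounded viscosity subsolutions (the final and boundary conditions are part of `F`). -/
structure IsViscositySubsolution (v : ℝ × Euc d → ℝ) : Prop where
  bounded : ∃ C : ℝ, ∀ z ∈ P.Q, |v z| ≤ C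
  sub : ∀ ψ : ℝ × Euc d → ℝ, ContDiff ℝ 2 ψ → ∀ z ∈ P.Q,
    IsLocalMaxOn (fun y => P.upper v y - ψ y) P.Q z → P.Flower (jet ψ z (P.upper v z)) ≤ 0

/-- Bounded viscosity supersolutions. -/
structure IsViscositySupersolution (v : ℝ × Euc d → ℝ) : Prop where
  bounded : ∃ C : ℝ, ∀ z ∈ P.Q, |v z| ≤ C
  super : ∀ ψ : ℝ × Euc d → ℝ, ContDiff ℝ 2 ψ → ∀ z ∈ P.Q,
    IsLocalMinOn (fun y => P.lower v y - ψ y) P.Q z → 0 ≤ P.Fupper (jet ψ z (P.lower v z))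

/-- Standing assumptions on the problem. Since `A` is compact, continuity of the coefficient maps
in the supremum norm contains the equicontinuity of the families of coefficients. -/
structure Standing [TopologicalSpace A] : Prop where
  polytopic : IsPolytopicDomain P.Ω
  T_pos : 0 < P.T
  bd_union : P.bdD ∪ P.bdR ∪ P.bdT = frontier P.Ω
  disj_DR : Disjoint P.bdD P.bdR
  disj_DT : Disjoint P.bdD P.bdT
  disj_RT : Disjoint P.bdR P.bdT
  a_cont : ∀ α, ContinuousOn (P.a α) P.Ω
  b_cont : ∀ α, ContinuousOn (P.b α) P.Ω
  c_cont : ∀ α, ContinuousOn (P.c α) P.Ω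
  f_cont : ∀ α, ContinuousOn (P.f α) P.Ω
  a_dep : ∀ α₀, TendstoUniformlyOn P.a (P.a α₀) (𝓝 α₀) P.Ω
  b_dep : ∀ α₀, TendstoUniformlyOn P.b (P.b α₀) (𝓝 α₀) P.Ω
  c_dep : ∀ α₀, TendstoUniformlyOn P.c (P.c α₀) (𝓝 α₀) P.Ω
  f_dep : ∀ α₀, TendstoUniformlyOn P.f (P.f α₀) (𝓝 α₀) P.Ω
  bB_pc : ∀ α, P.PC (P.bB α)
  cB_pc : ∀ α, P.PC (P.cB α)
  gB_pc : ∀ α, P.PC (P.gB α)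
  bB_dep : ∀ α₀, TendstoUniformlyOn P.bB (P.bB α₀) (𝓝 α₀) (frontier P.Ω)
  cB_dep : ∀ α₀, TendstoUniformlyOn P.cB (P.cB α₀) (𝓝 α₀) (frontier P.Ω)
  gB_dep : ∀ α₀, TendstoUniformlyOn P.gB (P.gB α₀) (𝓝 α₀) (frontier P.Ω)
  g_cont : ContinuousOn P.g (frontier P.Ω)
  vT_cont : ContinuousOn P.vT P.Ω
  a_nonneg : ∀ α, ∀ x ∈ P.Ω, 0 ≤ P.a α x
  c_nonneg : ∀ α, ∀ x ∈ P.Ω, 0 ≤ P.c α x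
  cB_nonneg : ∀ α, ∀ x ∈ frontier P.Ω, 0 ≤ P.cB α x
  gB_nonneg : ∀ α, ∀ x ∈ frontier P.Ω, 0 ≤ P.gB α x
  g_nonneg : ∀ x ∈ frontier P.Ω, 0 ≤ P.g x
  vT_nonneg : ∀ x ∈ P.Ω, 0 ≤ P.vT x
  vT_dirichlet : ∀ x ∈ P.bdD, P.vT x = P.g x
  cone : ∀ α, ∀ x ∈ frontier P.Ω, P.bB α x ∈ tangentCone P.Ω x

/-- Some linear problem has a strict supersolution of class `C^2`. -/
def HasStrictSupersolution : Prop :=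
  ∃ α : A, ∃ w : ℝ × Euc d → ℝ, ContDiff ℝ 2 w ∧ ∃ ε : ℝ, 0 < ε ∧ ∀ z ∈ P.Q,
    ε ≤ P.Flin α z.1 z.2 (Laplacian.laplacian (fun x => w (z.1, x)) z.2)
      (gradient (fun x => w (z.1, x)) z.2) (deriv (fun τ => w (τ, z.2)) z.1) (w z)

end Problem

/-! ## Simplicial meshes and continuous piecewise linear functions -/

/-- A conforming simplicial mesh; an element is the convex hull of `d + 1` affinely independent
vertices, and two elements meet in the convex hull of their common vertices. -/
structure Mesh (d : ℕ) where
  elements : Finset (Finset (Euc d))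
  card_eq : ∀ K ∈ elements, K.card = d + 1
  indep : ∀ K ∈ elements, AffineIndependent ℝ (Subtype.val : K → Euc d)
  conforming : ∀ K ∈ elements, ∀ K' ∈ elements,
    convexHull ℝ (K : Set (Euc d)) ∩ convexHull ℝ (K' : Set (Euc d)) =
      convexHull ℝ ((K : Set (Euc d)) ∩ K')

/-- The closed element with vertex set `K`. -/
def hull {d : ℕ} (K : Finset (Euc d)) : Set (Euc d) := convexHull ℝ (K : Set (Euc d))

namespace Mesh

variable {d : ℕ} (T : Mesh d)

/-- The nodes of the mesh. -/
def nodes : Set (Euc d) := {y | ∃ K ∈ T.elements, y ∈ K}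

/-- The union of the closed elements. -/
def carrier : Set (Euc d) := ⋃ K ∈ T.elements, hull K

/-- The largest diameter of an element. -/
def meshSize : ℝ := ⨆ K : T.elements, Metric.diam (hull (K : Finset (Euc d)))

/-- The continuous functions on the meshed set that are affine on each closed element, extended by
zero off the meshed set. Continuity follows from agreement on the intersections of elements. -/
def V : Submodule ℝ (Euc d → ℝ) where
  carrier := {v | (∀ K ∈ T.elements, ∃ l : Euc d →ᵃ[ℝ] ℝ, EqOn v l (hull K)) ∧
    ∀ x ∉ T.carrier, v x = 0}
  add_mem' := by
    rintro u v ⟨hu, hu0⟩ ⟨hv, hv0⟩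
    refine ⟨fun K hK => ?_, fun x hx => by simp [hu0 x hx, hv0 x hx]⟩
    obtain ⟨l, hl⟩ := hu K hK
    obtain ⟨m, hm⟩ := hv K hK
    exact ⟨l + m, fun x hx => by simp [hl hx, hm hx]⟩
  zero_mem' := ⟨fun K _ => ⟨0, fun x _ => by simp⟩, fun x _ => rfl⟩
  smul_mem' := by
    rintro r v ⟨hv, hv0⟩
    refine ⟨fun K hK => ?_, fun x hx => by simp [hv0 x hx]⟩
    obtain ⟨m, hm⟩ := hv K hK
    exact ⟨r • m, fun x hx => by simp [hm hx]⟩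

/-- The vertices of an element, as an affine basis of the space. -/
def affBasis (K : T.elements) : AffineBasis (K : Finset (Euc d)) ℝ (Euc d) where
  toFun := Subtype.val
  ind' := T.indep K K.2
  tot' := by
    rw [(T.indep K K.2).affineSpan_eq_top_iff_card_eq_finrank_add_one]
    simp [T.card_eq K K.2]

open Classical in
/-- The nodal hat function `φ_y`: on an element having `y` as a vertex it is the barycentric
coordinate belonging to `y`, elsewhere it is zero. -/
def hat (y x : Euc d) : ℝ :=
  if h : ∃ K : T.elements, y ∈ (K : Finset (Euc d)) ∧ x ∈ hull (K : Finset (Euc d)) then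
    (T.affBasis h.choose).coord ⟨y, h.choose_spec.1⟩ x
  else 0

/-- The hat function normalised in `L^1`. -/
def nhat (y x : Euc d) : ℝ := T.hat y x / ∫ z in T.carrier, |T.hat y z|

/-- The support of the hat function of the node `y`: the union of the elements containing `y`. -/
def patch (y : Euc d) : Set (Euc d) := ⋃ K ∈ {K ∈ T.elements | y ∈ K}, hull K

/-- Strict acuteness with angle `θ`. -/
def StrictlyAcute (θ : ℝ) : Prop :=
  0 < θ ∧ θ < Real.pi / 2 ∧ ∀ K ∈ T.elements, ∀ y ∈ T.nodes, ∀ z ∈ T.nodes, y ≠ z →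
    ∀ x ∈ interior (hull K), inner ℝ (gradient (T.hat y) x) (gradient (T.hat z) x) ≤
      -(Real.sin θ) * ‖gradient (T.hat y) x‖ * ‖gradient (T.hat z) x‖

end Mesh

/-- The supremum norm of a function on a set. -/
def supOn {X F : Type*} [NormedAddCommGroup F] (u : X → F) (S : Set X) : ℝ :=
  sSup ((fun x => ‖u x‖) '' S)

/-- `(∑_j ‖u_j‖²_{L^∞(S)})^{1/2}` for a vector field `u`. -/
def vecSup {d : ℕ} (u : Euc d → Euc d) (S : Set (Euc d)) : ℝ :=
  Real.sqrt (∑ j, (supOn (fun x => u x j) S) ^ 2)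

/-! ## The numerical scheme -/

/-- One refinement level: a mesh, the number of time steps, and the coefficients of the explicit
(`E`) and implicit (`I`) operators in the domain and (`bBE`, `cBE`, `bBI`, `cBI`) on the boundary,
together with the approximate data `f`, `gB`. -/
structure Level (d : ℕ) (A : Type*) where
  mesh : Mesh d
  M : ℕ
  aE : A → Euc d → ℝ
  bE : A → Euc d → Euc d
  cE : A → Euc d → ℝ
  aI : A → Euc d → ℝ
  bI : A → Euc d → Euc d
  cI : A → Euc d → ℝ
  f : A → Euc d → ℝ
  bBE : A → Euc d → Euc d
  cBE : A → Euc d → ℝ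
  bBI : A → Euc d → Euc d
  cBI : A → Euc d → ℝ
  gB : A → Euc d → ℝ

/-- Row of the node `y` of a discrete second-order operator in the domain:
`a(y) ⟨∇w, ∇φ̂⟩ + ⟨-b·∇w + c w, φ̂⟩`. The gradients exist almost everywhere. -/
def domRow {d : ℕ} (Ω : Set (Euc d)) (m : Mesh d) (a : Euc d → ℝ) (b : Euc d → Euc d)
    (c : Euc d → ℝ) (w : Euc d → ℝ) (y : Euc d) : ℝ :=
  a y * (∫ x in Ω, inner ℝ (gradient w x) (gradient (m.nhat y) x)) +
    ∫ x in Ω, (-(inner ℝ (b x) (gradient w x)) + c x * w x) * m.nhat y x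

/-- Row of the node `y` of a discrete first-order operator on the boundary. -/
def bdRow {d : ℕ} (b : Euc d → Euc d) (c : Euc d → ℝ) (w : Euc d → ℝ) (y : Euc d) : ℝ :=
  diniDeriv w y (b y) + c y * w y

namespace Level

variable {d : ℕ} {A : Type*} (D : Level d A) (P : Problem d A)

/-- The time step size. -/
def h : ℝ := P.T / D.M

/-- The `k`-th time. -/
def time (k : ℕ) : ℝ := k * D.h P

open Classical in
/-- Explicit operator, row of the node `y` (domain, Dirichlet, Robin nodes). -/
def opE (α : A) (w : Euc d → ℝ) (y : Euc d) : ℝ :=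
  if y ∈ interior P.Ω then domRow P.Ω D.mesh (D.aE α) (D.bE α) (D.cE α) w y
  else if y ∈ P.bdD then 0
  else bdRow (D.bBE α) (D.cBE α) w y

open Classical in
/-- Implicit operator, row of the node `y`. -/
def opI (α : A) (w : Euc d → ℝ) (y : Euc d) : ℝ :=
  if y ∈ interior P.Ω then domRow P.Ω D.mesh (D.aI α) (D.bI α) (D.cI α) w y
  else if y ∈ P.bdD then w y
  else bdRow (D.bBI α) (D.cBI α) w y

open Classical in
/-- Right-hand side, row of the node `y`. -/
def rhs (α : A) (y : Euc d) : ℝ :=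
  if y ∈ interior P.Ω then ∫ x in P.Ω, D.f α x * D.mesh.nhat y x
  else if y ∈ P.bdD then P.g y
  else D.gB α y

open Classical in
/-- The discrete time derivative; zero at the nodes on `bdR` and `bdD`. -/
def dt (v : ℕ → Euc d → ℝ) (k : ℕ) (y : Euc d) : ℝ :=
  if y ∈ interior P.Ω ∪ P.bdT then (v (k + 1) y - v k y) / D.h P else 0

/-- `v k` is the numerical solution at the `k`-th time: it interpolates the Dirichlet data and, at
the final time, `v_T`, and it solves the discrete Bellman equation at each earlier time. -/
structure IsNumericalSolution (v : ℕ → Euc d → ℝ) : Prop where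
  mem : ∀ k ≤ D.M, v k ∈ D.mesh.V
  dirichlet : ∀ k ≤ D.M, ∀ y ∈ D.mesh.nodes, y ∈ P.bdD → v k y = P.g y
  final : ∀ y ∈ D.mesh.nodes, v D.M y = P.vT y
  scheme : ∀ k < D.M, ∀ y ∈ D.mesh.nodes,
    -(D.dt P v k y) + ⨆ α, (D.opE P α (v (k + 1)) y + D.opI P α (v k) y - D.rhs P α y) = 0

/-- Continuity of the coefficients of one level in space, and in the control `α` with respect to
the supremum norm. -/
structure Regular [TopologicalSpace A] : Prop where
  aE_cont : ∀ α, ContinuousOn (D.aE α) P.Ω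
  bE_cont : ∀ α, ContinuousOn (D.bE α) P.Ω
  cE_cont : ∀ α, ContinuousOn (D.cE α) P.Ω
  aI_cont : ∀ α, ContinuousOn (D.aI α) P.Ω
  bI_cont : ∀ α, ContinuousOn (D.bI α) P.Ω
  cI_cont : ∀ α, ContinuousOn (D.cI α) P.Ω
  f_cont : ∀ α, ContinuousOn (D.f α) P.Ω
  bBE_pc : ∀ α, P.PC (D.bBE α)
  cBE_pc : ∀ α, P.PC (D.cBE α)
  bBI_pc : ∀ α, P.PC (D.bBI α)
  cBI_pc : ∀ α, P.PC (D.cBI α)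
  gB_pc : ∀ α, P.PC (D.gB α)
  aE_dep : ∀ α₀, TendstoUniformlyOn D.aE (D.aE α₀) (𝓝 α₀) P.Ω
  bE_dep : ∀ α₀, TendstoUniformlyOn D.bE (D.bE α₀) (𝓝 α₀) P.Ω
  cE_dep : ∀ α₀, TendstoUniformlyOn D.cE (D.cE α₀) (𝓝 α₀) P.Ω
  aI_dep : ∀ α₀, TendstoUniformlyOn D.aI (D.aI α₀) (𝓝 α₀) P.Ω
  bI_dep : ∀ α₀, TendstoUniformlyOn D.bI (D.bI α₀) (𝓝 α₀) P.Ω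
  cI_dep : ∀ α₀, TendstoUniformlyOn D.cI (D.cI α₀) (𝓝 α₀) P.Ω
  f_dep : ∀ α₀, TendstoUniformlyOn D.f (D.f α₀) (𝓝 α₀) P.Ω
  bBE_dep : ∀ α₀, TendstoUniformlyOn D.bBE (D.bBE α₀) (𝓝 α₀) (frontier P.Ω)
  cBE_dep : ∀ α₀, TendstoUniformlyOn D.cBE (D.cBE α₀) (𝓝 α₀) (frontier P.Ω)
  bBI_dep : ∀ α₀, TendstoUniformlyOn D.bBI (D.bBI α₀) (𝓝 α₀) (frontier P.Ω)
  cBI_dep : ∀ α₀, TendstoUniformlyOn D.cBI (D.cBI α₀) (𝓝 α₀) (frontier P.Ω)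
  gB_dep : ∀ α₀, TendstoUniformlyOn D.gB (D.gB α₀) (𝓝 α₀) (frontier P.Ω)

/-- Sign conditions, admissible directions for the Dini derivatives, and a fully implicit
discretisation with positive zeroth-order coefficient on `bdR`. -/
structure SignsAndCone : Prop where
  cE_nonneg : ∀ α, ∀ x ∈ P.Ω, 0 ≤ D.cE α x
  cI_nonneg : ∀ α, ∀ x ∈ P.Ω, 0 ≤ D.cI α x
  f_nonneg : ∀ α, ∀ x ∈ P.Ω, 0 ≤ D.f α x
  cBE_nonneg : ∀ α, ∀ x ∈ frontier P.Ω, 0 ≤ D.cBE α x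
  cBI_nonneg : ∀ α, ∀ x ∈ frontier P.Ω, 0 ≤ D.cBI α x
  gB_nonneg : ∀ α, ∀ x ∈ frontier P.Ω, 0 ≤ D.gB α x
  bBE_cone : ∀ α, ∀ y ∈ D.mesh.nodes, y ∈ P.bdT ∪ P.bdR → D.bBE α y ∈ tangentCone P.Ω y
  bBI_cone : ∀ α, ∀ y ∈ D.mesh.nodes, y ∈ P.bdT ∪ P.bdR → D.bBI α y ∈ tangentCone P.Ω y
  aE_R : ∀ α, ∀ x ∈ P.bdR, D.aE α x = 0
  bE_R : ∀ α, ∀ x ∈ P.bdR, D.bE α x = 0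
  cE_R : ∀ α, ∀ x ∈ P.bdR, D.cE α x = 0
  bBE_R : ∀ α, ∀ x ∈ P.bdR, D.bBE α x = 0
  cBE_R : ∀ α, ∀ x ∈ P.bdR, D.cBE α x = 0
  cBI_R : ∀ α, ∀ x ∈ P.bdR, 0 < D.cBI α x

/-- The artificial diffusion `ν` at the node `y` dominates the first- and zeroth-order terms. -/
def ArtDiff (θ ν : ℝ) (b : Euc d → Euc d) (c : Euc d → ℝ) (y : Euc d) : Prop :=
  ∀ K ∈ D.mesh.elements, y ∈ K →
    vecSup b (hull K) + Metric.diam (hull K) * supOn c (hull K) ≤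
      ν * Real.sin θ * vecSup (gradient (D.mesh.nhat y)) (interior (hull K)) *
        volume.real (hull K)

/-- Strict acuteness, choice of the diffusion coefficients, and the time step restriction (the
diagonal entries of `h E^α - Id` at the nodes with a time derivative are nonpositive). -/
structure Monotone : Prop where
  acute_artdiff : ∃ θ : ℝ, D.mesh.StrictlyAcute θ ∧
    ∀ α, ∀ y ∈ D.mesh.nodes, y ∈ interior P.Ω →
      (∃ ν : ℝ, 0 ≤ ν ∧ D.ArtDiff θ ν (D.bE α) (D.cE α) y ∧ ν ≤ D.aE α y) ∧
      (∃ ν : ℝ, 0 ≤ ν ∧ D.ArtDiff θ ν (D.bI α) (D.cI α) y ∧ ν ≤ D.aI α y)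
  timestep : ∀ α, ∀ y ∈ D.mesh.nodes, y ∈ interior P.Ω ∪ P.bdT →
    D.h P * D.opE P α (D.mesh.hat y) y ≤ 1

end Level

/-- Uniform convergence on `S`, uniformly in the control. -/
def UnifConv {X A F : Type*} [NormedAddCommGroup F] (S : Set X) (u : ℕ → A → X → F)
    (u₀ : A → X → F) : Prop :=
  ∀ ε : ℝ, 0 < ε → ∀ᶠ i in atTop, ∀ α, ∀ x ∈ S, ‖u₀ α x - u i α x‖ ≤ ε

section Sequences

variable {d : ℕ} {A : Type*} (P : Problem d A) (D : ℕ → Level d A)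

/-- A shape-regular sequence of meshes of `Ω`, subordinate to the generalised faces, with mesh size
and time step tending to zero. -/
structure MeshSequence : Prop where
  carrier_eq : ∀ i, (D i).mesh.carrier = P.Ω
  subordinate : ∀ i, ∀ K ∈ (D i).mesh.elements, ∀ S ⊆ K, S.card = d → hull S ⊆ frontier P.Ω →
    ∃ Γ ∈ P.genFaces, intrinsicInterior ℝ (hull S) ⊆ Γ
  shape_regular : ∃ σ : ℝ, 0 < σ ∧ ∀ i, ∀ K ∈ (D i).mesh.elements,
    ∃ z, Metric.closedBall z (σ * Metric.diam (hull K)) ⊆ hull K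
  meshSize_tendsto : Tendsto (fun i => (D i).mesh.meshSize) atTop (𝓝 0)
  M_pos : ∀ i, 0 < (D i).M
  h_tendsto : Tendsto (fun i => (D i).h P) atTop (𝓝 0)

/-- The sums of explicit and implicit coefficients approximate the coefficients of the problem; the
splitting of the boundary drift stays bounded. -/
structure Consistent : Prop where
  a_lim : ∀ ε : ℝ, 0 < ε → ∀ᶠ i in atTop, ∀ α, ∀ y ∈ (D i).mesh.nodes, y ∉ P.bdD →
    ∀ x ∈ (D i).mesh.patch y, |P.a α x - ((D i).aE α y + (D i).aI α y)| ≤ ε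
  b_lim : UnifConv P.Ω (fun i α x => (D i).bE α x + (D i).bI α x) P.b
  c_lim : UnifConv P.Ω (fun i α x => (D i).cE α x + (D i).cI α x) P.c
  f_lim : UnifConv P.Ω (fun i α x => (D i).f α x) P.f
  bB_lim : UnifConv (frontier P.Ω) (fun i α x => (D i).bBE α x + (D i).bBI α x) P.bB
  cB_lim : UnifConv (frontier P.Ω) (fun i α x => (D i).cBE α x + (D i).cBI α x) P.cB
  gB_lim : UnifConv (frontier P.Ω) (fun i α x => (D i).gB α x) P.gB
  bB_bdd : ∃ C : ℝ, ∀ i α, ∀ x ∈ frontier P.Ω, ‖(D i).bBE α x‖ ≤ C ∧ ‖(D i).bBI α x‖ ≤ C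

/-- The smooth functions on the whole space. -/
def smooth (d : ℕ) : Submodule ℝ (Euc d → ℝ) where
  carrier := {w | ContDiff ℝ ∞ w}
  add_mem' := by
    intro u v hu hv
    exact ContDiff.add (show ContDiff ℝ ∞ u from hu) (show ContDiff ℝ ∞ v from hv)
  zero_mem' := show ContDiff ℝ ∞ (fun _ : Euc d => (0 : ℝ)) from contDiff_const
  smul_mem' := by
    intro r v hv
    exact ContDiff.const_smul r (show ContDiff ℝ ∞ v from hv)

/-- The `W^{1,∞}(Ω)` norm of a (piecewise smooth, Lipschitz) function, as an extended number. -/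
def normW1inf (Ω : Set (Euc d)) (w : Euc d → ℝ) : ENNReal :=
  eLpNorm w ⊤ (volume.restrict Ω) + eLpNorm (gradient w) ⊤ (volume.restrict Ω)

/-- Existence of stable elliptic projections onto the finite element spaces. -/
def HasEllipticProjections : Prop :=
  ∃ Pr : ∀ i, smooth d →ₗ[ℝ] (D i).mesh.V,
    (∀ i, ∀ w : smooth d, ∀ y ∈ (D i).mesh.nodes, y ∈ interior P.Ω →
      ∫ x in P.Ω, inner ℝ (gradient (Pr i w : Euc d → ℝ) x) (gradient ((D i).mesh.nhat y) x) =
        ∫ x in P.Ω, inner ℝ (gradient (w : Euc d → ℝ) x) (gradient ((D i).mesh.nhat y) x)) ∧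
    (∃ C : ℝ≥0, ∀ i, ∀ w : smooth d, normW1inf P.Ω (Pr i w : Euc d → ℝ) ≤
      C * normW1inf P.Ω (w : Euc d → ℝ)) ∧
    ∀ w : smooth d, Tendsto
      (fun i => normW1inf P.Ω ((Pr i w : Euc d → ℝ) - (w : Euc d → ℝ))) atTop (𝓝 0)

/-- The space-time nodes `(i,k,y)` of all levels, converging to `z` as the level tends to
infinity. -/
def nodeFilter (z : ℝ × Euc d) : Filter (ℕ × ℕ × Euc d) :=
  comap (fun q => q.1) atTop ⊓ comap (fun q => ((D q.1).time P q.2.1, q.2.2)) (𝓝 z) ⊓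
    𝓟 {q | q.2.1 ≤ (D q.1).M ∧ q.2.2 ∈ (D q.1).mesh.nodes}

/-- The upper envelope of the numerical solutions. -/
def upperEnvelope (v : ℕ → ℕ → Euc d → ℝ) (z : ℝ × Euc d) : EReal :=
  limsup (fun q : ℕ × ℕ × Euc d => ((v q.1 q.2.1 q.2.2 : ℝ) : EReal)) (nodeFilter P D z)

/-- The lower envelope of the numerical solutions. -/
def lowerEnvelope (v : ℕ → ℕ → Euc d → ℝ) (z : ℝ × Euc d) : EReal :=
  liminf (fun q : ℕ × ℕ × Euc d => ((v q.1 q.2.1 q.2.2 : ℝ) : EReal)) (nodeFilter P D z)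

end Sequences

end HJB

end

noncomputable section

namespace HJB

/-! ## Barycentric coordinates and hat functions -/

/-! The proof is the half-relaxed limit argument for monotone, consistent and stable schemes.

Monotonicity. Each row of the explicit and implicit operators has nonpositive off-diagonal entries,
couples only neighbouring nodes and has a nonnegative row sum (`IsMonoRow`). In the domain, strict
acuteness makes the off-diagonal diffusion entries so negative that the artificial diffusion absorbs
drift and reaction (`isMonoRow_domRow`). On the boundary, the Dini derivative of a piecewise affine
function is a difference quotient along a segment inside one element (`isMonoRow_bdRow`). Together
with the time step restriction, all rows are nonnegative at a nonnegative space-time maximum of a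
grid function (`row_nonneg`).

Consistency. Nodal interpolation need not be consistent with the weak Laplacian, so test functions
enter through their elliptic projections. Polynomials of degree two in space suffice: their
Laplacian is constant, and integration by parts against the normalised hat function of an interior
node gives exactly minus this constant (`integral_inner_gradient_nhat`). Drift, reaction and source
are weighted means over shrinking patches. The explicit operator acts one time step late; the
resulting error is the step size times the explicit operator on a projection, which vanishes by
monotonicity and the time step restriction (`eventually_h_mul_opE_le`). The outcome is
`eventually_consistent`.

Passage to the limit. A `C²` test function is touched strictly from above by a space-time quadratic
with a nearby jet (`exists_touching`). The resulting strict maximum of the envelope persists for the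
grid functions. The quadratic is lowered slightly, so that the discrete maximum is nonnegative as
`row_nonneg` requires; accordingly the operator is evaluated at the value of the quadratic, not of
the solution. Subtracting the rows of the projection from the discrete Bellman equation gives `F ≤
ε` at arguments arbitrarily close to the jet, which is what the lower envelope of `F` asks for. At
final-time and Dirichlet nodes the solution equals the data and the comparison is immediate. For
supersolutions the argument runs on `-v`, and a single nearly optimal control is enough.

Stability. The solutions are nonnegative by backward induction in time (`solution_nonneg`). They lie
below the strict supersolution, since a nonnegative maximum of the difference would contradict
strictness by the same local argument (`eventually_lt_supersolution`). -/

lemma AffineMap_apply_sum {E ι : Type*} [AddCommGroup E] [Module ℝ E] (f : E →ᵃ[ℝ] ℝ)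
    (s : Finset ι) (w : ι → ℝ) (p : ι → E) (hw : ∑ i ∈ s, w i = 1) :
    f (∑ i ∈ s, w i • p i) = ∑ i ∈ s, w i * f (p i) := by
  have h : ∀ x, f x = f.linear x + f 0 := fun x => by
    have := congrFun (AffineMap.decomp f) x
    simpa using this
  rw [h, map_sum]
  simp only [map_smul, smul_eq_mul]
  calc ∑ i ∈ s, w i * f.linear (p i) + f 0
      = ∑ i ∈ s, w i * f.linear (p i) + (∑ i ∈ s, w i) * f 0 := by rw [hw, one_mul]
    _ = ∑ i ∈ s, w i * f (p i) := by
        rw [Finset.sum_mul, ← Finset.sum_add_distrib]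
        exact Finset.sum_congr rfl fun i _ => by rw [h (p i)]; ring

namespace Mesh

variable {d : ℕ} {T : Mesh d} {K K' : Finset (Euc d)} {x y z : Euc d}

/-- The barycentric coordinate of the vertex `y` of the element `K`. -/
def bary (hK : K ∈ T.elements) (hy : y ∈ K) : Euc d →ᵃ[ℝ] ℝ :=
  (T.affBasis ⟨K, hK⟩).coord ⟨y, hy⟩

lemma bary_apply_self (hK : K ∈ T.elements) (hy : y ∈ K) : bary hK hy y = 1 :=
  (T.affBasis ⟨K, hK⟩).coord_apply_eq ⟨y, hy⟩

lemma bary_apply_ne (hK : K ∈ T.elements) (hy : y ∈ K) (hz : z ∈ K) (h : y ≠ z) :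
    bary hK hy z = 0 := by
  have := (T.affBasis ⟨K, hK⟩).coord_apply_ne (i := ⟨y, hy⟩) (j := ⟨z, hz⟩)
    (by simpa using h)
  exact this

lemma range_affBasis (hK : K ∈ T.elements) :
    range (T.affBasis ⟨K, hK⟩) = (K : Set (Euc d)) := by
  change range (Subtype.val : {x // x ∈ K} → Euc d) = _
  simp

lemma mem_hull_iff (hK : K ∈ T.elements) :
    x ∈ hull K ↔ ∀ y, ∀ hy : y ∈ K, 0 ≤ bary hK hy x := by
  rw [hull, ← range_affBasis hK, AffineBasis.convexHull_eq_nonneg_coord]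
  exact ⟨fun h y hy => h ⟨y, hy⟩, fun h i => h i i.2⟩

lemma mem_interior_hull_iff (hK : K ∈ T.elements) :
    x ∈ interior (hull K) ↔ ∀ y, ∀ hy : y ∈ K, 0 < bary hK hy x := by
  rw [hull, ← range_affBasis hK, AffineBasis.interior_convexHull]
  exact ⟨fun h y hy => h ⟨y, hy⟩, fun h i => h i i.2⟩

lemma sum_bary (hK : K ∈ T.elements) (x : Euc d) : ∑ y : K, bary hK y.2 x = 1 :=
  (T.affBasis ⟨K, hK⟩).sum_coord_apply_eq_one x

lemma sum_bary_smul (hK : K ∈ T.elements) (x : Euc d) :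
    ∑ y : K, bary hK y.2 x • (y : Euc d) = x :=
  (T.affBasis ⟨K, hK⟩).linear_combination_coord_eq_self x

lemma affine_eq_sum_bary (hK : K ∈ T.elements) (f : Euc d →ᵃ[ℝ] ℝ) (x : Euc d) :
    f x = ∑ y : K, bary hK y.2 x * f y := by
  conv_lhs => rw [← sum_bary_smul hK x]
  exact AffineMap_apply_sum f _ _ _ (sum_bary hK x)

lemma interior_hull_nonempty (hK : K ∈ T.elements) : (interior (hull K)).Nonempty := by
  rw [hull, ← range_affBasis hK]
  exact ⟨_, (T.affBasis ⟨K, hK⟩).centroid_mem_interior_convexHull⟩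

lemma continuous_bary (hK : K ∈ T.elements) (hy : y ∈ K) : Continuous (bary hK hy) :=
  continuous_barycentric_coord (T.affBasis ⟨K, hK⟩) ⟨y, hy⟩

lemma isCompact_hull (K : Finset (Euc d)) : IsCompact (hull K) :=
  K.finite_toSet.isCompact_convexHull (𝕜 := ℝ)

lemma isClosed_hull (K : Finset (Euc d)) : IsClosed (hull K) := (isCompact_hull K).isClosed

lemma convex_hull (K : Finset (Euc d)) : Convex ℝ (hull K) := convex_convexHull ℝ _

lemma mem_hull_of_mem (hy : y ∈ K) : y ∈ hull K := subset_convexHull ℝ _ hy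

open Classical in
-- Conformity writes a common point as a convex combination of the common vertices, and the
-- barycentric coordinates in either element can only be those weights. Hence coordinates agree
-- across elements, and vanish for vertices that are not shared.
lemma exists_weights (hK : K ∈ T.elements) (hK' : K' ∈ T.elements) (hx : x ∈ hull K)
    (hx' : x ∈ hull K') : ∃ w : Euc d → ℝ,
      (∀ y, ∀ hy : y ∈ K, bary hK hy x = if y ∈ K' then w y else 0) ∧
      (∀ y, ∀ hy : y ∈ K', bary hK' hy x = if y ∈ K then w y else 0) := by
  have hmem : x ∈ convexHull ℝ ((K ∩ K' : Finset (Euc d)) : Set (Euc d)) := by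
    rw [Finset.coe_inter, ← T.conforming K hK K' hK']
    exact ⟨hx, hx'⟩
  obtain ⟨w, -, h1, h2⟩ := Finset.mem_convexHull'.1 hmem
  refine ⟨w, fun y hy => ?_, fun y hy => ?_⟩
  · rw [← h2, AffineMap_apply_sum _ _ _ _ h1]
    have : ∀ z ∈ K ∩ K', w z * bary hK hy z = if z = y then w z else 0 := by
      intro z hz
      split_ifs with h
      · subst h; rw [bary_apply_self, mul_one]
      · rw [bary_apply_ne hK hy (Finset.mem_inter.1 hz).1 (Ne.symm h), mul_zero]
    rw [Finset.sum_congr rfl this, Finset.sum_ite_eq']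
    simp [hy]
  · rw [← h2, AffineMap_apply_sum _ _ _ _ h1]
    have : ∀ z ∈ K ∩ K', w z * bary hK' hy z = if z = y then w z else 0 := by
      intro z hz
      split_ifs with h
      · subst h; rw [bary_apply_self, mul_one]
      · rw [bary_apply_ne hK' hy (Finset.mem_inter.1 hz).2 (Ne.symm h), mul_zero]
    rw [Finset.sum_congr rfl this, Finset.sum_ite_eq']
    simp [hy]

/-- The definition of the hat function chooses an element; by `exists_weights` the choice is
immaterial. -/
lemma hat_eq_bary (hK : K ∈ T.elements) (hy : y ∈ K) (hx : x ∈ hull K) :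
    T.hat y x = bary hK hy x := by
  have h : ∃ K : T.elements, y ∈ (K : Finset (Euc d)) ∧ x ∈ hull (K : Finset (Euc d)) :=
    ⟨⟨K, hK⟩, hy, hx⟩
  rw [hat, dif_pos h]
  obtain ⟨w, h1, h2⟩ := exists_weights hK h.choose.2 hx h.choose_spec.2
  have e1 := h1 y hy
  have e2 := h2 y h.choose_spec.1
  rw [if_pos h.choose_spec.1] at e1
  rw [if_pos hy] at e2
  rw [e1, ← e2]
  rfl

lemma hat_eq_zero_of_notMem (hK : K ∈ T.elements) (hy : y ∉ K) (hx : x ∈ hull K) :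
    T.hat y x = 0 := by
  by_cases h : ∃ K : T.elements, y ∈ (K : Finset (Euc d)) ∧ x ∈ hull (K : Finset (Euc d))
  · rw [hat, dif_pos h]
    obtain ⟨w, -, h2⟩ := exists_weights hK h.choose.2 hx h.choose_spec.2
    have e2 := h2 y h.choose_spec.1
    rw [if_neg hy] at e2
    exact e2
  · rw [hat, dif_neg h]

lemma mem_carrier_iff : x ∈ T.carrier ↔ ∃ K ∈ T.elements, x ∈ hull K := by
  simp [carrier]

lemma hull_subset_carrier (hK : K ∈ T.elements) : hull K ⊆ T.carrier :=
  fun _ hx => mem_carrier_iff.2 ⟨K, hK, hx⟩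

lemma hat_eq_zero_of_notMem_carrier (hx : x ∉ T.carrier) : T.hat y x = 0 := by
  rw [hat, dif_neg]
  rintro ⟨K, -, h⟩
  exact hx (hull_subset_carrier K.2 h)

lemma mem_patch_iff : x ∈ T.patch y ↔ ∃ K ∈ T.elements, y ∈ K ∧ x ∈ hull K := by
  simp [patch, and_assoc]

lemma hat_eq_zero_of_notMem_patch (hx : x ∉ T.patch y) : T.hat y x = 0 := by
  rw [hat, dif_neg]
  rintro ⟨K, h, h'⟩
  apply hx
  exact mem_patch_iff.2 ⟨K, K.2, h, h'⟩

lemma hat_nonneg (y x : Euc d) : 0 ≤ T.hat y x := by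
  by_cases hx : x ∈ T.patch y
  · obtain ⟨K, hK, hy, hx⟩ := mem_patch_iff.1 hx
    rw [hat_eq_bary hK hy hx]
    exact (mem_hull_iff hK).1 hx y hy
  · rw [hat_eq_zero_of_notMem_patch hx]

lemma hat_le_one (y x : Euc d) : T.hat y x ≤ 1 := by
  by_cases hx : x ∈ T.patch y
  · obtain ⟨K, hK, hy, hx⟩ := mem_patch_iff.1 hx
    have h := Finset.single_le_sum (s := Finset.univ) (f := fun y : K => bary hK y.2 x)
      (fun z _ => (mem_hull_iff hK).1 hx z z.2) (Finset.mem_univ (⟨y, hy⟩ : K))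
    rw [sum_bary hK x] at h
    rw [hat_eq_bary hK hy hx]
    exact h
  · rw [hat_eq_zero_of_notMem_patch hx]; exact zero_le_one

lemma hat_apply_self (hy : y ∈ T.nodes) : T.hat y y = 1 := by
  obtain ⟨K, hK, hy⟩ := hy
  rw [hat_eq_bary hK hy (mem_hull_of_mem hy), bary_apply_self]

lemma hat_apply_ne (hz : z ∈ T.nodes) (h : y ≠ z) : T.hat y z = 0 := by
  obtain ⟨K, hK, hz⟩ := hz
  by_cases hy : y ∈ K
  · rw [hat_eq_bary hK hy (mem_hull_of_mem hz), bary_apply_ne hK hy hz h]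
  · exact hat_eq_zero_of_notMem hK hy (mem_hull_of_mem hz)

lemma hat_mem_V (y : Euc d) : T.hat y ∈ T.V := by
  refine ⟨fun K hK => ?_, fun x hx => hat_eq_zero_of_notMem_carrier hx⟩
  by_cases hy : y ∈ K
  · exact ⟨bary hK hy, fun x hx => hat_eq_bary hK hy hx⟩
  · exact ⟨0, fun x hx => by simpa using hat_eq_zero_of_notMem hK hy hx⟩

/-- The nodes, as a finite set. -/
def nodeSet (T : Mesh d) : Finset (Euc d) := by
  classical exact T.elements.biUnion id

lemma mem_nodeSet : y ∈ T.nodeSet ↔ y ∈ T.nodes := by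
  simp [nodeSet, nodes]

lemma nodes_subset_carrier : T.nodes ⊆ T.carrier := by
  rintro y ⟨K, hK, hy⟩
  exact hull_subset_carrier hK (mem_hull_of_mem hy)

lemma finite_nodes (T : Mesh d) : T.nodes.Finite :=
  T.nodeSet.finite_toSet.subset fun _ hy => mem_nodeSet.2 hy

lemma eq_sum_hat_on {w : Euc d → ℝ} (hw : w ∈ T.V) (hK : K ∈ T.elements) (hx : x ∈ hull K) :
    w x = ∑ z ∈ K, w z * T.hat z x := by
  obtain ⟨l, hl⟩ := hw.1 K hK
  rw [hl hx, affine_eq_sum_bary hK l x, ← Finset.sum_coe_sort K]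
  refine Finset.sum_congr rfl fun z _ => ?_
  rw [hat_eq_bary hK z.2 hx, hl (mem_hull_of_mem z.2), mul_comm]

lemma sum_nodeSet_eq (hK : K ∈ T.elements) (hx : x ∈ hull K) (w : Euc d → ℝ) :
    ∑ z ∈ T.nodeSet, w z * T.hat z x = ∑ z ∈ K, w z * T.hat z x := by
  symm
  apply Finset.sum_subset
  · intro z hz; exact mem_nodeSet.2 ⟨K, hK, hz⟩
  · intro z _ hz; rw [hat_eq_zero_of_notMem hK hz hx, mul_zero]

lemma eq_sum_hat {w : Euc d → ℝ} (hw : w ∈ T.V) : w = ∑ z ∈ T.nodeSet, w z • T.hat z := by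
  ext x
  rw [Finset.sum_apply]
  simp only [Pi.smul_apply, smul_eq_mul]
  by_cases hx : x ∈ T.carrier
  · obtain ⟨K, hK, hx⟩ := mem_carrier_iff.1 hx
    rw [sum_nodeSet_eq hK hx, eq_sum_hat_on hw hK hx]
  · rw [hw.2 x hx]
    exact (Finset.sum_eq_zero fun z _ => by
      rw [hat_eq_zero_of_notMem_carrier hx, mul_zero]).symm

/-- The constant function one on the meshed set. -/
def one (T : Mesh d) : Euc d → ℝ := T.carrier.indicator 1

lemma one_apply (hx : x ∈ T.carrier) : T.one x = 1 := by simp [one, hx]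

lemma one_mem_V : T.one ∈ T.V :=
  ⟨fun _ hK => ⟨AffineMap.const ℝ _ 1, fun x hx => by
    simpa using one_apply (hull_subset_carrier hK hx)⟩,
    fun x hx => by simp [one, hx]⟩

lemma one_eq_sum_hat : T.one = ∑ z ∈ T.nodeSet, T.hat z := by
  rw [eq_sum_hat (one_mem_V (T := T))]
  refine Finset.sum_congr rfl fun z hz => ?_
  rw [one_apply (nodes_subset_carrier (mem_nodeSet.1 hz)), one_smul]

lemma isCompact_carrier (T : Mesh d) : IsCompact T.carrier :=
  T.elements.finite_toSet.isCompact_biUnion fun K _ => isCompact_hull K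

lemma continuousOn_carrier {w : Euc d → ℝ} (hw : w ∈ T.V) : ContinuousOn w T.carrier := by
  have : T.carrier = ⋃ K : T.elements, hull (K : Finset (Euc d)) := by
    ext x; simp [carrier]
  rw [this]
  refine LocallyFinite.continuousOn_iUnion (locallyFinite_of_finite _)
    (fun K => isClosed_hull _) fun K => ?_
  obtain ⟨l, hl⟩ := hw.1 K K.2
  exact l.continuous_of_finiteDimensional.continuousOn.congr hl

lemma diam_hull_le (hK : K ∈ T.elements) : Metric.diam (hull K) ≤ T.meshSize :=
  le_ciSup (f := fun K : T.elements => Metric.diam (hull (K : Finset (Euc d))))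
    (Set.finite_range _).bddAbove ⟨K, hK⟩

lemma dist_le_meshSize (hK : K ∈ T.elements) (hx : x ∈ hull K) (hz : z ∈ hull K) :
    dist x z ≤ T.meshSize :=
  (Metric.dist_le_diam_of_mem (isCompact_hull K).isBounded hx hz).trans (diam_hull_le hK)

/-- At an interior point all coordinates are positive, so every vertex of `K` must be shared with
`K'`; equal cardinalities then force equality. -/
lemma interior_hull_disjoint (hK : K ∈ T.elements) (hK' : K' ∈ T.elements) (h : K ≠ K') :
    Disjoint (interior (hull K)) (interior (hull K')) := by
  rw [Set.disjoint_left]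
  intro x hx hx'
  apply h
  obtain ⟨w, h1, -⟩ := exists_weights hK hK' (interior_subset hx) (interior_subset hx')
  refine Finset.eq_of_subset_of_card_le (fun y hy => ?_) ?_
  · by_contra hy'
    have := h1 y hy
    rw [if_neg hy'] at this
    exact absurd this ((mem_interior_hull_iff hK).1 hx y hy).ne'
  · rw [T.card_eq K hK, T.card_eq K' hK']

end Mesh

end HJB

namespace HJB

namespace Mesh

variable {d : ℕ} {T : Mesh d} {K K' : Finset (Euc d)} {x y z : Euc d}

/-! ## Gradients and integrals of piecewise linear functions -/

/-- The gradient is the Riesz representative of the linear part. The second clause holds on the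
closed element, so increments from a vertex are available where the function itself need not be
differentiable. -/
lemma exists_gradient {w : Euc d → ℝ} (hw : w ∈ T.V) (hK : K ∈ T.elements) :
    ∃ G : Euc d, (∀ x ∈ interior (hull K), HasGradientAt w G x) ∧
      ∀ x ∈ hull K, ∀ z ∈ hull K, w z - w x = inner ℝ G (z - x) := by
  obtain ⟨l, hl⟩ := hw.1 K hK
  set L : Euc d →L[ℝ] ℝ := LinearMap.toContinuousLinearMap l.linear with hL
  have hlx : ∀ x, l x = L x + l 0 := fun x => by
    have := congrFun (AffineMap.decomp l) x
    simpa [hL] using this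
  refine ⟨(InnerProductSpace.toDual ℝ (Euc d)).symm L, fun x hx => ?_, fun x hx z hz => ?_⟩
  · rw [hasGradientAt_iff_hasFDerivAt, LinearIsometryEquiv.apply_symm_apply]
    have h1 : HasFDerivAt (fun x => L x + l 0) L x := L.hasFDerivAt.add_const _
    refine h1.congr_of_eventuallyEq ?_
    filter_upwards [isOpen_interior.mem_nhds hx] with z hz
    rw [hl (interior_subset hz), hlx]
  · rw [InnerProductSpace.toDual_symm_apply, hl hx, hl hz, hlx z, hlx x, map_sub]
    ring

lemma differentiableAt {w : Euc d → ℝ} (hw : w ∈ T.V) (hK : K ∈ T.elements)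
    (hx : x ∈ interior (hull K)) : DifferentiableAt ℝ w x := by
  obtain ⟨G, hG, -⟩ := exists_gradient hw hK
  exact (hG x hx).differentiableAt

lemma measurableSet_carrier (T : Mesh d) : MeasurableSet T.carrier :=
  T.isCompact_carrier.isClosed.measurableSet

/-- The boundary of a convex set is null, so integrals and almost-everywhere statements reduce to
open elements, where gradients exist. -/
lemma carrier_ae_eq (T : Mesh d) :
    (T.carrier : Set (Euc d)) =ᵐ[volume] ⋃ K ∈ T.elements, interior (hull K) := by
  refine ae_eq_set.2 ⟨?_, ?_⟩
  · refine measure_mono_null (t := ⋃ K ∈ T.elements, frontier (hull K)) ?_ ?_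
    · rintro x ⟨hx, hx'⟩
      obtain ⟨K, hK, hx⟩ := mem_carrier_iff.1 hx
      simp only [mem_iUnion, not_exists] at hx' ⊢
      exact ⟨K, hK, subset_closure hx, hx' K hK⟩
    · exact (measure_biUnion_null_iff T.elements.countable_toSet).2
        fun K _ => (convex_hull K).addHaar_frontier volume
  · rw [sdiff_eq_empty.2, measure_empty]
    exact iUnion₂_mono fun K _ => interior_subset

lemma ae_of_interior {p : Euc d → Prop}
    (h : ∀ K ∈ T.elements, ∀ x ∈ interior (hull K), p x) :
    ∀ᵐ x ∂(volume.restrict T.carrier), p x := by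
  rw [Measure.restrict_congr_set T.carrier_ae_eq]
  refine (ae_restrict_iff' ?_).2 (Eventually.of_forall fun x hx => ?_)
  · exact Finset.measurableSet_biUnion _ fun K _ => isOpen_interior.measurableSet
  · obtain ⟨K, hK, hx⟩ := mem_iUnion₂.1 hx
    exact h K hK x hx

lemma integral_carrier {f : Euc d → ℝ} (hf : IntegrableOn f T.carrier) :
    ∫ x in T.carrier, f x = ∑ K ∈ T.elements, ∫ x in interior (hull K), f x := by
  rw [Measure.restrict_congr_set T.carrier_ae_eq]
  refine integral_biUnion_finset _ (fun K _ => isOpen_interior.measurableSet) ?_ ?_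
  · intro K hK K' hK' h
    exact interior_hull_disjoint hK hK' h
  · intro K hK
    exact hf.mono_set (interior_subset.trans (hull_subset_carrier hK))

lemma measurable_gradient (w : Euc d → ℝ) : Measurable (gradient w) :=
  (InnerProductSpace.toDual ℝ (Euc d)).symm.continuous.measurable.comp (measurable_fderiv ℝ w)

lemma exists_gradient_bound {w : Euc d → ℝ} (hw : w ∈ T.V) :
    ∃ C, ∀ K ∈ T.elements, ∀ x ∈ interior (hull K), ‖gradient w x‖ ≤ C := by
  have : ∀ K : T.elements, ∃ C, ∀ x ∈ interior (hull (K : Finset (Euc d))),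
      ‖gradient w x‖ ≤ C := fun K => by
    obtain ⟨G, hG, -⟩ := exists_gradient hw K.2
    exact ⟨‖G‖, fun x hx => by rw [(hG x hx).gradient]⟩
  choose C hC using this
  obtain ⟨M, hM⟩ := (Set.finite_range C).bddAbove
  exact ⟨M, fun K hK x hx => (hC ⟨K, hK⟩ x hx).trans (hM ⟨⟨K, hK⟩, rfl⟩)⟩

lemma exists_bound {F : Type*} [NormedAddCommGroup F] {w : Euc d → F}
    (hw : ContinuousOn w T.carrier) : ∃ C, ∀ x ∈ T.carrier, ‖w x‖ ≤ C :=
  T.isCompact_carrier.exists_bound_of_continuousOn hw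

lemma integrableOn_carrier_of_bound {f : Euc d → ℝ}
    (hf : AEStronglyMeasurable f (volume.restrict T.carrier)) {C : ℝ}
    (hC : ∀ K ∈ T.elements, ∀ x ∈ interior (hull K), ‖f x‖ ≤ C) : IntegrableOn f T.carrier :=
  IntegrableOn.of_bound T.isCompact_carrier.measure_lt_top hf C (ae_of_interior hC)

lemma integrableOn_inner_gradient {u w : Euc d → ℝ} (hu : u ∈ T.V) (hw : w ∈ T.V) :
    IntegrableOn (fun x => inner ℝ (gradient u x) (gradient w x)) T.carrier := by
  obtain ⟨C, hC⟩ := exists_gradient_bound hu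
  obtain ⟨C', hC'⟩ := exists_gradient_bound hw
  refine integrableOn_carrier_of_bound (C := C * C') ?_ fun K hK x hx => ?_
  · exact ((measurable_gradient u).inner (measurable_gradient w)).aestronglyMeasurable
  · exact (norm_inner_le_norm _ _).trans (mul_le_mul (hC K hK x hx) (hC' K hK x hx)
      (norm_nonneg _) ((norm_nonneg _).trans (hC K hK x hx)))

lemma integrableOn_lower {b : Euc d → Euc d} {c : Euc d → ℝ} (hb : ContinuousOn b T.carrier)
    (hc : ContinuousOn c T.carrier) {w u : Euc d → ℝ} (hw : w ∈ T.V) (hu : u ∈ T.V) :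
    IntegrableOn (fun x => (-(inner ℝ (b x) (gradient w x)) + c x * w x) * u x) T.carrier := by
  obtain ⟨C, hC⟩ := exists_gradient_bound hw
  obtain ⟨B, hB⟩ := exists_bound hb
  obtain ⟨E, hE⟩ := exists_bound (hc.mul (continuousOn_carrier hw))
  obtain ⟨U, hU⟩ := exists_bound (continuousOn_carrier hu)
  refine integrableOn_carrier_of_bound (C := (B * C + E) * U) ?_ fun K hK x hx => ?_
  · have hT := T.measurableSet_carrier
    have hcompact := T.isCompact_carrier
    exact (((hb.aestronglyMeasurable hT).inner
      (measurable_gradient w).aestronglyMeasurable).neg.add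
      ((hc.mul (continuousOn_carrier hw)).aestronglyMeasurable hT)).mul
      ((continuousOn_carrier hu).aestronglyMeasurable hT)
  · have hx' := hull_subset_carrier hK (interior_subset hx)
    rw [norm_mul]
    have h1 : ‖-(inner ℝ (b x) (gradient w x)) + c x * w x‖ ≤ B * C + E := by
      refine (norm_add_le _ _).trans (add_le_add ?_ (hE x hx'))
      rw [norm_neg]
      exact (norm_inner_le_norm _ _).trans (mul_le_mul (hB x hx') (hC K hK x hx)
        (norm_nonneg _) ((norm_nonneg _).trans (hB x hx')))
    exact mul_le_mul h1 (hU x hx') (norm_nonneg _) ((norm_nonneg _).trans h1)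

lemma integrableOn_of_mem_V {w : Euc d → ℝ} (hw : w ∈ T.V) : IntegrableOn w T.carrier :=
  (continuousOn_carrier hw).integrableOn_compact T.isCompact_carrier

/-! ## Normalised hat functions -/

/-- The `L^1` norm of a hat function. -/
def mass (T : Mesh d) (y : Euc d) : ℝ := ∫ z in T.carrier, |T.hat y z|

lemma mass_eq (T : Mesh d) (y : Euc d) : T.mass y = ∫ z in T.carrier, T.hat y z := by
  simp only [mass, abs_of_nonneg (hat_nonneg _ _)]

lemma mass_pos (hy : y ∈ T.nodes) : 0 < T.mass y := by
  rw [mass_eq, setIntegral_pos_iff_support_of_nonneg_ae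
    (Eventually.of_forall fun x => hat_nonneg y x) (integrableOn_of_mem_V (hat_mem_V y))]
  obtain ⟨K, hK, hy⟩ := hy
  refine lt_of_lt_of_le (isOpen_interior.measure_pos volume (interior_hull_nonempty hK))
    (measure_mono fun x hx => ⟨?_, hull_subset_carrier hK (interior_subset hx)⟩)
  rw [Function.mem_support, hat_eq_bary hK hy (interior_subset hx)]
  exact ((mem_interior_hull_iff hK).1 hx y hy).ne'

lemma nhat_eq_smul (T : Mesh d) (y : Euc d) : T.nhat y = (T.mass y)⁻¹ • T.hat y := by
  ext x
  simp [nhat, mass, div_eq_inv_mul]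

lemma nhat_mem_V (y : Euc d) : T.nhat y ∈ T.V := by
  rw [nhat_eq_smul]; exact T.V.smul_mem _ (hat_mem_V y)

lemma nhat_nonneg (hy : y ∈ T.nodes) (x : Euc d) : 0 ≤ T.nhat y x := by
  rw [nhat_eq_smul]
  exact mul_nonneg (inv_nonneg.2 (mass_pos hy).le) (hat_nonneg _ _)

lemma integral_nhat (hy : y ∈ T.nodes) : ∫ x in T.carrier, T.nhat y x = 1 := by
  simp only [nhat_eq_smul, Pi.smul_apply, smul_eq_mul]
  rw [integral_const_mul, ← mass_eq, inv_mul_cancel₀ (mass_pos hy).ne']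

lemma integrableOn_nhat (y : Euc d) : IntegrableOn (T.nhat y) T.carrier :=
  integrableOn_of_mem_V (nhat_mem_V y)

/-- A weighted mean against a normalised hat function is close to any value close to the
integrand on the patch. -/
lemma abs_integral_mul_nhat_sub_le {f : Euc d → ℝ} {r ε : ℝ} (hy : y ∈ T.nodes)
    (hf : IntegrableOn (fun x => f x * T.nhat y x) T.carrier)
    (h : ∀ K ∈ T.elements, y ∈ K → ∀ x ∈ interior (hull K), |f x - r| ≤ ε) :
    |(∫ x in T.carrier, f x * T.nhat y x) - r| ≤ ε := by
  have e : (∫ x in T.carrier, f x * T.nhat y x) - r =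
      ∫ x in T.carrier, (f x - r) * T.nhat y x := by
    have : r = ∫ x in T.carrier, r * T.nhat y x := by
      rw [integral_const_mul, integral_nhat hy, mul_one]
    conv_lhs => rw [this]
    rw [← integral_sub hf ((integrableOn_nhat y).const_mul r)]
    simp only [sub_mul]
  have e' : ε = ∫ x in T.carrier, ε * T.nhat y x := by
    rw [integral_const_mul, integral_nhat hy, mul_one]
  rw [e, e', ← Real.norm_eq_abs]
  refine norm_integral_le_of_norm_le ((integrableOn_nhat y).const_mul ε) (ae_of_interior ?_)
  intro K hK x hx
  rw [norm_mul, Real.norm_eq_abs, Real.norm_of_nonneg (nhat_nonneg hy x)]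
  by_cases hyK : y ∈ K
  · exact mul_le_mul_of_nonneg_right (h K hK hyK x hx) (nhat_nonneg hy x)
  · have : T.nhat y x = 0 := by
      rw [nhat_eq_smul, Pi.smul_apply, hat_eq_zero_of_notMem hK hyK (interior_subset hx), smul_zero]
    simp [this]

end Mesh

end HJB

namespace HJB

namespace Mesh

variable {d : ℕ} {T : Mesh d} {K K' : Finset (Euc d)} {x y z : Euc d}

/-! ## Rows of monotone type -/

/-- Two nodes are neighbours when they are vertices of a common element. -/
def Nbr (T : Mesh d) (y z : Euc d) : Prop := ∃ K ∈ T.elements, y ∈ K ∧ z ∈ K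

lemma Nbr.dist_le (h : T.Nbr y z) : dist y z ≤ T.meshSize := by
  obtain ⟨K, hK, hy, hz⟩ := h
  exact dist_le_meshSize hK (mem_hull_of_mem hy) (mem_hull_of_mem hz)

lemma Nbr.mem_nodes (h : T.Nbr y z) : z ∈ T.nodes := by
  obtain ⟨K, hK, -, hz⟩ := h
  exact ⟨K, hK, hz⟩

lemma Nbr.refl (hy : y ∈ T.nodes) : T.Nbr y y := by
  obtain ⟨K, hK, hy⟩ := hy
  exact ⟨K, hK, hy, hy⟩

/-- A row, belonging to the node `y`, of a matrix on the nodes of the mesh: it is supported on the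
neighbours of `y`, its off-diagonal entries are nonpositive and its row sum is nonnegative. -/
structure IsMonoRow (T : Mesh d) (y : Euc d) (L : (Euc d → ℝ) → ℝ) : Prop where
  add : ∀ u ∈ T.V, ∀ v ∈ T.V, L (u + v) = L u + L v
  smul : ∀ (r : ℝ), ∀ u ∈ T.V, L (r • u) = r * L u
  offdiag : ∀ z ∈ T.nodes, z ≠ y → L (T.hat z) ≤ 0
  support : ∀ z ∈ T.nodes, ¬ T.Nbr y z → L (T.hat z) = 0
  one_nonneg : 0 ≤ L T.one

namespace IsMonoRow

variable {L : (Euc d → ℝ) → ℝ}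

lemma zero (T : Mesh d) (y : Euc d) : IsMonoRow T y fun _ => 0 :=
  ⟨by simp, by simp, by simp, by simp, le_rfl⟩

lemma neg (h : IsMonoRow T y L) {u : Euc d → ℝ} (hu : u ∈ T.V) : L (-u) = -L u := by
  have := h.smul (-1) u hu
  simpa using this

lemma sub (h : IsMonoRow T y L) {u v : Euc d → ℝ} (hu : u ∈ T.V) (hv : v ∈ T.V) :
    L (u - v) = L u - L v := by
  rw [sub_eq_add_neg, h.add u hu _ (T.V.neg_mem hv), h.neg hv, sub_eq_add_neg]

lemma map_sum (h : IsMonoRow T y L) (s : Finset (Euc d)) (a : Euc d → ℝ) :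
    L (∑ z ∈ s, a z • T.hat z) = ∑ z ∈ s, a z * L (T.hat z) := by
  classical
  induction s using Finset.induction_on with
  | empty =>
    have := h.smul 0 0 T.V.zero_mem
    simpa using this
  | insert z s hz ih =>
    rw [Finset.sum_insert hz, Finset.sum_insert hz, h.add _ (T.V.smul_mem _ (hat_mem_V z)) _
      (T.V.sum_mem fun i _ => T.V.smul_mem _ (hat_mem_V i)), h.smul _ _ (hat_mem_V z), ih]

/-- The discrete maximum principle for one row. -/
theorem le (h : IsMonoRow T y L) (hy : y ∈ T.nodes) {w : Euc d → ℝ} (hw : w ∈ T.V) {m : ℝ}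
    (hm : 0 ≤ m) (hle : ∀ z, T.Nbr y z → w z ≤ m) : (w y - m) * L (T.hat y) ≤ L w := by
  have h1 : L w = ∑ z ∈ T.nodeSet, w z * L (T.hat z) := by
    conv_lhs => rw [eq_sum_hat hw]
    exact h.map_sum _ _
  have h2 : L T.one = ∑ z ∈ T.nodeSet, L (T.hat z) := by
    have := h.map_sum T.nodeSet fun _ => 1
    simp only [one_smul, one_mul] at this
    rw [one_eq_sum_hat, this]
  -- Hat functions sum to one, so subtracting `m` from all nodal values costs `m` times the row sum.
  -- After that every off-diagonal term is a product of two nonpositive factors. The sign of `m` is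
  -- needed because the row sum is only known to be nonnegative.
  have h3 : L w - m * L T.one = ∑ z ∈ T.nodeSet, (w z - m) * L (T.hat z) := by
    rw [h1, h2, Finset.mul_sum, ← Finset.sum_sub_distrib]
    exact Finset.sum_congr rfl fun z _ => by ring
  have h4 : (w y - m) * L (T.hat y) ≤ ∑ z ∈ T.nodeSet, (w z - m) * L (T.hat z) := by
    classical
    rw [← Finset.add_sum_erase _ _ (mem_nodeSet.2 hy)]
    refine le_add_of_nonneg_right (Finset.sum_nonneg fun z hz => ?_)
    obtain ⟨hzy, hz⟩ := Finset.mem_erase.1 hz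
    have hz := mem_nodeSet.1 hz
    by_cases hn : T.Nbr y z
    · exact mul_nonneg_of_nonpos_of_nonpos (sub_nonpos.2 (hle z hn)) (h.offdiag z hz hzy)
    · rw [h.support z hz hn, mul_zero]
  have := mul_nonneg hm h.one_nonneg
  linarith

/-- The row applied to a function close to a constant near the node. -/
theorem abs_le (h : IsMonoRow T y L) (hy : y ∈ T.nodes) {τ : ℝ} (hτ : 0 ≤ τ)
    (hdiag : τ * L (T.hat y) ≤ 1) {w : Euc d → ℝ} (hw : w ∈ T.V) {κ : ℝ} (hκ : 0 ≤ κ)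
    (hosc : ∀ z, T.Nbr y z → |w z - w y| ≤ κ) :
    τ * |L w| ≤ τ * |w y| * L T.one + κ := by
  -- Removing the value at `y` leaves a function that vanishes at `y` and is at most `κ` in modulus
  -- on the neighbours; the maximum principle for `u` and `-u` bounds the row by `κ` times its
  -- diagonal entry.
  set u : Euc d → ℝ := w - w y • T.one with hu
  have huV : u ∈ T.V := T.V.sub_mem hw (T.V.smul_mem _ one_mem_V)
  have huz : ∀ z, T.Nbr y z → u z = w z - w y := fun z hz => by
    simp [hu, one_apply (nodes_subset_carrier hz.mem_nodes)]
  have huy : u y = 0 := by rw [huz y (Nbr.refl hy), sub_self]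
  have h1 := h.le hy huV hκ fun z hz => by rw [huz z hz]; exact (_root_.abs_le.1 (hosc z hz)).2
  have h2 := h.le hy (T.V.neg_mem huV) hκ fun z hz => by
    rw [Pi.neg_apply, huz z hz]; linarith [(_root_.abs_le.1 (hosc z hz)).1]
  rw [h.neg huV, Pi.neg_apply] at h2
  rw [huy] at h1 h2
  have h3 : L w = L u + w y * L T.one := by
    rw [hu, h.sub hw (T.V.smul_mem _ one_mem_V), h.smul _ _ one_mem_V]; ring
  have h4 : τ * |L u| ≤ κ := by
    rw [show τ * |L u| = |τ * L u| by rw [abs_mul, abs_of_nonneg hτ]]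
    have h5 : κ * (τ * L (T.hat y)) ≤ κ := by nlinarith
    have h6 := mul_le_mul_of_nonneg_left h1 hτ
    have h7 := mul_le_mul_of_nonneg_left h2 hτ
    exact _root_.abs_le.2 ⟨by linarith, by linarith⟩
  have h6 : |L w| ≤ |L u| + |w y| * L T.one := by
    rw [h3]
    refine (abs_add_le _ _).trans ?_
    rw [abs_mul, abs_of_nonneg h.one_nonneg]
  have h7 := mul_le_mul_of_nonneg_left h6 hτ
  linarith

end IsMonoRow

/-! ## Boundary rows -/

/-- Finitely many elements cover the ray, so one of them meets it arbitrarily close to `y`. Being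
closed it contains `y`, and by convexity it contains an initial segment, on which every piecewise
affine function is affine. The difference quotients are thus constant there, and one segment serves
all functions at once. -/
lemma exists_segment {e : Euc d} (hy : y ∈ T.nodes) (he : e ∈ tangentCone T.carrier y) :
    ∃ l : ℝ, 0 < l ∧ ∃ K ∈ T.elements, y ∈ K ∧ y + l • e ∈ hull K ∧
      ∀ w ∈ T.V, diniDeriv w y e = (w y - w (y + l • e)) / l := by
  obtain ⟨Λ, hΛ, hseg⟩ := he
  have h1 : ∃ᶠ l in 𝓝[>] (0 : ℝ), ∃ K ∈ T.elements, y + l • e ∈ hull K := by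
    refine Eventually.frequently ?_
    filter_upwards [Ioc_mem_nhdsGT hΛ] with l hl
    exact mem_carrier_iff.1 (hseg l ⟨hl.1.le, hl.2⟩)
  have h2 : ∃ K ∈ T.elements, ∃ᶠ l in 𝓝[>] (0 : ℝ), y + l • e ∈ hull K := by
    by_contra hcon
    push Not at hcon
    apply h1
    have : ∀ᶠ l in 𝓝[>] (0 : ℝ), ∀ K ∈ T.elements, y + l • e ∉ hull K :=
      (Filter.eventually_all_finset _).2 hcon
    filter_upwards [this] with l hl
    rintro ⟨K, hK, h⟩
    exact hl K hK h
  obtain ⟨K, hK, hfreq⟩ := h2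
  have hyhull : y ∈ hull K := by
    have hc : Tendsto (fun l : ℝ => y + l • e) (𝓝[>] 0) (𝓝 y) := by
      have : Continuous fun l : ℝ => y + l • e := by fun_prop
      simpa using (this.tendsto 0).mono_left nhdsWithin_le_nhds
    exact (isClosed_hull K).mem_of_frequently_of_tendsto hfreq hc
  -- A node lying in an element is a vertex of it: otherwise its hat function would vanish on the
  -- element, yet it equals one at the node.
  have hyK : y ∈ K := by
    by_contra hyK
    have := hat_eq_zero_of_notMem hK hyK hyhull
    rw [hat_apply_self hy] at this
    exact one_ne_zero this
  obtain ⟨l, hl, hl0⟩ := (hfreq.and_eventually self_mem_nhdsWithin).exists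
  have hl0 : 0 < l := hl0
  refine ⟨l, hl0, K, hK, hyK, hl, fun w hw => ?_⟩
  obtain ⟨G, -, hG⟩ := exists_gradient hw hK
  have hval : ∀ s, y + s • e ∈ hull K → w y - w (y + s • e) = -(s * inner ℝ G e) := by
    intro s hs
    have := hG y hyhull _ hs
    rw [add_sub_cancel_left, inner_smul_right] at this
    linarith
  have heq : (fun s : ℝ => (w y - w (y + s • e)) / s) =ᶠ[𝓝[>] 0] fun _ => -inner ℝ G e := by
    filter_upwards [Ioc_mem_nhdsGT hl0] with s hs
    have hmem : y + s • e ∈ hull K := by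
      have := (convex_hull K).add_smul_mem hyhull hl (t := s / l)
        ⟨div_nonneg hs.1.le hl0.le, (div_le_one hl0).2 hs.2⟩
      rwa [smul_smul, div_mul_cancel₀ _ hl0.ne'] at this
    rw [hval s hmem]
    field_simp [hs.1.ne']
  rw [diniDeriv, Filter.liminf_congr heq, hval l hl]
  simp only [liminf_const]
  field_simp

/-- The hat function of another node is zero at `y` and nonnegative at the far end of the segment,
so its quotient is nonpositive. Constants have quotient zero, so the row sum is `c y`. -/
lemma isMonoRow_bdRow {b : Euc d → Euc d} {c : Euc d → ℝ} (hy : y ∈ T.nodes)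
    (hb : b y ∈ tangentCone T.carrier y) (hc : 0 ≤ c y) : IsMonoRow T y (bdRow b c · y) := by
  obtain ⟨l, hl, K, hK, hyK, hmem, hdini⟩ := exists_segment hy hb
  refine ⟨fun u hu v hv => ?_, fun r u hu => ?_, fun z hz hzy => ?_, fun z hz hn => ?_, ?_⟩
  · simp only [bdRow, hdini _ hu, hdini _ hv, hdini _ (T.V.add_mem hu hv), Pi.add_apply]
    ring
  · simp only [bdRow, hdini _ hu, hdini _ (T.V.smul_mem r hu), Pi.smul_apply, smul_eq_mul]
    ring
  · simp only [bdRow, hdini _ (hat_mem_V z), hat_apply_ne hy hzy, mul_zero, add_zero, zero_sub]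
    exact div_nonpos_of_nonpos_of_nonneg (neg_nonpos.2 (hat_nonneg _ _)) hl.le
  · have hzK : z ∉ K := fun h => hn ⟨K, hK, hyK, h⟩
    simp only [bdRow, hdini _ (hat_mem_V z), hat_eq_zero_of_notMem hK hzK hmem,
      hat_eq_zero_of_notMem hK hzK (mem_hull_of_mem hyK)]
    simp
  · simp only [bdRow, hdini _ one_mem_V, one_apply (hull_subset_carrier hK hmem),
      one_apply (nodes_subset_carrier hy)]
    simpa using hc

lemma bdRow_one {b : Euc d → Euc d} {c : Euc d → ℝ} (hy : y ∈ T.nodes)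
    (hb : b y ∈ tangentCone T.carrier y) : bdRow b c T.one y = c y := by
  obtain ⟨l, hl, K, hK, hyK, hmem, hdini⟩ := exists_segment hy hb
  simp only [bdRow, hdini _ one_mem_V, one_apply (hull_subset_carrier hK hmem),
      one_apply (nodes_subset_carrier hy)]
  simp

/-- The Dini derivative of a piecewise linear function, in terms of a nearby gradient. -/
lemma abs_diniDeriv_add_inner_le {e g : Euc d} {ε : ℝ} (hy : y ∈ T.nodes)
    (he : e ∈ tangentCone T.carrier y) {w : Euc d → ℝ} (hw : w ∈ T.V)
    (hg : ∀ K ∈ T.elements, y ∈ K → ∃ x ∈ interior (hull K), ‖gradient w x - g‖ ≤ ε) :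
    |diniDeriv w y e + inner ℝ e g| ≤ ‖e‖ * ε := by
  obtain ⟨l, hl, K, hK, hyK, hmem, hdini⟩ := exists_segment hy he
  obtain ⟨G, hG, hG'⟩ := exists_gradient hw hK
  obtain ⟨x, hx, hxg⟩ := hg K hK hyK
  have h1 := hG' y (mem_hull_of_mem hyK) _ hmem
  rw [add_sub_cancel_left, inner_smul_right] at h1
  have h2 : diniDeriv w y e = -inner ℝ G e := by
    rw [hdini w hw, ← neg_sub, h1]
    field_simp
  rw [(hG x hx).gradient] at hxg
  have h3 : -inner ℝ G e + inner ℝ e g = inner ℝ e (g - G) := by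
    rw [inner_sub_right, real_inner_comm e G]; ring
  rw [norm_sub_rev] at hxg
  rw [h2, h3]
  calc |inner ℝ e (g - G)| ≤ ‖e‖ * ‖g - G‖ := abs_real_inner_le_norm _ _
    _ ≤ _ := mul_le_mul_of_nonneg_left hxg (norm_nonneg _)

end Mesh

end HJB

namespace HJB

namespace Mesh

variable {d : ℕ} {T : Mesh d} {K K' : Finset (Euc d)} {x y z : Euc d}

/-! ## Domain rows -/

lemma gradient_add_of_mem {u v : Euc d → ℝ} (hu : u ∈ T.V) (hv : v ∈ T.V) (hK : K ∈ T.elements)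
    (hx : x ∈ interior (hull K)) : gradient (u + v) x = gradient u x + gradient v x := by
  simp only [gradient, fderiv_add (differentiableAt hu hK hx) (differentiableAt hv hK hx), map_add]

lemma gradient_smul_of_mem (r : ℝ) {u : Euc d → ℝ} (hu : u ∈ T.V) (hK : K ∈ T.elements)
    (hx : x ∈ interior (hull K)) : gradient (r • u) x = r • gradient u x := by
  simp only [gradient, fderiv_const_smul (differentiableAt hu hK hx), map_smul]

lemma gradient_eq_zero_of_const {w : Euc d → ℝ} {r : ℝ} (hw : ∀ x ∈ hull K, w x = r)
    (hx : x ∈ interior (hull K)) : gradient w x = 0 := by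
  have : w =ᶠ[𝓝 x] fun _ => r := by
    filter_upwards [isOpen_interior.mem_nhds hx] with z hz using hw z (interior_subset hz)
  rw [this.gradient_eq, gradient_fun_const]

/-- The bound `hC` is essential: the real supremum of an unbounded set has the default value zero.
-/
lemma le_supOn {X F : Type*} [NormedAddCommGroup F] {u : X → F} {S : Set X} {C : ℝ}
    (hC : ∀ x ∈ S, ‖u x‖ ≤ C) {x : X} (hx : x ∈ S) : ‖u x‖ ≤ supOn u S :=
  le_csSup ⟨C, by rintro _ ⟨x, hx, rfl⟩; exact hC x hx⟩ ⟨x, hx, rfl⟩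

lemma norm_le_vecSup {u : Euc d → Euc d} {S : Set (Euc d)} {C : ℝ} (hC : ∀ x ∈ S, ‖u x‖ ≤ C)
    (hx : x ∈ S) : ‖u x‖ ≤ vecSup u S := by
  rw [EuclideanSpace.norm_eq, vecSup]
  refine Real.sqrt_le_sqrt (Finset.sum_le_sum fun j _ => ?_)
  have : ‖u x j‖ ≤ supOn (fun x => u x j) S :=
    le_supOn (u := fun x => u x j) (C := C)
      (fun x hx => (PiLp.norm_apply_le (u x) j).trans (hC x hx)) hx
  exact pow_le_pow_left₀ (norm_nonneg _) this 2

lemma vecSup_const {u : Euc d → Euc d} {S : Set (Euc d)} {N : Euc d} (hS : S.Nonempty)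
    (hN : ∀ x ∈ S, u x = N) : vecSup u S = ‖N‖ := by
  rw [EuclideanSpace.norm_eq, vecSup]
  congr 1
  refine Finset.sum_congr rfl fun j _ => ?_
  congr 1
  have : (fun x => ‖u x j‖) '' S = {‖N j‖} := by
    rw [← hS.image_const (‖N j‖)]
    exact image_congr fun x hx => by rw [hN x hx]
  rw [supOn, this, csSup_singleton]

lemma volume_real_interior_hull (K : Finset (Euc d)) :
    volume.real (interior (hull K)) = volume.real (hull K) := by
  have h : (interior (hull K) : Set (Euc d)) =ᵐ[volume] hull K := by
    refine ae_eq_set.2 ⟨?_, ?_⟩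
    · rw [sdiff_eq_empty.2 interior_subset, measure_empty]
    · refine measure_mono_null ?_ ((convex_hull K).addHaar_frontier volume)
      exact fun x hx => ⟨subset_closure hx.1, hx.2⟩
  exact measureReal_congr h

/-- The contribution of an element to an off-diagonal entry of a domain row vanishes unless both
nodes belong to the element. -/
lemma elementEntry_eq_zero (a : ℝ) (b : Euc d → Euc d) (c : Euc d → ℝ)
    (hK : K ∈ T.elements) (h : y ∉ K ∨ z ∉ K) :
    a * (∫ x in interior (hull K), inner ℝ (gradient (T.hat z) x) (gradient (T.nhat y) x)) +
      ∫ x in interior (hull K),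
        (-(inner ℝ (b x) (gradient (T.hat z) x)) + c x * T.hat z x) * T.nhat y x = 0 := by
  rcases h with h | h
  · have h0 : ∀ x ∈ hull K, T.nhat y x = 0 := fun x hx => by
      rw [nhat_eq_smul, Pi.smul_apply, hat_eq_zero_of_notMem hK h hx, smul_zero]
    rw [setIntegral_eq_zero_of_forall_eq_zero fun x hx => ?_,
      setIntegral_eq_zero_of_forall_eq_zero fun x hx => ?_, mul_zero, add_zero]
    · rw [h0 x (interior_subset hx), mul_zero]
    · rw [gradient_eq_zero_of_const h0 hx, inner_zero_right]
  · have h0 : ∀ x ∈ hull K, T.hat z x = 0 := fun x hx => hat_eq_zero_of_notMem hK h hx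
    rw [setIntegral_eq_zero_of_forall_eq_zero fun x hx => ?_,
      setIntegral_eq_zero_of_forall_eq_zero fun x hx => ?_, mul_zero, add_zero]
    · rw [gradient_eq_zero_of_const h0 hx, h0 x (interior_subset hx), inner_zero_right]
      simp
    · rw [gradient_eq_zero_of_const h0 hx, inner_zero_left]

/-- Acuteness bounds the diffusion part by minus `ν sin θ |∇φ̂_y| |∇φ_z| vol K`. As `φ̂_y` has
integral at most one over `K`, the lower-order part is at most `|b|_K |∇φ_z| + ‖c‖`. The artificial
diffusion condition, multiplied by `|∇φ_z|`, compares the two. -/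
lemma elementEntry_nonpos {a ν θ : ℝ} {b : Euc d → Euc d} {c : Euc d → ℝ}
    (hb : ContinuousOn b T.carrier) (hc : ContinuousOn c T.carrier)
    (hθ : T.StrictlyAcute θ) (hν : 0 ≤ ν) (hνa : ν ≤ a)
    (hK : K ∈ T.elements) (hy : y ∈ K) (hz : z ∈ K) (hzy : z ≠ y)
    (hart : vecSup b (hull K) + Metric.diam (hull K) * supOn c (hull K) ≤
      ν * Real.sin θ * vecSup (gradient (T.nhat y)) (interior (hull K)) * volume.real (hull K)) :
    a * (∫ x in interior (hull K), inner ℝ (gradient (T.hat z) x) (gradient (T.nhat y) x)) +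
      ∫ x in interior (hull K),
        (-(inner ℝ (b x) (gradient (T.hat z) x)) + c x * T.hat z x) * T.nhat y x ≤ 0 := by
  have hI : MeasurableSet (interior (hull K)) := isOpen_interior.measurableSet
  have hyn : y ∈ T.nodes := ⟨K, hK, hy⟩
  have hzn : z ∈ T.nodes := ⟨K, hK, hz⟩
  obtain ⟨x₀, hx₀⟩ := interior_hull_nonempty hK
  obtain ⟨Gy, hGy, -⟩ := exists_gradient (hat_mem_V (T := T) y) hK
  obtain ⟨Gz, hGz, hGz'⟩ := exists_gradient (hat_mem_V (T := T) z) hK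
  have hm := mass_pos hyn
  set N := (T.mass y)⁻¹ • Gy with hN
  have hgN : ∀ x ∈ interior (hull K), gradient (T.nhat y) x = N := fun x hx => by
    rw [nhat_eq_smul, gradient_smul_of_mem _ (hat_mem_V y) hK hx, (hGy x hx).gradient]
  have hgz : ∀ x ∈ interior (hull K), gradient (T.hat z) x = Gz := fun x hx => (hGz x hx).gradient
  rw [vecSup_const ⟨x₀, hx₀⟩ hgN] at hart
  have hacute : inner ℝ Gz N ≤ -(Real.sin θ) * ‖N‖ * ‖Gz‖ := by
    have := hθ.2.2 K hK y hyn z hzn hzy.symm x₀ hx₀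
    rw [(hGy x₀ hx₀).gradient, hgz x₀ hx₀] at this
    rw [hN, inner_smul_right, norm_smul, Real.norm_of_nonneg (inv_nonneg.2 hm.le),
      real_inner_comm]
    calc (T.mass y)⁻¹ * inner ℝ Gy Gz ≤ (T.mass y)⁻¹ * (-(Real.sin θ) * ‖Gy‖ * ‖Gz‖) :=
          mul_le_mul_of_nonneg_left this (inv_nonneg.2 hm.le)
      _ = _ := by ring
  -- The hat function of `z` climbs from zero to one along the edge from `y` to `z`. This supplies
  -- the factor `|∇φ_z| diam K` needed to absorb the zeroth-order term.
  have hdiam : 1 ≤ ‖Gz‖ * Metric.diam (hull K) := by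
    have h1 := hGz' y (mem_hull_of_mem hy) z (mem_hull_of_mem hz)
    rw [hat_apply_self hzn, hat_apply_ne hyn hzy, sub_zero] at h1
    calc (1 : ℝ) = inner ℝ Gz (z - y) := h1
      _ ≤ ‖Gz‖ * ‖z - y‖ := real_inner_le_norm _ _
      _ ≤ _ := by
        refine mul_le_mul_of_nonneg_left ?_ (norm_nonneg _)
        rw [← dist_eq_norm]
        exact Metric.dist_le_diam_of_mem (isCompact_hull K).isBounded (mem_hull_of_mem hz)
          (mem_hull_of_mem hy)
  have hsub : hull K ⊆ T.carrier := hull_subset_carrier hK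
  obtain ⟨B, hB⟩ := exists_bound hb
  obtain ⟨C, hC⟩ := exists_bound hc
  set vb := vecSup b (hull K)
  set sc := supOn c (hull K)
  have hsc : 0 ≤ sc := (norm_nonneg (c x₀)).trans
    (le_supOn (fun x hx => hC x (hsub hx)) (interior_subset hx₀))
  have h1 : ∫ x in interior (hull K), inner ℝ (gradient (T.hat z) x) (gradient (T.nhat y) x) =
      volume.real (hull K) * inner ℝ Gz N := by
    rw [setIntegral_congr_fun (g := fun _ => inner ℝ Gz N) hI fun x hx => by
      simp only [hgN x hx, hgz x hx]]
    rw [setIntegral_const, volume_real_interior_hull, smul_eq_mul]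
  have hint := (integrableOn_nhat (T := T) y).mono_set (interior_subset.trans hsub)
  have hvb : 0 ≤ vb := Real.sqrt_nonneg _
  have h2 : ∫ x in interior (hull K),
        (-(inner ℝ (b x) (gradient (T.hat z) x)) + c x * T.hat z x) * T.nhat y x ≤
      vb * ‖Gz‖ + sc := by
    calc _ ≤ ∫ x in interior (hull K), (vb * ‖Gz‖ + sc) * T.nhat y x := by
          refine setIntegral_mono_on ?_ (hint.const_mul _) hI fun x hx => ?_
          · exact (integrableOn_lower hb hc (hat_mem_V z) (nhat_mem_V y)).mono_set
              (interior_subset.trans hsub)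
          · refine mul_le_mul_of_nonneg_right (add_le_add ?_ ?_) (nhat_nonneg hyn x)
            · rw [hgz x hx, ← inner_neg_left]
              refine (real_inner_le_norm _ _).trans ?_
              rw [norm_neg]
              exact mul_le_mul_of_nonneg_right
                (norm_le_vecSup (fun x hx => hB x (hsub hx)) (interior_subset hx)) (norm_nonneg _)
            · have h3 : c x ≤ sc := (le_abs_self _).trans
                (le_supOn (fun x hx => hC x (hsub hx)) (interior_subset hx))
              calc c x * T.hat z x ≤ sc * T.hat z x :=
                    mul_le_mul_of_nonneg_right h3 (hat_nonneg _ _)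
                _ ≤ sc * 1 := mul_le_mul_of_nonneg_left (hat_le_one _ _) hsc
                _ = sc := mul_one _
      _ = (vb * ‖Gz‖ + sc) * ∫ x in interior (hull K), T.nhat y x := integral_const_mul _ _
      _ ≤ (vb * ‖Gz‖ + sc) * 1 := by
          refine mul_le_mul_of_nonneg_left ?_ (by positivity)
          rw [← integral_nhat hyn]
          exact setIntegral_mono_set (integrableOn_nhat y)
            (Eventually.of_forall fun x => nhat_nonneg hyn x)
            (LE.le.eventuallyLE (interior_subset.trans hsub))
      _ = _ := mul_one _
  rw [h1]
  set V := volume.real (hull K)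
  have hV : 0 ≤ V := measureReal_nonneg
  have hsin : 0 ≤ Real.sin θ :=
    Real.sin_nonneg_of_nonneg_of_le_pi hθ.1.le (by linarith [hθ.2.1, Real.pi_pos])
  have h3 : V * inner ℝ Gz N ≤ -(V * (Real.sin θ * ‖N‖ * ‖Gz‖)) := by
    have := mul_le_mul_of_nonneg_left hacute hV
    linarith
  have hpos : 0 ≤ V * (Real.sin θ * ‖N‖ * ‖Gz‖) := by positivity
  have h4 : a * (V * inner ℝ Gz N) ≤ -(ν * (V * (Real.sin θ * ‖N‖ * ‖Gz‖))) := by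
    nlinarith [mul_le_mul_of_nonneg_left h3 (hν.trans hνa), mul_le_mul_of_nonneg_right hνa hpos]
  have h5 := mul_le_mul_of_nonneg_right hart (norm_nonneg Gz)
  have h6 : sc ≤ sc * (‖Gz‖ * Metric.diam (hull K)) := le_mul_of_one_le_right hsc hdiam
  linarith

/-- Constants have zero gradient inside every element, so only the weighted mean of `c` survives;
this is the row sum. -/
lemma domRow_one (a : Euc d → ℝ) (b : Euc d → Euc d) (c : Euc d → ℝ) (y : Euc d) :
    domRow T.carrier T a b c T.one y = ∫ x in T.carrier, c x * T.nhat y x := by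
  have hone : ∀ K ∈ T.elements, ∀ x ∈ interior (hull K), gradient T.one x = 0 :=
    fun K hK x hx => gradient_eq_zero_of_const
      (fun x hx => one_apply (hull_subset_carrier hK hx)) hx
  have h1 : ∫ x in T.carrier, inner ℝ (gradient T.one x) (gradient (T.nhat y) x) = 0 := by
    rw [← integral_zero (α := Euc d) (G := ℝ) (μ := volume.restrict T.carrier)]
    refine integral_congr_ae (ae_of_interior fun K hK x hx => ?_)
    beta_reduce
    rw [hone K hK x hx, inner_zero_left]
  rw [domRow, h1, mul_zero, zero_add]
  refine integral_congr_ae (ae_of_interior fun K hK x hx => ?_)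
  beta_reduce
  rw [hone K hK x hx, inner_zero_right, neg_zero, zero_add,
    one_apply (hull_subset_carrier hK (interior_subset hx)), mul_one]

lemma integral_mul_nhat_le {c : Euc d → ℝ} {C : ℝ} (hy : y ∈ T.nodes)
    (hc : ContinuousOn c T.carrier) (hC : ∀ x ∈ T.carrier, c x ≤ C) :
    ∫ x in T.carrier, c x * T.nhat y x ≤ C := by
  calc _ ≤ ∫ x in T.carrier, C * T.nhat y x := by
        refine setIntegral_mono_on ?_ ((integrableOn_nhat y).const_mul _) T.measurableSet_carrier
          fun x hx => mul_le_mul_of_nonneg_right (hC x hx) (nhat_nonneg hy x)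
        exact (hc.mul (continuousOn_carrier (nhat_mem_V y))).integrableOn_compact
          T.isCompact_carrier
    _ = C := by rw [integral_const_mul, integral_nhat hy, mul_one]

/-- An off-diagonal entry is a sum over elements, and only elements containing both nodes
contribute, each with a nonpositive amount. -/
lemma isMonoRow_domRow {ν θ : ℝ} {a : Euc d → ℝ} {b : Euc d → Euc d} {c : Euc d → ℝ}
    (hy : y ∈ T.nodes) (hb : ContinuousOn b T.carrier) (hc : ContinuousOn c T.carrier)
    (hc0 : ∀ x ∈ T.carrier, 0 ≤ c x) (hθ : T.StrictlyAcute θ) (hν : 0 ≤ ν) (hνa : ν ≤ a y)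
    (hart : ∀ K ∈ T.elements, y ∈ K →
      vecSup b (hull K) + Metric.diam (hull K) * supOn c (hull K) ≤
      ν * Real.sin θ * vecSup (gradient (T.nhat y)) (interior (hull K)) *
        volume.real (hull K)) :
    IsMonoRow T y (domRow T.carrier T a b c · y) := by
  have hsplit : ∀ z, domRow T.carrier T a b c (T.hat z) y = ∑ K ∈ T.elements,
      (a y * (∫ x in interior (hull K), inner ℝ (gradient (T.hat z) x) (gradient (T.nhat y) x)) +
      ∫ x in interior (hull K),
        (-(inner ℝ (b x) (gradient (T.hat z) x)) + c x * T.hat z x) * T.nhat y x) := fun z => by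
    rw [domRow, integral_carrier (integrableOn_inner_gradient (hat_mem_V z) (nhat_mem_V y)),
      integral_carrier (integrableOn_lower hb hc (hat_mem_V z) (nhat_mem_V y)),
      Finset.sum_add_distrib, Finset.mul_sum]
  refine ⟨fun u hu v hv => ?_, fun r u hu => ?_, fun z hz hzy => ?_, fun z hz hn => ?_, ?_⟩
  · simp only [domRow]
    have h1 : ∫ x in T.carrier, inner ℝ (gradient (u + v) x) (gradient (T.nhat y) x) =
        (∫ x in T.carrier, inner ℝ (gradient u x) (gradient (T.nhat y) x)) +
        ∫ x in T.carrier, inner ℝ (gradient v x) (gradient (T.nhat y) x) := by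
      rw [← integral_add (integrableOn_inner_gradient hu (nhat_mem_V y))
        (integrableOn_inner_gradient hv (nhat_mem_V y))]
      refine integral_congr_ae (ae_of_interior fun K hK x hx => ?_)
      beta_reduce
      rw [gradient_add_of_mem hu hv hK hx, inner_add_left]
    have h2 : ∫ x in T.carrier,
        (-(inner ℝ (b x) (gradient (u + v) x)) + c x * (u + v) x) * T.nhat y x =
        (∫ x in T.carrier, (-(inner ℝ (b x) (gradient u x)) + c x * u x) * T.nhat y x) +
        ∫ x in T.carrier, (-(inner ℝ (b x) (gradient v x)) + c x * v x) * T.nhat y x := by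
      rw [← integral_add (integrableOn_lower hb hc hu (nhat_mem_V y))
        (integrableOn_lower hb hc hv (nhat_mem_V y))]
      refine integral_congr_ae (ae_of_interior fun K hK x hx => ?_)
      beta_reduce
      rw [gradient_add_of_mem hu hv hK hx, inner_add_right, Pi.add_apply]
      ring
    rw [h1, h2]
    ring
  · simp only [domRow]
    have h1 : ∫ x in T.carrier, inner ℝ (gradient (r • u) x) (gradient (T.nhat y) x) =
        r * ∫ x in T.carrier, inner ℝ (gradient u x) (gradient (T.nhat y) x) := by
      rw [← integral_const_mul]
      refine integral_congr_ae (ae_of_interior fun K hK x hx => ?_)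
      beta_reduce
      rw [gradient_smul_of_mem r hu hK hx, real_inner_smul_left]
    have h2 : ∫ x in T.carrier,
        (-(inner ℝ (b x) (gradient (r • u) x)) + c x * (r • u) x) * T.nhat y x =
        r * ∫ x in T.carrier, (-(inner ℝ (b x) (gradient u x)) + c x * u x) * T.nhat y x := by
      rw [← integral_const_mul]
      refine integral_congr_ae (ae_of_interior fun K hK x hx => ?_)
      beta_reduce
      rw [gradient_smul_of_mem r hu hK hx, inner_smul_right, Pi.smul_apply, smul_eq_mul]
      ring
    rw [h1, h2]
    ring
  · rw [hsplit]
    refine Finset.sum_nonpos fun K hK => ?_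
    by_cases h : y ∈ K ∧ z ∈ K
    · exact elementEntry_nonpos hb hc hθ hν hνa hK h.1 h.2 hzy (hart K hK h.1)
    · exact (elementEntry_eq_zero _ b c hK (by tauto)).le
  · rw [hsplit]
    refine Finset.sum_eq_zero fun K hK => elementEntry_eq_zero _ b c hK ?_
    by_contra h
    exact hn ⟨K, hK, by tauto⟩
  · rw [domRow_one]
    exact setIntegral_nonneg T.measurableSet_carrier fun x hx =>
      mul_nonneg (hc0 x hx) (nhat_nonneg hy x)

end Mesh

end HJB

namespace HJB

/-! ## A Lipschitz criterion -/

/-- To the right of any point, one of the finitely many closed sets is visited arbitrarily close by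
and therefore contains the point. So the lower right Dini derivative never exceeds `C`, and the
growth comparison theorem applies. -/
lemma sub_le_of_closed_cover {f : ℝ → ℝ} (hf : ContinuousOn f (Icc 0 1)) {ι : Type*} [Finite ι]
    {S : ι → Set ℝ} (hS : ∀ i, IsClosed (S i)) (hcov : Icc 0 1 ⊆ ⋃ i, S i) {C : ℝ}
    (hC : ∀ i, ∀ s ∈ S i, ∀ t ∈ S i, |f s - f t| ≤ C * |s - t|) : f 1 - f 0 ≤ C := by
  have key := image_le_of_liminf_slope_right_le_deriv_boundary (f := f) (a := 0) (b := 1) hf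
    (B := fun t => f 0 + C * t) (B' := fun _ => C) (by simp) (by fun_prop)
    (fun x _ => by
      have := ((hasDerivAt_id x).const_mul C).const_add (f 0)
      simpa using this.hasDerivWithinAt) ?_
  · have := key (right_mem_Icc.2 zero_le_one)
    simp only [mul_one] at this
    linarith
  · intro x hx r hr
    have h1 : ∃ᶠ z in 𝓝[>] x, ∃ i, z ∈ S i := by
      refine Eventually.frequently ?_
      filter_upwards [Ioc_mem_nhdsGT hx.2] with z hz
      exact mem_iUnion.1 (hcov ⟨hx.1.trans hz.1.le, hz.2⟩)
    obtain ⟨i, hi⟩ : ∃ i, ∃ᶠ z in 𝓝[>] x, z ∈ S i := by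
      by_contra hcon
      push Not at hcon
      apply h1
      filter_upwards [Filter.eventually_all.2 hcon] with z hz
      rintro ⟨i, h⟩
      exact hz i h
    have hxS : x ∈ S i := (hS i).mem_of_frequently_of_tendsto hi
      (tendsto_id.mono_left nhdsWithin_le_nhds)
    refine (hi.and_eventually self_mem_nhdsWithin).mono fun z hz => lt_of_le_of_lt ?_ hr
    obtain ⟨hz, hzx⟩ := hz
    have hzx : 0 < z - x := sub_pos.2 hzx
    rw [slope_def_field, div_le_iff₀ hzx]
    have := hC i z hz x hxS
    rw [abs_of_pos hzx] at this
    exact (le_abs_self _).trans this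

/-- The one-dimensional criterion is applied on the segment from `z` to `x`, covered by the
preimages of the closed sets. -/
lemma lipschitzWith_of_closed_cover {E : Type*} [NormedAddCommGroup E] [NormedSpace ℝ E]
    {g : E → ℝ} (hg : Continuous g) {ι : Type*} [Finite ι] {S : ι → Set E}
    (hS : ∀ i, IsClosed (S i)) (hcov : ⋃ i, S i = univ) {C : ℝ≥0}
    (hC : ∀ i, ∀ x ∈ S i, ∀ z ∈ S i, |g x - g z| ≤ C * ‖x - z‖) : LipschitzWith C g := by
  refine LipschitzWith.of_le_add_mul C fun x z => ?_
  have hc : Continuous fun t : ℝ => z + t • (x - z) := by fun_prop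
  have := sub_le_of_closed_cover (f := fun t => g (z + t • (x - z))) (C := C * ‖x - z‖)
    (hg.comp hc).continuousOn (S := fun i => (fun t : ℝ => z + t • (x - z)) ⁻¹' S i)
    (fun i => (hS i).preimage hc) (by rw [← preimage_iUnion, hcov]; simp) ?_
  · simp only [one_smul, add_sub_cancel, zero_smul, add_zero] at this
    rw [dist_eq_norm]
    linarith
  · intro i s hs t ht
    refine (hC i _ hs _ ht).trans_eq ?_
    rw [add_sub_add_left_eq_sub, ← sub_smul, norm_smul, Real.norm_eq_abs]
    ring

namespace Mesh

variable {d : ℕ} {T : Mesh d} {K K' : Finset (Euc d)} {x y z : Euc d}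

/-! ## Hat functions of interior nodes -/

/-- Near the interior node `y` the domain is filled by the elements with vertex `y`, and dilation
from `y` carries this over to a neighbourhood of any point whose coordinate at `y` is positive. It
follows that the hat function of an interior node vanishes on the boundary, as integration by parts
requires. -/
lemma mem_interior_of_hat_pos (hy : y ∈ T.nodes) (hyi : y ∈ interior T.carrier)
    (hx : 0 < T.hat y x) : x ∈ interior T.carrier := by
  classical
  have hxp : x ∈ T.patch y := by
    by_contra h
    rw [hat_eq_zero_of_notMem_patch h] at hx
    exact hx.false
  obtain ⟨K, hK, hyK, hxK⟩ := mem_patch_iff.1 hxp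
  -- The elements without vertex `y` form a closed set missing `y`; off it, inside the domain, every
  -- point lies in an element with vertex `y`.
  set S : Set (Euc d) := ⋃ K ∈ T.elements.filter (fun K => y ∉ K), hull K with hS
  have hSc : IsClosed S := isClosed_biUnion_finset fun K _ => isClosed_hull K
  have hyS : y ∉ S := by
    intro h
    obtain ⟨K', hK', hyK'⟩ := mem_iUnion₂.1 h
    obtain ⟨hK', hn⟩ := Finset.mem_filter.1 hK'
    have := hat_eq_zero_of_notMem hK' hn hyK'
    rw [hat_apply_self hy] at this
    exact one_ne_zero this
  set N : Set (Euc d) := interior T.carrier ∩ Sᶜ with hN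
  have hNo : IsOpen N := isOpen_interior.inter hSc.isOpen_compl
  have hNK : ∀ u ∈ N, ∃ K' ∈ T.elements, y ∈ K' ∧ u ∈ hull K' := by
    rintro u ⟨hu, huS⟩
    obtain ⟨K', hK', huK'⟩ := mem_carrier_iff.1 (interior_subset hu)
    refine ⟨K', hK', ?_, huK'⟩
    by_contra hn
    exact huS (mem_iUnion₂.2 ⟨K', Finset.mem_filter.2 ⟨hK', hn⟩, huK'⟩)
  -- The ratio `s` contracts `x` towards `y` far enough to enter this neighbourhood.
  obtain ⟨s, hsN, hs0, hs1⟩ : ∃ s : ℝ, AffineMap.lineMap y x s ∈ N ∧ 0 < s ∧ s ≤ 1 := by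
    have hc : Continuous fun s : ℝ => AffineMap.lineMap y x s := by fun_prop
    have h0 : AffineMap.lineMap y x (0 : ℝ) ∈ N := by
      rw [AffineMap.lineMap_apply_zero]; exact ⟨hyi, hyS⟩
    have h1 : ∀ᶠ s in 𝓝[>] (0 : ℝ), AffineMap.lineMap y x s ∈ N :=
      nhdsWithin_le_nhds (hc.continuousAt.eventually (hNo.mem_nhds h0))
    obtain ⟨s, h2, h3⟩ := (h1.and (Ioc_mem_nhdsGT zero_lt_one)).exists
    exact ⟨s, h2, h3.1, h3.2⟩
  have hcu : Continuous fun u : Euc d => AffineMap.lineMap y u s := by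
    simp only [AffineMap.lineMap_apply_module]; fun_prop
  have hline : ∀ (K' : Finset (Euc d)) (hK' : K' ∈ T.elements) (hyK' : y ∈ K') (z : Euc d)
      (hz : z ∈ K') (u : Euc d), bary hK' hz (AffineMap.lineMap y u s) =
        (1 - s) * bary hK' hz y + s * bary hK' hz u := by
    intro K' hK' hyK' z hz u
    rw [AffineMap.apply_lineMap, AffineMap.lineMap_apply_module, smul_eq_mul, smul_eq_mul]
  -- Contraction towards `y` multiplies all other barycentric coordinates by `s > 0`, so their signs
  -- can be read off at the contracted point. The coordinate at `y` stays positive near `x`: by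
  -- consistency of the hat function at the contracted point it has the same value at `x` in `K'` as
  -- in `K`. If the contracted `x` is outside the closed set `hull K'`, the claim is void near `x`.
  have hev : ∀ K' ∈ T.elements, y ∈ K' →
      ∀ᶠ u in 𝓝 x, AffineMap.lineMap y u s ∈ hull K' → u ∈ hull K' := by
    intro K' hK' hyK'
    by_cases hxs : AffineMap.lineMap y x s ∈ hull K'
    · have hxsK : AffineMap.lineMap y x s ∈ hull K :=
        (convex_hull K).lineMap_mem (mem_hull_of_mem hyK) hxK ⟨hs0.le, hs1⟩
      have hpos : 0 < bary hK' hyK' x := by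
        have h1 := hline K' hK' hyK' y hyK' x
        have h2 := hline K hK hyK y hyK x
        rw [← hat_eq_bary hK' hyK' hxs, bary_apply_self] at h1
        rw [← hat_eq_bary hK hyK hxsK, bary_apply_self, h1] at h2
        rw [hat_eq_bary hK hyK hxK] at hx
        have : bary hK' hyK' x = bary hK hyK x := mul_left_cancel₀ hs0.ne' (by linarith)
        rwa [this]
      filter_upwards [(continuous_bary hK' hyK').continuousAt.eventually (lt_mem_nhds hpos)]
        with u hu hus
      refine (mem_hull_iff hK').2 fun z hz => ?_
      by_cases hzy : z = y
      · subst hzy; exact hu.le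
      · have h1 := hline K' hK' hyK' z hz u
        rw [bary_apply_ne hK' hz hyK' hzy, mul_zero, zero_add] at h1
        have h2 := (mem_hull_iff hK').1 hus z hz
        rw [h1] at h2
        exact (mul_nonneg_iff_of_pos_left hs0).1 h2
    · filter_upwards [hcu.continuousAt.eventually ((isClosed_hull K').isOpen_compl.mem_nhds hxs)]
        with u hu hus
      exact absurd hus hu
  have hall : ∀ᶠ u in 𝓝 x, ∀ K' ∈ T.elements, y ∈ K' →
      AffineMap.lineMap y u s ∈ hull K' → u ∈ hull K' :=
    (Filter.eventually_all_finset _).2 fun K' hK' => by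
      by_cases hyK' : y ∈ K'
      · filter_upwards [hev K' hK' hyK'] with u hu _ using hu
      · exact Eventually.of_forall fun u h => absurd h hyK'
  rw [mem_interior_iff_mem_nhds]
  filter_upwards [hall, hcu.continuousAt.eventually (hNo.mem_nhds hsN)] with u hu huN
  obtain ⟨K', hK', hyK', h⟩ := hNK _ huN
  exact hull_subset_carrier hK' (hu K' hK' hyK' h)

lemma hat_eq_zero_of_mem_closure_compl (hy : y ∈ T.nodes) (hyi : y ∈ interior T.carrier)
    (hx : x ∈ closure T.carrierᶜ) : T.hat y x = 0 := by
  by_contra h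
  have := mem_interior_of_hat_pos hy hyi ((hat_nonneg y x).lt_of_ne' h)
  rw [closure_compl] at hx
  exact hx this

/-- The meshed set and the closure of its complement are closed, and on their overlap both pieces
vanish because `y` is interior. -/
lemma continuous_hat (hy : y ∈ T.nodes) (hyi : y ∈ interior T.carrier) : Continuous (T.hat y) := by
  rw [← continuousOn_univ, ← union_compl_self T.carrier]
  have h1 : ContinuousOn (T.hat y) (T.carrier ∪ closure T.carrierᶜ) :=
    (continuousOn_carrier (hat_mem_V y)).union_of_isClosed
      ((continuousOn_const (c := (0 : ℝ))).congr fun x hx =>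
        hat_eq_zero_of_mem_closure_compl hy hyi hx) T.isCompact_carrier.isClosed isClosed_closure
  exact h1.mono (union_subset_union_right _ subset_closure)

/-- The elements and the closure of the complement form a finite closed cover with a Lipschitz bound
on each piece. Global Lipschitz continuity gives almost-everywhere differentiability and makes
integration by parts available on the whole space. -/
lemma exists_lipschitzWith_hat (hy : y ∈ T.nodes) (hyi : y ∈ interior T.carrier) :
    ∃ C, LipschitzWith C (T.hat y) := by
  have : ∀ K : T.elements, ∃ C : ℝ≥0, ∀ x ∈ hull (K : Finset (Euc d)),
      ∀ z ∈ hull (K : Finset (Euc d)), |T.hat y x - T.hat y z| ≤ C * ‖x - z‖ := fun K => by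
    obtain ⟨G, -, hG⟩ := exists_gradient (hat_mem_V (T := T) y) K.2
    refine ⟨‖G‖₊, fun x hx z hz => ?_⟩
    rw [hG z hz x hx]
    exact abs_real_inner_le_norm _ _
  choose C hC using this
  obtain ⟨M, hM⟩ := (Set.finite_range C).bddAbove
  refine ⟨M, lipschitzWith_of_closed_cover (continuous_hat hy hyi) (ι := Option T.elements)
    (S := fun o => o.elim (closure T.carrierᶜ) fun K => hull (K : Finset (Euc d))) ?_ ?_ ?_⟩
  · rintro (_ | K)
    · exact isClosed_closure
    · exact isClosed_hull _
  · refine eq_univ_of_forall fun x => mem_iUnion.2 ?_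
    by_cases hx : x ∈ T.carrier
    · obtain ⟨K, hK, hx⟩ := mem_carrier_iff.1 hx
      exact ⟨some ⟨K, hK⟩, hx⟩
    · exact ⟨none, subset_closure hx⟩
  · rintro (_ | K) x hx z hz
    · rw [hat_eq_zero_of_mem_closure_compl hy hyi hx, hat_eq_zero_of_mem_closure_compl hy hyi hz]
      simp only [sub_zero, abs_zero]
      positivity
    · refine (hC K x hx z hz).trans (mul_le_mul_of_nonneg_right ?_ (norm_nonneg _))
      exact_mod_cast hM ⟨K, rfl⟩

lemma exists_lipschitzWith_nhat (hy : y ∈ T.nodes) (hyi : y ∈ interior T.carrier) :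
    ∃ C, LipschitzWith C (T.nhat y) := by
  obtain ⟨C, hC⟩ := exists_lipschitzWith_hat hy hyi
  have := (lipschitzWith_smul (β := ℝ) (T.mass y)⁻¹).comp hC
  rw [nhat_eq_smul]
  exact ⟨_, this⟩

end Mesh

/-! ## Quadratic functions and integration by parts -/

variable {d : ℕ}

/-- Polynomials of degree at most two. -/
def IsQuad (q : Euc d → ℝ) : Prop :=
  ∃ (c : ℝ) (l : Euc d →L[ℝ] ℝ) (B : Euc d →L[ℝ] Euc d →L[ℝ] ℝ), ∀ x, q x = c + l x + B x x

lemma laplacian_eq_sum_fderiv (f : Euc d → ℝ) (x : Euc d) :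
    Laplacian.laplacian f x = ∑ j, fderiv ℝ (fderiv ℝ f) x
      (EuclideanSpace.basisFun (Fin d) ℝ j) (EuclideanSpace.basisFun (Fin d) ℝ j) := by
  have := congrFun (InnerProductSpace.laplacian_eq_iteratedFDeriv_orthonormalBasis f
    (EuclideanSpace.basisFun (Fin d) ℝ)) x
  simp only [iteratedFDeriv_two_apply] at this
  exact this

namespace IsQuad

variable {q q' : Euc d → ℝ}

lemma const (r : ℝ) : IsQuad fun _ : Euc d => r := ⟨r, 0, 0, by simp⟩

lemma clm (l : Euc d →L[ℝ] ℝ) : IsQuad fun x => l x := ⟨0, l, 0, by simp⟩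

lemma bilin (B : Euc d →L[ℝ] Euc d →L[ℝ] ℝ) : IsQuad fun x => B x x := ⟨0, 0, B, by simp⟩

lemma add (h : IsQuad q) (h' : IsQuad q') : IsQuad (q + q') := by
  obtain ⟨c, l, B, hq⟩ := h
  obtain ⟨c', l', B', hq'⟩ := h'
  refine ⟨c + c', l + l', B + B', fun x => ?_⟩
  simp only [Pi.add_apply, hq, hq', add_apply]
  ring

lemma contDiff (h : IsQuad q) {n : WithTop ℕ∞} : ContDiff ℝ n q := by
  obtain ⟨c, l, B, hq⟩ := h
  rw [funext hq]
  exact (contDiff_const.add l.contDiff).add (B.contDiff.clm_apply contDiff_id)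

lemma exists_fderiv (h : IsQuad q) :
    ∃ (l : Euc d →L[ℝ] ℝ) (B : Euc d →L[ℝ] Euc d →L[ℝ] ℝ), ∀ x, HasFDerivAt q (l + B x) x := by
  obtain ⟨c, l, B, hq⟩ := h
  refine ⟨l, B + B.flip, fun x => ?_⟩
  rw [funext hq]
  have h1 : HasFDerivAt (fun x => B x x) ((B x).comp (.id ℝ _) + B.flip x) x :=
    B.hasFDerivAt.clm_apply (hasFDerivAt_id x)
  have h2 := ((hasFDerivAt_const c x).add l.hasFDerivAt).add h1
  refine h2.congr_fderiv ?_
  ext v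
  simp

end IsQuad

open InnerProductSpace in
-- Green's formula without boundary term, since the normalised hat function of an interior node
-- extends by zero to a compactly supported Lipschitz function. The Laplacian of a quadratic is
-- constant and the hat function has mean one, so the result is exact and `x₀` is arbitrary.
lemma Mesh.integral_inner_gradient_nhat {T : Mesh d} {y : Euc d} (hy : y ∈ T.nodes)
    (hyi : y ∈ interior T.carrier) {q : Euc d → ℝ} (hq : IsQuad q) (x₀ : Euc d) :
    ∫ x in T.carrier, inner ℝ (gradient q x) (gradient (T.nhat y) x) =
      -Laplacian.laplacian q x₀ := by
  obtain ⟨l, B, hD⟩ := hq.exists_fderiv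
  obtain ⟨C, hC⟩ := T.exists_lipschitzWith_nhat hy hyi
  set u := T.nhat y
  set e := EuclideanSpace.basisFun (Fin d) ℝ
  have hu0 : ∀ x ∉ T.carrier, u x = 0 := (T.nhat_mem_V y).2
  have hsupp : HasCompactSupport u := HasCompactSupport.intro T.isCompact_carrier hu0
  have hnear : ∀ x ∉ T.carrier, u =ᶠ[𝓝 x] fun _ => 0 := fun x hx => by
    filter_upwards [T.isCompact_carrier.isClosed.isOpen_compl.mem_nhds hx] with z hz
    exact hu0 z hz
  have hLd : ∀ x ∉ T.carrier, ∀ v, lineDeriv ℝ u x v = 0 := fun x hx v => by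
    have hda : DifferentiableAt ℝ u x := (hnear x hx).differentiableAt_iff.2 (by fun_prop)
    rw [hda.lineDeriv_eq_fderiv, (hnear x hx).fderiv_eq]
    simp
  have hfd : fderiv ℝ q = fun x => l + B x := funext fun x => (hD x).fderiv
  have hlap : Laplacian.laplacian q x₀ = ∑ j, B (e j) (e j) := by
    rw [laplacian_eq_sum_fderiv, hfd]
    have : HasFDerivAt (fun x => l + B x) B x₀ := B.hasFDerivAt.const_add l
    rw [this.fderiv]
  have hcont : ∀ j, Continuous fun x => (l + B x) (e j) := fun j => by fun_prop
  have hlip : ∀ j, ∃ D, LipschitzWith D fun x => (l + B x) (e j) := fun j => by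
    refine ⟨_, LipschitzWith.of_dist_le_mul (K := ‖B.flip (e j)‖₊) fun x z => ?_⟩
    rw [dist_eq_norm, dist_eq_norm]
    have := (B.flip (e j)).le_opNorm (x - z)
    simpa using this
  have hint : ∀ j, Integrable (fun x => lineDeriv ℝ u x (e j) * (l + B x) (e j)) := fun j => by
    obtain ⟨M, hM⟩ := exists_bound (T := T) (hcont j).continuousOn
    rw [← integrableOn_iff_integrable_of_support_subset (s := T.carrier)]
    · refine IntegrableOn.of_bound T.isCompact_carrier.measure_lt_top ?_ (C * ‖e j‖ * M) ?_
      · exact ((measurable_lineDeriv hC.continuous).mul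
          (hcont j).measurable).aestronglyMeasurable
      · refine (ae_restrict_iff' T.measurableSet_carrier).2 (Eventually.of_forall fun x hx => ?_)
        rw [norm_mul]
        exact mul_le_mul (norm_lineDeriv_le_of_lipschitz ℝ hC) (hM x hx) (norm_nonneg _)
          (by positivity)
    · intro x hx
      by_contra h
      exact hx (by simp only [hLd x h, zero_mul])
  have h1 : ∫ x in T.carrier, inner ℝ (gradient q x) (gradient u x) =
      ∫ x, inner ℝ (gradient q x) (gradient u x) :=
    setIntegral_eq_integral_of_forall_compl_eq_zero fun x hx => by
      rw [(hnear x hx).gradient_eq, gradient_fun_const, inner_zero_right]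
  have h2 : ∫ x, inner ℝ (gradient q x) (gradient u x) =
      ∫ x, ∑ j, lineDeriv ℝ u x (e j) * (l + B x) (e j) := by
    refine integral_congr_ae ?_
    filter_upwards [hC.ae_differentiableAt (μ := volume)] with x hx
    rw [← e.sum_inner_mul_inner]
    refine Finset.sum_congr rfl fun j _ => ?_
    rw [hx.lineDeriv_eq_fderiv, inner_gradient_left, (hD x).fderiv, mul_comm]
    congr 1
    rw [real_inner_comm, inner_gradient_left]
  rw [h1, h2, integral_finsetSum _ fun j _ => hint j, hlap, ← Finset.sum_neg_distrib]
  refine Finset.sum_congr rfl fun j _ => ?_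
  obtain ⟨D, hDl⟩ := hlip j
  -- The formula reverses the direction when moving the derivative; starting from `-e j` leaves `u`
  -- differentiated along `e j`.
  have h3 := LipschitzWith.integral_lineDeriv_mul_eq (μ := volume) hDl hC hsupp (-e j)
  rw [neg_neg] at h3
  rw [← h3]
  have h4 : ∀ x, lineDeriv ℝ (fun x => (l + B x) (e j)) x (-e j) = -B (e j) (e j) := fun x => by
    have : HasFDerivAt (fun x => (l + B x) (e j)) (B.flip (e j)) x := by
      have := (B.flip (e j)).hasFDerivAt.const_add (l (e j)) (x := x)
      simpa using this
    rw [this.differentiableAt.lineDeriv_eq_fderiv, this.fderiv]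
    simp
  simp only [h4]
  rw [integral_const_mul, ← setIntegral_eq_integral_of_forall_compl_eq_zero (s := T.carrier) hu0,
    T.integral_nhat hy, mul_one]

end HJB

namespace HJB

/-! ## Families depending continuously on a compact parameter -/

/-- Finitely many neighbourhoods cover the compact parameter space; by monotonicity in `r` an upper
bound of their constants works for all parameters. -/
lemma exists_forall_of_locally {A : Type*} [TopologicalSpace A] [CompactSpace A]
    {p : A → ℝ → Prop} (hmono : ∀ α r r', r ≤ r' → p α r → p α r')
    (h : ∀ α₀, ∃ r, ∀ᶠ α in 𝓝 α₀, p α r) : ∃ r, ∀ α, p α r := by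
  choose r hr using h
  obtain ⟨t, -, ht⟩ := isCompact_univ.elim_nhds_subcover (fun α₀ => {α | p α (r α₀)})
    fun α₀ _ => hr α₀
  obtain ⟨M, hM⟩ := (t.finite_toSet.image r).bddAbove
  refine ⟨M, fun α => ?_⟩
  obtain ⟨α₀, h₀, h1⟩ := mem_iUnion₂.1 (ht (mem_univ α))
  exact hmono α _ _ (hM ⟨α₀, h₀, rfl⟩) h1

lemma exists_bound_family {A X F : Type*} [TopologicalSpace A] [CompactSpace A]
    [NormedAddCommGroup F] {u : A → X → F} {S : Set X}
    (hb : ∀ α, ∃ C : ℝ, ∀ x ∈ S, ‖u α x‖ ≤ C)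
    (hdep : ∀ α₀, TendstoUniformlyOn u (u α₀) (𝓝 α₀) S) : ∃ C : ℝ, ∀ α, ∀ x ∈ S, ‖u α x‖ ≤ C := by
  refine exists_forall_of_locally (p := fun α C => ∀ x ∈ S, ‖u α x‖ ≤ C)
    (fun α r r' hr h x hx => (h x hx).trans hr) fun α₀ => ?_
  obtain ⟨C, hC⟩ := hb α₀
  refine ⟨C + 1, ?_⟩
  filter_upwards [Metric.tendstoUniformlyOn_iff.1 (hdep α₀) 1 one_pos] with α hα x hx
  have h1 := (hα x hx).le
  rw [dist_eq_norm, norm_sub_rev] at h1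
  have h2 := norm_add_le (u α x - u α₀ x) (u α₀ x)
  rw [sub_add_cancel] at h2
  linarith [hC x hx]

/-- A norm-compact family of continuous functions on a compact set is uniformly equicontinuous. -/
lemma exists_modulus_family {A X F : Type*} [TopologicalSpace A] [CompactSpace A]
    [PseudoMetricSpace X] [NormedAddCommGroup F] {u : A → X → F} {S : Set X} (hS : IsCompact S)
    (hc : ∀ α, ContinuousOn (u α) S)
    (hdep : ∀ α₀, TendstoUniformlyOn u (u α₀) (𝓝 α₀) S) {ε : ℝ} (hε : 0 < ε) :
    ∃ δ > 0, ∀ α, ∀ x ∈ S, ∀ z ∈ S, dist x z < δ → ‖u α x - u α z‖ ≤ ε := by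
  -- Writing `δ = exp (-r)` makes the property weaker as `r` grows and keeps `δ` positive, the form
  -- required by `exists_forall_of_locally`.
  suffices h : ∀ α₀, ∃ r : ℝ, ∀ᶠ α in 𝓝 α₀, ∀ x ∈ S, ∀ z ∈ S, dist x z < Real.exp (-r) →
      ‖u α x - u α z‖ ≤ ε by
    obtain ⟨r, hr⟩ := exists_forall_of_locally
      (p := fun α r => ∀ x ∈ S, ∀ z ∈ S, dist x z < Real.exp (-r) → ‖u α x - u α z‖ ≤ ε)
      (fun α r r' hr h x hx z hz hd => h x hx z hz
        (hd.trans_le (Real.exp_le_exp.2 (neg_le_neg hr)))) h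
    exact ⟨_, Real.exp_pos _, hr⟩
  · intro α₀
    obtain ⟨δ, hδ, h⟩ := Metric.uniformContinuousOn_iff.1
      (hS.uniformContinuousOn_of_continuous (hc α₀)) (ε / 3) (by positivity)
    refine ⟨-Real.log δ, ?_⟩
    filter_upwards [Metric.tendstoUniformlyOn_iff.1 (hdep α₀) (ε / 3) (by positivity)]
      with α hα x hx z hz hd
    rw [neg_neg, Real.exp_log hδ] at hd
    rw [← dist_eq_norm]
    have h1 := hα x hx
    have h2 := hα z hz
    have h3 := h x hx z hz hd
    rw [dist_comm] at h1
    linarith [dist_triangle4 (u α x) (u α₀ x) (u α₀ z) (u α z)]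

variable {d : ℕ} {A : Type*}

/-! ## Elliptic projections of quadratic functions -/

/-- The functions `p i` of the finite element spaces converge to the quadratic function `q` in
`W^{1,∞}`, and have the same discrete Laplacian. -/
structure Approximates (D : ℕ → Level d A) (p : ℕ → Euc d → ℝ) (q : Euc d → ℝ) : Prop where
  quad : IsQuad q
  mem : ∀ i, p i ∈ (D i).mesh.V
  elliptic : ∀ i, ∀ y ∈ (D i).mesh.nodes, y ∈ interior (D i).mesh.carrier → ∀ x₀,
    ∫ x in (D i).mesh.carrier, inner ℝ (gradient (p i) x) (gradient ((D i).mesh.nhat y) x) =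
      -Laplacian.laplacian q x₀
  unif : ∀ ε : ℝ, 0 < ε → ∀ᶠ i in atTop, ∀ x ∈ (D i).mesh.carrier, |p i x - q x| ≤ ε
  gradient_unif : ∀ ε : ℝ, 0 < ε → ∀ᶠ i in atTop, ∀ K ∈ (D i).mesh.elements,
    ∀ x ∈ interior (hull K), ‖gradient (p i) x - gradient q x‖ ≤ ε

lemma forall_le_of_ae_le {U : Set (Euc d)} (hU : IsOpen U) {f : Euc d → ℝ} (hf : ContinuousOn f U)
    {ε : ℝ} (h : ∀ᵐ x ∂(volume.restrict U), f x ≤ ε) : ∀ x ∈ U, f x ≤ ε := by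
  by_contra! hcon
  obtain ⟨x, hx, hlt⟩ := hcon
  have ho : IsOpen (U ∩ f ⁻¹' Ioi ε) := hf.isOpen_inter_preimage hU isOpen_Ioi
  have h0 : volume (U ∩ f ⁻¹' Ioi ε) = 0 := by
    rw [ae_restrict_iff' hU.measurableSet, ae_iff] at h
    refine measure_mono_null (fun z hz => ?_) h
    simp only [mem_ofPred_eq, Classical.not_imp, not_le]
    exact hz
  rw [ho.measure_eq_zero_iff volume] at h0
  exact eq_empty_iff_forall_notMem.1 h0 x ⟨hx, hlt⟩

lemma Mesh.closure_interior_hull {T : Mesh d} {K : Finset (Euc d)} (hK : K ∈ T.elements) :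
    closure (interior (hull K)) = hull K := by
  rw [(Mesh.convex_hull K).closure_interior_eq_closure_of_nonempty_interior
    (Mesh.interior_hull_nonempty hK), (Mesh.isClosed_hull K).closure_eq]

/-- Convergence in `W^{1,∞}` is an almost-everywhere statement. By continuity it holds at every
point of each open element, and for the values also on the closed elements. The exact discrete
Laplacian comes from integration by parts for the quadratic. -/
lemma exists_approximates {P : Problem d A} {D : ℕ → Level d A}
    (hcar : ∀ i, (D i).mesh.carrier = P.Ω) (hproj : HasEllipticProjections P D)
    {q : Euc d → ℝ} (hq : IsQuad q) : ∃ p, Approximates D p q := by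
  obtain ⟨Pr, h1, -, h3⟩ := hproj
  set w : smooth d := ⟨q, hq.contDiff (n := ∞)⟩ with hw
  have hbound : ∀ ε : ℝ, 0 < ε → ∀ᶠ i in atTop,
      (∀ᵐ x ∂(volume.restrict (D i).mesh.carrier), ‖(Pr i w : Euc d → ℝ) x - q x‖ ≤ ε) ∧
      ∀ᵐ x ∂(volume.restrict (D i).mesh.carrier),
        ‖gradient ((Pr i w : Euc d → ℝ) - q) x‖ ≤ ε := by
    intro ε hε
    have := (h3 w).eventually (gt_mem_nhds (ENNReal.ofReal_pos.2 hε))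
    filter_upwards [this] with i hi
    rw [normW1inf] at hi
    rw [hcar i]
    have key : ∀ {F : Type} [NormedAddCommGroup F] (f : Euc d → F),
        eLpNorm f ⊤ (volume.restrict P.Ω) ≤ ENNReal.ofReal ε →
        ∀ᵐ x ∂(volume.restrict P.Ω), ‖f x‖ ≤ ε := by
      intro F _ f hf
      rw [eLpNorm_exponent_top] at hf
      filter_upwards [enorm_ae_le_eLpNormEssSup f (volume.restrict P.Ω)] with x hx
      have := hx.trans hf
      rwa [← ofReal_norm, ENNReal.ofReal_le_ofReal_iff hε.le] at this
    exact ⟨key _ ((le_self_add).trans hi.le), key _ ((le_add_self).trans hi.le)⟩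
  have hcq : Continuous q := (hq.contDiff (n := 0)).continuous
  have hgq : Continuous (gradient q) :=
    (InnerProductSpace.toDual ℝ (Euc d)).symm.continuous.comp
      ((hq.contDiff (n := 1)).continuous_fderiv (by simp))
  have hdq : Differentiable ℝ q := (hq.contDiff (n := 1)).differentiable (by simp)
  refine ⟨fun i => Pr i w, hq, fun i => (Pr i w).2, fun i y hy hyi x₀ => ?_, fun ε hε => ?_,
    fun ε hε => ?_⟩
  · rw [← Mesh.integral_inner_gradient_nhat hy hyi hq x₀, hcar i]
    exact h1 i w y hy (by rwa [hcar i] at hyi)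
  · filter_upwards [hbound ε hε] with i hi x hx
    obtain ⟨K, hK, hx⟩ := Mesh.mem_carrier_iff.1 hx
    have hsub := Mesh.hull_subset_carrier hK
    have hc : ContinuousOn (fun x => |(Pr i w : Euc d → ℝ) x - q x|) (hull K) :=
      (((Mesh.continuousOn_carrier (Pr i w).2).mono hsub).sub hcq.continuousOn).abs
    have hint := forall_le_of_ae_le isOpen_interior (hc.mono interior_subset)
      (ae_restrict_of_ae_restrict_of_subset (interior_subset.trans hsub) hi.1)
    have hcl := hc.preimage_isClosed_of_isClosed (Mesh.isClosed_hull K) (isClosed_Iic (a := ε))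
    -- The bound passes from the open element to the closed one because the interior is dense in it.
    rw [← Mesh.closure_interior_hull hK] at hx
    have hsub' : interior (hull K) ⊆
        hull K ∩ (fun x => |(Pr i w : Euc d → ℝ) x - q x|) ⁻¹' Iic ε :=
      fun z hz => ⟨interior_subset hz, hint z hz⟩
    exact (closure_minimal hsub' hcl hx).2
  · filter_upwards [hbound ε hε] with i hi K hK
    obtain ⟨G, hG, -⟩ := Mesh.exists_gradient (Pr i w).2 hK
    have hgr : ∀ x ∈ interior (hull K),
        gradient ((Pr i w : Euc d → ℝ) - q) x = gradient (Pr i w : Euc d → ℝ) x - gradient q x :=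
      fun x hx => by
        simp only [gradient, fderiv_sub (hG x hx).differentiableAt (hdq x), map_sub]
    have hc : ContinuousOn (fun x => ‖gradient (Pr i w : Euc d → ℝ) x - gradient q x‖)
        (interior (hull K)) := by
      refine ContinuousOn.norm (ContinuousOn.sub ?_ hgq.continuousOn)
      exact (continuousOn_const (c := G)).congr fun x hx => (hG x hx).gradient
    refine forall_le_of_ae_le isOpen_interior hc ?_
    have := ae_restrict_of_ae_restrict_of_subset
      (interior_subset.trans (Mesh.hull_subset_carrier hK)) hi.2
    filter_upwards [this, ae_restrict_mem isOpen_interior.measurableSet] with x hx hxm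
    rwa [hgr x hxm] at hx

end HJB

/-! ### The assumptions collected, monotone rows of the scheme, and the size of the explicit
operator -/

namespace HJB

variable {d : ℕ} {A : Type*} [MetricSpace A]

lemma mem_frontier {S : Set (Euc d)} {y : Euc d} (hy : y ∈ S) (hi : y ∉ interior S) :
    y ∈ frontier S := ⟨subset_closure hy, hi⟩

/-- The assumptions on the problem and on the discretisation. -/
structure Admissible (P : Problem d A) (D : ℕ → Level d A) : Prop where
  standing : P.Standing
  mesh : MeshSequence P D
  reg : ∀ i, (D i).Regular P
  sign : ∀ i, (D i).SignsAndCone P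
  cons : Consistent P D
  mono : ∀ i, (D i).Monotone P

lemma IsQuad.continuous {q : Euc d → ℝ} (hq : IsQuad q) : Continuous q :=
  (hq.contDiff (n := 0)).continuous

lemma IsQuad.continuous_gradient {q : Euc d → ℝ} (hq : IsQuad q) : Continuous (gradient q) :=
  (InnerProductSpace.toDual ℝ (Euc d)).symm.continuous.comp
      ((hq.contDiff (n := 1)).continuous_fderiv (by simp))

lemma IsQuad.laplacian_const {q : Euc d → ℝ} (hq : IsQuad q) (x z : Euc d) :
    Laplacian.laplacian q x = Laplacian.laplacian q z := by
  obtain ⟨l, B, hD⟩ := hq.exists_fderiv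
  have hfd : fderiv ℝ q = fun x => l + B x := funext fun x => (hD x).fderiv
  have : ∀ x, HasFDerivAt (fun x => l + B x) B x := fun x => B.hasFDerivAt.const_add l
  rw [laplacian_eq_sum_fderiv, laplacian_eq_sum_fderiv, hfd, (this x).fderiv, (this z).fderiv]

lemma exists_modulus {F : Type*} [NormedAddCommGroup F] {S : Set (Euc d)} (hS : IsCompact S)
    {u : Euc d → F} (hu : Continuous u) {ε : ℝ} (hε : 0 < ε) :
    ∃ δ > 0, ∀ x ∈ S, ∀ z ∈ S, dist x z < δ → ‖u x - u z‖ ≤ ε := by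
  obtain ⟨δ, hδ, h⟩ := Metric.uniformContinuousOn_iff.1
    (hS.uniformContinuousOn_of_continuous hu.continuousOn) ε hε
  exact ⟨δ, hδ, fun x hx z hz hd => by rw [← dist_eq_norm]; exact (h x hx z hz hd).le⟩

namespace Mesh.IsMonoRow

/-- This is the Dirichlet row of the implicit operator. -/
lemma eval {T : Mesh d} {y : Euc d} (hy : y ∈ T.nodes) : IsMonoRow T y fun w => w y := by
  refine ⟨by simp, by simp, fun z _ hzy => (hat_apply_ne hy hzy).le, fun z hz hn => ?_, ?_⟩
  · refine hat_apply_ne hy fun h => hn ?_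
    rw [h]
    exact Nbr.refl hy
  · rw [one_apply (nodes_subset_carrier hy)]; exact zero_le_one

end Mesh.IsMonoRow

namespace Admissible

variable {P : Problem d A} {D : ℕ → Level d A}

lemma isCompact_Ω (h : Admissible P D) : IsCompact P.Ω := h.standing.polytopic.isCompact

lemma node_mem (h : Admissible P D) {i : ℕ} {y : Euc d} (hy : y ∈ (D i).mesh.nodes) : y ∈ P.Ω := by
  rw [← h.mesh.carrier_eq i]
  exact Mesh.nodes_subset_carrier hy

lemma mem_bd (h : Admissible P D) {y : Euc d} (hy : y ∈ P.Ω) (hi : y ∉ interior P.Ω)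
    (hD : y ∉ P.bdD) : y ∈ P.bdT ∪ P.bdR := by
  have := mem_frontier hy hi
  rw [← h.standing.bd_union] at this
  rcases this with (h | h) | h
  · exact absurd h hD
  · exact Or.inr h
  · exact Or.inl h

lemma notMem_interior (h : Admissible P D) {y : Euc d} (hy : y ∈ P.bdD ∪ P.bdR ∪ P.bdT) :
    y ∉ interior P.Ω := by
  rw [h.standing.bd_union] at hy
  exact hy.2

/-! ### Monotonicity of the rows -/

lemma isMonoRow_opE (h : Admissible P D) (i : ℕ) (α : A) {y : Euc d}
    (hy : y ∈ (D i).mesh.nodes) : (D i).mesh.IsMonoRow y ((D i).opE P α · y) := by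
  have hcar := h.mesh.carrier_eq i
  by_cases hi : y ∈ interior P.Ω
  · simp only [Level.opE, if_pos hi]
    obtain ⟨θ, hθ, hart⟩ := (h.mono i).acute_artdiff
    obtain ⟨⟨ν, hν, hart, hνa⟩, -⟩ := hart α y hy hi
    rw [← hcar]
    exact Mesh.isMonoRow_domRow hy (hcar ▸ (h.reg i).bE_cont α) (hcar ▸ (h.reg i).cE_cont α)
      (hcar ▸ (h.sign i).cE_nonneg α) hθ hν hνa hart
  · by_cases hD : y ∈ P.bdD
    · simp only [Level.opE, if_neg hi, if_pos hD]
      exact Mesh.IsMonoRow.zero _ _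
    · simp only [Level.opE, if_neg hi, if_neg hD]
      refine Mesh.isMonoRow_bdRow hy ?_ ?_
      · rw [hcar]
        exact (h.sign i).bBE_cone α y hy (h.mem_bd (h.node_mem hy) hi hD)
      · exact (h.sign i).cBE_nonneg α y (mem_frontier (h.node_mem hy) hi)

lemma isMonoRow_opI (h : Admissible P D) (i : ℕ) (α : A) {y : Euc d}
    (hy : y ∈ (D i).mesh.nodes) : (D i).mesh.IsMonoRow y ((D i).opI P α · y) := by
  have hcar := h.mesh.carrier_eq i
  by_cases hi : y ∈ interior P.Ω
  · simp only [Level.opI, if_pos hi]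
    obtain ⟨θ, hθ, hart⟩ := (h.mono i).acute_artdiff
    obtain ⟨-, ⟨ν, hν, hart, hνa⟩⟩ := hart α y hy hi
    rw [← hcar]
    exact Mesh.isMonoRow_domRow hy (hcar ▸ (h.reg i).bI_cont α) (hcar ▸ (h.reg i).cI_cont α)
      (hcar ▸ (h.sign i).cI_nonneg α) hθ hν hνa hart
  · by_cases hD : y ∈ P.bdD
    · simp only [Level.opI, if_neg hi, if_pos hD]
      exact Mesh.IsMonoRow.eval hy
    · simp only [Level.opI, if_neg hi, if_neg hD]
      refine Mesh.isMonoRow_bdRow hy ?_ ?_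
      · rw [hcar]
        exact (h.sign i).bBI_cone α y hy (h.mem_bd (h.node_mem hy) hi hD)
      · exact (h.sign i).cBI_nonneg α y (mem_frontier (h.node_mem hy) hi)

/-- At Robin nodes the explicit coefficients vanish, and the Dini derivative in direction zero is
zero. Thus the explicit operator acts only at nodes carrying a time derivative, exactly those
covered by the time step restriction. -/
lemma opE_eq_zero (h : Admissible P D) (i : ℕ) (α : A) {y : Euc d} (w : Euc d → ℝ)
    (hy : y ∉ interior P.Ω ∪ P.bdT) (hyΩ : y ∈ P.Ω) : (D i).opE P α w y = 0 := by
  have hi : y ∉ interior P.Ω := fun h => hy (Or.inl h)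
  rw [Level.opE, if_neg hi]
  split_ifs with hD
  · rfl
  · have hR : y ∈ P.bdR := (h.mem_bd hyΩ hi hD).resolve_left fun h => hy (Or.inr h)
    rw [bdRow, (h.sign i).bBE_R α y hR, (h.sign i).cBE_R α y hR, zero_mul, add_zero, diniDeriv]
    simp

lemma h_pos (h : Admissible P D) (i : ℕ) : 0 < (D i).h P :=
  div_pos h.standing.T_pos (by exact_mod_cast h.mesh.M_pos i)

/-- Uniform bounds of the zeroth-order coefficients of the explicit operators. -/
lemma exists_opE_one_le [CompactSpace A] (h : Admissible P D) : ∃ C : ℝ, ∀ᶠ i in atTop, ∀ α,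
    ∀ y ∈ (D i).mesh.nodes, (D i).opE P α (D i).mesh.one y ≤ C := by
  have hΩ := h.isCompact_Ω
  obtain ⟨C₁, hC₁⟩ := exists_bound_family (u := P.c) (S := P.Ω)
    (fun α => hΩ.exists_bound_of_continuousOn (h.standing.c_cont α)) h.standing.c_dep
  obtain ⟨C₂, hC₂⟩ := exists_bound_family (u := P.cB) (S := frontier P.Ω)
    (fun α => (h.standing.cB_pc α).1) h.standing.cB_dep
  refine ⟨max 0 (max (C₁ + 1) (C₂ + 1)), ?_⟩
  filter_upwards [h.cons.c_lim 1 one_pos, h.cons.cB_lim 1 one_pos] with i h1 h2 α y hy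
  have hcar := h.mesh.carrier_eq i
  by_cases hi : y ∈ interior P.Ω
  · rw [Level.opE, if_pos hi, ← hcar, Mesh.domRow_one]
    refine (Mesh.integral_mul_nhat_le (C := C₁ + 1) hy (hcar ▸ (h.reg i).cE_cont α)
      fun x hx => ?_).trans (le_max_of_le_right (le_max_left _ _))
    rw [hcar] at hx
    -- Only the sum of the explicit and implicit coefficients converges; it bounds the explicit one
    -- because the implicit one is nonnegative.
    have h3 := (abs_le.1 (h1 α x hx)).1
    have h4 := (abs_le.1 (hC₁ α x hx)).2
    have h5 := (h.sign i).cI_nonneg α x hx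
    linarith
  · rw [Level.opE, if_neg hi]
    split_ifs with hD
    · exact le_max_left _ _
    · have hf := mem_frontier (h.node_mem hy) hi
      rw [Mesh.bdRow_one hy (hcar ▸ (h.sign i).bBE_cone α y hy (h.mem_bd (h.node_mem hy) hi hD))]
      refine le_max_of_le_right (le_max_of_le_right ?_)
      have h3 := (abs_le.1 (h2 α y hf)).1
      have h4 := (abs_le.1 (hC₂ α y hf)).2
      have h5 := (h.sign i).cBI_nonneg α y hf
      linarith

lemma exists_bound_quad (h : Admissible P D) {q : Euc d → ℝ} (hq : IsQuad q) :
    ∃ C : ℝ, ∀ x ∈ P.Ω, |q x| ≤ C :=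
  h.isCompact_Ω.exists_bound_of_continuousOn hq.continuous.continuousOn

lemma meshSize_lt (h : Admissible P D) {δ : ℝ} (hδ : 0 < δ) :
    ∀ᶠ i in atTop, (D i).mesh.meshSize < δ :=
  h.mesh.meshSize_tendsto.eventually (gt_mem_nhds hδ)

lemma h_lt (h : Admissible P D) {δ : ℝ} (hδ : 0 < δ) : ∀ᶠ i in atTop, (D i).h P < δ :=
  h.mesh.h_tendsto.eventually (gt_mem_nhds hδ)

/-- The explicit operator is `o(1/h)` on the projections of a fixed function. -/
lemma eventually_h_mul_opE_le [CompactSpace A] (h : Admissible P D) {p : ℕ → Euc d → ℝ} {q : Euc d → ℝ}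
    (hp : Approximates D p q) {ε : ℝ} (hε : 0 < ε) : ∀ᶠ i in atTop, ∀ α,
    ∀ y ∈ (D i).mesh.nodes, (D i).h P * |(D i).opE P α (p i) y| ≤ ε := by
  obtain ⟨C, hC⟩ := h.exists_opE_one_le
  obtain ⟨M, hM⟩ := h.exists_bound_quad hp.quad
  obtain ⟨δ, hδ, hmod⟩ := exists_modulus h.isCompact_Ω hp.quad.continuous
    (ε := ε / 6) (by positivity)
  set N := (|M| + 1) * (|C| + 1) with hN
  have hNpos : 0 < N := by positivity
  filter_upwards [hC, hp.unif (min 1 (ε / 6)) (by positivity), h.meshSize_lt hδ,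
    h.h_lt (δ := ε / (2 * N)) (by positivity)] with i hC hu hs hh α y hy
  have hcar := h.mesh.carrier_eq i
  rw [hcar] at hu
  by_cases hyT : y ∈ interior P.Ω ∪ P.bdT
  · have hh0 := (h.h_pos i).le
    have hyΩ := h.node_mem hy
    have hrow := h.isMonoRow_opE i α hy
    -- The row estimate is scaled by the time step: the restriction controls the diagonal, the row
    -- sum is bounded and multiplied by a vanishing step, and `κ = ε / 2` is the oscillation between
    -- neighbours. The latter consists of two projection errors and one modulus of continuity of
    -- `q`, each `ε / 6`.
    have := hrow.abs_le hy hh0 ((h.mono i).timestep α y hy hyT) (hp.mem i)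
      (κ := ε / 2) (by positivity) fun z hz => ?_
    · have h1 : |p i y| ≤ |M| + 1 := by
        have h2 := (hu y hyΩ).trans (min_le_left _ _)
        have h3 := (hM y hyΩ).trans (le_abs_self M)
        calc |p i y| = |(p i y - q y) + q y| := by ring_nf
          _ ≤ _ := abs_add_le _ _
          _ ≤ _ := by linarith
      have h4 : (D i).opE P α (D i).mesh.one y ≤ |C| + 1 :=
        (hC α y hy).trans ((le_abs_self C).trans (by linarith))
      have h5 : |p i y| * (D i).opE P α (D i).mesh.one y ≤ N :=
        mul_le_mul h1 h4 hrow.one_nonneg (by positivity)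
      have h6 : (D i).h P * N ≤ ε / 2 := by
        calc (D i).h P * N ≤ ε / (2 * N) * N := mul_le_mul_of_nonneg_right hh.le hNpos.le
          _ = ε / 2 := by field_simp
      have h7 := mul_le_mul_of_nonneg_left h5 hh0
      linarith
    · have hzΩ := h.node_mem hz.mem_nodes
      have h1 := (hu y hyΩ).trans (min_le_right _ _)
      have h2 := (hu z hzΩ).trans (min_le_right _ _)
      have h3 := hmod z hzΩ y hyΩ (by rw [dist_comm]; exact hz.dist_le.trans_lt hs)
      rw [Real.norm_eq_abs] at h3
      rw [abs_le] at *
      constructor <;> linarith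
  · rw [h.opE_eq_zero i α _ hyT (h.node_mem hy), abs_zero, mul_zero]
    exact hε.le

end Admissible

end HJB

/-! ### Consistency of the spatial rows and of the source on quadratic functions -/

namespace HJB

variable {d : ℕ} {A : Type*} [MetricSpace A]

lemma abs_inner_sub_inner_le {E : Type*} [NormedAddCommGroup E] [InnerProductSpace ℝ E]
    {b b' g g' : E} {δ B G : ℝ} (hb : ‖b' - b‖ ≤ δ) (hg : ‖g' - g‖ ≤ δ) (hB : ‖b‖ ≤ B)
    (hG : ‖g'‖ ≤ G) : |inner ℝ b' g' - inner ℝ b g| ≤ δ * G + B * δ := by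
  have e : inner ℝ b' g' - inner ℝ b g = inner ℝ (b' - b) g' + inner ℝ b (g' - g) := by
    rw [inner_sub_left, inner_sub_right]; ring
  rw [e]
  refine (abs_add_le _ _).trans (add_le_add ?_ ?_)
  · exact (abs_real_inner_le_norm _ _).trans
      (mul_le_mul hb hG (norm_nonneg _) ((norm_nonneg _).trans hb))
  · exact (abs_real_inner_le_norm _ _).trans
      (mul_le_mul hB hg (norm_nonneg _) ((norm_nonneg _).trans hB))

lemma abs_mul_sub_mul_le {c c' w w' δ C W : ℝ} (hc : |c' - c| ≤ δ) (hw : |w' - w| ≤ δ)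
    (hC : |c| ≤ C) (hW : |w'| ≤ W) : |c' * w' - c * w| ≤ δ * W + C * δ := by
  have e : c' * w' - c * w = (c' - c) * w' + c * (w' - w) := by ring
  rw [e]
  refine (abs_add_le _ _).trans (add_le_add ?_ ?_)
  · rw [abs_mul]
    exact mul_le_mul hc hW (abs_nonneg _) ((abs_nonneg _).trans hc)
  · rw [abs_mul]
    exact mul_le_mul hC hw (abs_nonneg _) ((abs_nonneg _).trans hC)

namespace Problem

open Classical in
/-- The spatial part of the operator at the points off `bdD`. -/
def spatial (P : Problem d A) (α : A) (y : Euc d) (q : Euc d → ℝ) : ℝ :=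
  if y ∈ interior P.Ω then P.L α y (Laplacian.laplacian q y) (gradient q y) (q y)
  else P.LB α y (gradient q y) (q y)

open Classical in
/-- The right-hand side of the problem before the final time. -/
def source (P : Problem d A) (α : A) (y : Euc d) : ℝ :=
  if y ∈ interior P.Ω then P.f α y else if y ∈ P.bdD then P.g y else P.gB α y

end Problem

namespace Admissible

variable {P : Problem d A} {D : ℕ → Level d A}

lemma dist_lt_of_mem_hull {T : Mesh d} {K : Finset (Euc d)} {x z : Euc d} {δ : ℝ}
    (hK : K ∈ T.elements) (hx : x ∈ hull K) (hz : z ∈ hull K) (hs : T.meshSize < δ) :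
    dist x z < δ := (Mesh.dist_le_meshSize hK hx hz).trans_lt hs

/-- Both operators act here on the same projection, so only the sums of coefficients enter. The
diffusion part is exactly minus the summed coefficient times the constant Laplacian. The remainder
is a weighted mean over the patch of `y` of an integrand close to its limit value. -/
lemma eventually_domain_rows [CompactSpace A] (h : Admissible P D) {p : ℕ → Euc d → ℝ}
    {q : Euc d → ℝ} (hp : Approximates D p q) {ε : ℝ} (hε : 0 < ε) : ∀ᶠ i in atTop, ∀ α,
    ∀ y ∈ (D i).mesh.nodes, y ∈ interior P.Ω →
      |(D i).opE P α (p i) y + (D i).opI P α (p i) y - P.spatial α y q| ≤ ε := by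
  have hΩ := h.isCompact_Ω
  have hst := h.standing
  obtain ⟨B, hB⟩ := exists_bound_family (u := P.b) (S := P.Ω)
    (fun α => hΩ.exists_bound_of_continuousOn (hst.b_cont α)) hst.b_dep
  obtain ⟨C, hC⟩ := exists_bound_family (u := P.c) (S := P.Ω)
    (fun α => hΩ.exists_bound_of_continuousOn (hst.c_cont α)) hst.c_dep
  obtain ⟨W, hW⟩ := h.exists_bound_quad hp.quad
  obtain ⟨G, hG⟩ := hΩ.exists_bound_of_continuousOn hp.quad.continuous_gradient.continuousOn
  set Λ := Laplacian.laplacian q 0 with hΛ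
  -- `N` gathers the factors multiplying `η` in the final estimate, including `G + 1` and `W + 1`
  -- for the projected gradient and value.
  set N := |Λ| + 2 * (|G| + 1) + |B| * 2 + 2 * (|W| + 1) + |C| * 2 + 1 with hN
  have hNpos : 0 < N := by positivity
  set η := min 1 (ε / N) with hη
  have hηpos : 0 < η := by positivity
  have hη1 : η ≤ 1 := min_le_left _ _
  obtain ⟨δb, hδb, hmb⟩ := exists_modulus_family hΩ hst.b_cont hst.b_dep hηpos
  obtain ⟨δc, hδc, hmc⟩ := exists_modulus_family hΩ hst.c_cont hst.c_dep hηpos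
  obtain ⟨δq, hδq, hmq⟩ := exists_modulus hΩ hp.quad.continuous hηpos
  obtain ⟨δg, hδg, hmg⟩ := exists_modulus hΩ hp.quad.continuous_gradient hηpos
  filter_upwards [hp.unif η hηpos, hp.gradient_unif η hηpos, h.cons.a_lim η hηpos,
    h.cons.b_lim η hηpos, h.cons.c_lim η hηpos, h.meshSize_lt hδb, h.meshSize_lt hδc,
    h.meshSize_lt hδq, h.meshSize_lt hδg] with i hu hgu ha hb hc s1 s2 s3 s4 α y hy hyi
  have hcar := h.mesh.carrier_eq i
  have hyD : y ∉ P.bdD := fun hD => h.notMem_interior (Or.inl (Or.inl hD)) hyi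
  have hyΩ := h.node_mem hy
  set m := (D i).mesh
  have hyp : y ∈ m.patch y := by
    obtain ⟨K, hK, hyK⟩ := hy
    exact Mesh.mem_patch_iff.2 ⟨K, hK, hyK, Mesh.mem_hull_of_mem hyK⟩
  have ha := ha α y hy hyD y hyp
  have hbE : ContinuousOn ((D i).bE α) m.carrier := hcar ▸ (h.reg i).bE_cont α
  have hbI : ContinuousOn ((D i).bI α) m.carrier := hcar ▸ (h.reg i).bI_cont α
  have hcE : ContinuousOn ((D i).cE α) m.carrier := hcar ▸ (h.reg i).cE_cont α
  have hcI : ContinuousOn ((D i).cI α) m.carrier := hcar ▸ (h.reg i).cI_cont α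
  have hell := hp.elliptic i y hy (hcar ▸ hyi) 0
  set lower : Euc d → ℝ := fun x =>
    -(inner ℝ ((D i).bE α x + (D i).bI α x) (gradient (p i) x)) +
      ((D i).cE α x + (D i).cI α x) * p i x with hlower
  have hintE := Mesh.integrableOn_lower hbE hcE (hp.mem i) (Mesh.nhat_mem_V (T := m) y)
  have hintI := Mesh.integrableOn_lower hbI hcI (hp.mem i) (Mesh.nhat_mem_V (T := m) y)
  have hlow : (fun x => lower x * m.nhat y x) =
      fun x => (-(inner ℝ ((D i).bE α x) (gradient (p i) x)) + (D i).cE α x * p i x) * m.nhat y x +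
        (-(inner ℝ ((D i).bI α x) (gradient (p i) x)) + (D i).cI α x * p i x) * m.nhat y x := by
    ext x
    simp only [hlower, inner_add_left]
    ring
  have hsum : (D i).opE P α (p i) y + (D i).opI P α (p i) y =
      -(((D i).aE α y + (D i).aI α y) * Λ) + ∫ x in m.carrier, lower x * m.nhat y x := by
    rw [Level.opE, Level.opI, if_pos hyi, if_pos hyi, ← hcar, domRow, domRow, hell, hlow,
      integral_add hintE hintI]
    ring
  have hlowint : IntegrableOn (fun x => lower x * m.nhat y x) m.carrier := by
    rw [hlow]; exact hintE.add hintI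
  -- Each `2 * η` is one `η` for replacing discrete data by their limits at `x` and one for moving
  -- from `x` to `y`.
  have hclose := Mesh.abs_integral_mul_nhat_sub_le (T := m)
    (r := -(inner ℝ (P.b α y) (gradient q y)) + P.c α y * q y)
    (ε := 2 * η * (|G| + 1) + |B| * (2 * η) + (2 * η * (|W| + 1) + |C| * (2 * η)))
    hy hlowint fun K hK hyK x hx => ?_
  · have e : (D i).opE P α (p i) y + (D i).opI P α (p i) y - P.spatial α y q =
        (P.a α y - ((D i).aE α y + (D i).aI α y)) * Λ +
        ((∫ x in m.carrier, lower x * m.nhat y x) -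
          (-(inner ℝ (P.b α y) (gradient q y)) + P.c α y * q y)) := by
      rw [hsum, Problem.spatial, if_pos hyi, Problem.L, hp.quad.laplacian_const y 0]
      ring
    rw [e]
    refine (abs_add_le _ _).trans ((add_le_add ?_ hclose).trans (b := η * |Λ| + _) ?_)
    · rw [abs_mul]
      exact mul_le_mul_of_nonneg_right ha (abs_nonneg _)
    · have h1 : η * N ≤ ε := by
        calc η * N ≤ ε / N * N := mul_le_mul_of_nonneg_right (min_le_right _ _) hNpos.le
          _ = ε := div_mul_cancel₀ _ hNpos.ne'
      refine le_trans ?_ h1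
      rw [hN]
      nlinarith
  · have hxK : x ∈ hull K := interior_subset hx
    have hyK' : y ∈ hull K := Mesh.mem_hull_of_mem hyK
    have hxΩ : x ∈ P.Ω := hcar ▸ Mesh.hull_subset_carrier hK hxK
    have hd : ∀ {δ}, m.meshSize < δ → dist x y < δ := fun hs => dist_lt_of_mem_hull hK hxK hyK' hs
    have b1 := hb α x hxΩ
    have b2 := hmb α x hxΩ y hyΩ (hd s1)
    have c1 := hc α x hxΩ
    have c2 := hmc α x hxΩ y hyΩ (hd s2)
    have q1 := hu x (Mesh.hull_subset_carrier hK hxK)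
    have q2 := hmq x hxΩ y hyΩ (hd s3)
    have g1 := hgu K hK x hx
    have g2 := hmg x hxΩ y hyΩ (hd s4)
    have b3 : ‖(D i).bE α x + (D i).bI α x - P.b α y‖ ≤ 2 * η := by
      rw [norm_sub_rev] at b1
      have := norm_sub_le_norm_sub_add_norm_sub ((D i).bE α x + (D i).bI α x) (P.b α x) (P.b α y)
      linarith
    have g3 : ‖gradient (p i) x - gradient q y‖ ≤ 2 * η := by
      have := norm_sub_le_norm_sub_add_norm_sub (gradient (p i) x) (gradient q x) (gradient q y)
      linarith
    have g4 : ‖gradient (p i) x‖ ≤ |G| + 1 := by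
      have h1 := norm_le_norm_add_norm_sub' (gradient (p i) x) (gradient q x)
      have h2 := (hG x hxΩ).trans (le_abs_self G)
      linarith
    have b4 : ‖P.b α y‖ ≤ |B| := (hB α y hyΩ).trans (le_abs_self B)
    have I1 := abs_inner_sub_inner_le b3 g3 b4 g4
    rw [Real.norm_eq_abs] at c1 c2 q2
    have c3 : |(D i).cE α x + (D i).cI α x - P.c α y| ≤ 2 * η := by
      rw [abs_sub_comm] at c1
      have := abs_sub_le ((D i).cE α x + (D i).cI α x) (P.c α x) (P.c α y)
      linarith
    have q3 : |p i x - q y| ≤ 2 * η := by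
      have := abs_sub_le (p i x) (q x) (q y)
      linarith
    have q4 : |p i x| ≤ |W| + 1 := by
      have h1 := abs_sub_abs_le_abs_sub (p i x) (q x)
      have h2 := (hW x hxΩ).trans (le_abs_self W)
      linarith
    have c4 : |P.c α y| ≤ |C| := (hC α y hyΩ).trans (le_abs_self C)
    have I2 := abs_mul_sub_mul_le c3 q3 c4 q4
    have e : lower x - (-(inner ℝ (P.b α y) (gradient q y)) + P.c α y * q y) =
        -(inner ℝ ((D i).bE α x + (D i).bI α x) (gradient (p i) x) -
          inner ℝ (P.b α y) (gradient q y)) +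
        (((D i).cE α x + (D i).cI α x) * p i x - P.c α y * q y) := by
      simp only [hlower]; ring
    rw [e]
    refine (abs_add_le _ _).trans (add_le_add ?_ I2)
    rw [abs_neg]
    exact I1

/-- Each Dini derivative is minus the drift paired with a gradient of the projection near `y`, hence
close to minus the drift paired with `∇q y`. The error is weighted by the explicit and implicit
drifts separately, and only their sum converges; their separate uniform bound is therefore needed.
All coefficients are taken at `y`, so no continuity along the boundary is required. -/
lemma eventually_boundary_rows [CompactSpace A] (h : Admissible P D) {p : ℕ → Euc d → ℝ}
    {q : Euc d → ℝ} (hp : Approximates D p q) {ε : ℝ} (hε : 0 < ε) : ∀ᶠ i in atTop, ∀ α,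
    ∀ y ∈ (D i).mesh.nodes, y ∉ interior P.Ω → y ∉ P.bdD →
      |(D i).opE P α (p i) y + (D i).opI P α (p i) y - P.spatial α y q| ≤ ε := by
  have hΩ := h.isCompact_Ω
  have hst := h.standing
  obtain ⟨B, hB⟩ := h.cons.bB_bdd
  obtain ⟨C, hC⟩ := exists_bound_family (u := P.cB) (S := frontier P.Ω)
    (fun α => (hst.cB_pc α).1) hst.cB_dep
  obtain ⟨W, hW⟩ := h.exists_bound_quad hp.quad
  obtain ⟨G, hG⟩ := hΩ.exists_bound_of_continuousOn hp.quad.continuous_gradient.continuousOn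
  set N := 4 * |B| + |G| + (|W| + 1) + |C| + 1 with hN
  have hNpos : 0 < N := by positivity
  set η := min 1 (ε / N) with hη
  have hηpos : 0 < η := by positivity
  have hη1 : η ≤ 1 := min_le_left _ _
  obtain ⟨δg, hδg, hmg⟩ := exists_modulus hΩ hp.quad.continuous_gradient hηpos
  filter_upwards [hp.unif η hηpos, hp.gradient_unif η hηpos,
    h.cons.bB_lim η hηpos, h.cons.cB_lim η hηpos, h.meshSize_lt hδg] with i hu hgu hb hc s α y hy
    hyi hyD
  have hcar := h.mesh.carrier_eq i
  have hyΩ := h.node_mem hy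
  have hyf := mem_frontier hyΩ hyi
  have hbd := h.mem_bd hyΩ hyi hyD
  have hgrad : ∀ K ∈ (D i).mesh.elements, y ∈ K →
      ∃ x ∈ interior (hull K), ‖gradient (p i) x - gradient q y‖ ≤ 2 * η := by
    intro K hK hyK
    obtain ⟨x, hx⟩ := Mesh.interior_hull_nonempty hK
    have hxK := interior_subset hx
    refine ⟨x, hx, ?_⟩
    have g1 := hgu K hK x hx
    have g2 := hmg x (hcar ▸ Mesh.hull_subset_carrier hK hxK) y hyΩ
      (dist_lt_of_mem_hull hK hxK (Mesh.mem_hull_of_mem hyK) s)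
    have := norm_sub_le_norm_sub_add_norm_sub (gradient (p i) x) (gradient q x) (gradient q y)
    linarith
  have dE := Mesh.abs_diniDeriv_add_inner_le hy
    (hcar.symm ▸ (h.sign i).bBE_cone α y hy hbd) (hp.mem i) hgrad
  have dI := Mesh.abs_diniDeriv_add_inner_le hy
    (hcar.symm ▸ (h.sign i).bBI_cone α y hy hbd) (hp.mem i) hgrad
  have b1 := hb α y hyf
  have c1 := hc α y hyf
  rw [Real.norm_eq_abs, abs_sub_comm] at c1
  have q1 := hu y (hcar.symm ▸ hyΩ)
  have q4 : |p i y| ≤ |W| + 1 := by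
    have h1 := abs_sub_abs_le_abs_sub (p i y) (q y)
    have h2 := (hW y hyΩ).trans (le_abs_self W)
    linarith
  have c4 : |P.cB α y| ≤ |C| := (hC α y hyf).trans (le_abs_self C)
  have I2 := abs_mul_sub_mul_le c1 q1 c4 q4
  have I1 : |inner ℝ (P.bB α y - ((D i).bBE α y + (D i).bBI α y)) (gradient q y)| ≤ η * |G| :=
    (abs_real_inner_le_norm _ _).trans
      (mul_le_mul b1 ((hG y hyΩ).trans (le_abs_self G)) (norm_nonneg _) hηpos.le)
  have hbE : ‖(D i).bBE α y‖ * (2 * η) ≤ |B| * (2 * η) :=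
    mul_le_mul_of_nonneg_right ((hB i α y hyf).1.trans (le_abs_self B)) (by positivity)
  have hbI : ‖(D i).bBI α y‖ * (2 * η) ≤ |B| * (2 * η) :=
    mul_le_mul_of_nonneg_right ((hB i α y hyf).2.trans (le_abs_self B)) (by positivity)
  have e : (D i).opE P α (p i) y + (D i).opI P α (p i) y - P.spatial α y q =
      (diniDeriv (p i) y ((D i).bBE α y) + inner ℝ ((D i).bBE α y) (gradient q y)) +
      (diniDeriv (p i) y ((D i).bBI α y) + inner ℝ ((D i).bBI α y) (gradient q y)) +
      inner ℝ (P.bB α y - ((D i).bBE α y + (D i).bBI α y)) (gradient q y) +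
      (((D i).cBE α y + (D i).cBI α y) * p i y - P.cB α y * q y) := by
    rw [Level.opE, Level.opI, Problem.spatial, if_neg hyi, if_neg hyD, if_neg hyi, if_neg hyD,
      if_neg hyi, bdRow, bdRow, Problem.LB, inner_sub_left, inner_add_left]
    ring
  have h1 : η * N ≤ ε := by
    calc η * N ≤ ε / N * N := mul_le_mul_of_nonneg_right (min_le_right _ _) hNpos.le
      _ = ε := div_mul_cancel₀ _ hNpos.ne'
  have h2 : η * N = |B| * (2 * η) + |B| * (2 * η) + η * |G| + (η * (|W| + 1) + |C| * η) + η := by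
    rw [hN]; ring
  rw [e]
  refine (abs_add_le _ _).trans ?_
  have t1 := abs_add_le (diniDeriv (p i) y ((D i).bBE α y) +
      inner ℝ ((D i).bBE α y) (gradient q y) +
      (diniDeriv (p i) y ((D i).bBI α y) + inner ℝ ((D i).bBI α y) (gradient q y)))
    (inner ℝ (P.bB α y - ((D i).bBE α y + (D i).bBI α y)) (gradient q y))
  have t2 := abs_add_le (diniDeriv (p i) y ((D i).bBE α y) +
      inner ℝ ((D i).bBE α y) (gradient q y))
    (diniDeriv (p i) y ((D i).bBI α y) + inner ℝ ((D i).bBI α y) (gradient q y))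
  linarith

lemma eventually_rows [CompactSpace A] (h : Admissible P D) {p : ℕ → Euc d → ℝ}
    {q : Euc d → ℝ} (hp : Approximates D p q) {ε : ℝ} (hε : 0 < ε) : ∀ᶠ i in atTop, ∀ α,
    ∀ y ∈ (D i).mesh.nodes, y ∉ P.bdD →
      |(D i).opE P α (p i) y + (D i).opI P α (p i) y - P.spatial α y q| ≤ ε := by
  filter_upwards [h.eventually_domain_rows hp hε, h.eventually_boundary_rows hp hε]
    with i h1 h2 α y hy hyD
  by_cases hyi : y ∈ interior P.Ω
  · exact h1 α y hy hyi
  · exact h2 α y hy hyi hyD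

lemma eventually_rhs [CompactSpace A] (h : Admissible P D) {ε : ℝ} (hε : 0 < ε) :
    ∀ᶠ i in atTop, ∀ α, ∀ y ∈ (D i).mesh.nodes, |(D i).rhs P α y - P.source α y| ≤ ε := by
  obtain ⟨δ, hδ, hm⟩ := exists_modulus_family h.isCompact_Ω h.standing.f_cont h.standing.f_dep
    (ε := ε / 2) (by positivity)
  filter_upwards [h.cons.f_lim (ε / 2) (by positivity), h.cons.gB_lim ε hε, h.meshSize_lt hδ]
    with i hf hg hs α y hy
  have hcar := h.mesh.carrier_eq i
  have hyΩ := h.node_mem hy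
  by_cases hyi : y ∈ interior P.Ω
  · rw [Level.rhs, Problem.source, if_pos hyi, if_pos hyi, ← hcar]
    refine Mesh.abs_integral_mul_nhat_sub_le hy ?_ fun K hK hyK x hx => ?_
    · have hc : ContinuousOn ((D i).f α) (D i).mesh.carrier := hcar ▸ (h.reg i).f_cont α
      exact (hc.mul (Mesh.continuousOn_carrier (Mesh.nhat_mem_V y))).integrableOn_compact
        (D i).mesh.isCompact_carrier
    · have hxK := interior_subset hx
      have hxΩ : x ∈ P.Ω := hcar ▸ Mesh.hull_subset_carrier hK hxK
      have h1 := hf α x hxΩ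
      have h2 := hm α x hxΩ y hyΩ (dist_lt_of_mem_hull hK hxK (Mesh.mem_hull_of_mem hyK) hs)
      rw [Real.norm_eq_abs] at h1 h2
      rw [abs_sub_comm] at h1
      have := abs_sub_le ((D i).f α x) (P.f α x) (P.f α y)
      linarith
  · rw [Level.rhs, Problem.source, if_neg hyi, if_neg hyi]
    split_ifs with hD
    · simpa using hε.le
    · have := hg α y (mem_frontier hyΩ hyi)
      rwa [Real.norm_eq_abs, abs_sub_comm] at this

end Admissible

end HJB

namespace HJB

variable {d : ℕ} {A : Type*}

/-! ## Quadratic test functions -/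

lemma IsQuad.smul {q : Euc d → ℝ} (hq : IsQuad q) (r : ℝ) : IsQuad (r • q) := by
  obtain ⟨c, l, B, h⟩ := hq
  refine ⟨r * c, r • l, r • B, fun x => ?_⟩
  simp only [Pi.smul_apply, h, smul_eq_mul, smul_apply]
  ring

lemma IsQuad.differentiableAt {q : Euc d → ℝ} (hq : IsQuad q) (x : Euc d) :
    DifferentiableAt ℝ q x := (hq.contDiff (n := 1)).differentiable (by simp) x

lemma Problem.spatial_add (P : Problem d A) (α : A) (y : Euc d) {q q' : Euc d → ℝ} (hq : IsQuad q)
    (hq' : IsQuad q') : P.spatial α y (q + q') = P.spatial α y q + P.spatial α y q' := by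
  have h1 : gradient (q + q') y = gradient q y + gradient q' y := by
    simp only [gradient, fderiv_add (hq.differentiableAt y) (hq'.differentiableAt y), map_add]
  have h2 : Laplacian.laplacian (q + q') y =
      Laplacian.laplacian q y + Laplacian.laplacian q' y :=
    ContDiffAt.laplacian_add hq.contDiff.contDiffAt hq'.contDiff.contDiffAt
  simp only [Problem.spatial, Problem.L, Problem.LB, h1, h2, inner_add_right, Pi.add_apply]
  split_ifs <;> ring

lemma Problem.spatial_smul (P : Problem d A) (α : A) (y : Euc d) {q : Euc d → ℝ} (hq : IsQuad q)
    (r : ℝ) : P.spatial α y (r • q) = r * P.spatial α y q := by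
  have h1 : gradient (r • q) y = r • gradient q y := by
    simp only [gradient, fderiv_const_smul (hq.differentiableAt y), map_smul]
  have h2 : Laplacian.laplacian (r • q) y = r • Laplacian.laplacian q y :=
    InnerProductSpace.laplacian_smul r hq.contDiff.contDiffAt
  simp only [Problem.spatial, Problem.L, Problem.LB, h1, h2, inner_smul_right, Pi.smul_apply,
    smul_eq_mul]
  split_ifs <;> ring

/-- A function of time and space that is quadratic in time, with coefficients that are quadratic
in space. -/
structure QuadTest (d : ℕ) where
  q₀ : Euc d → ℝ
  q₁ : Euc d → ℝ
  q₂ : Euc d → ℝ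
  h₀ : IsQuad q₀
  h₁ : IsQuad q₁
  h₂ : IsQuad q₂

namespace QuadTest

/-- The slice at the time `t`. -/
def slice (φ : QuadTest d) (t : ℝ) : Euc d → ℝ := φ.q₀ + t • φ.q₁ + t ^ 2 • φ.q₂

/-- The function of time and space. -/
def val (φ : QuadTest d) (z : ℝ × Euc d) : ℝ := φ.slice z.1 z.2

lemma val_eq (φ : QuadTest d) (t : ℝ) (x : Euc d) :
    φ.val (t, x) = φ.q₀ x + t * φ.q₁ x + t ^ 2 * φ.q₂ x := by simp [val, slice]

lemma spatial_slice (φ : QuadTest d) (P : Problem d A) (α : A) (y : Euc d) (t : ℝ) :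
    P.spatial α y (φ.slice t) =
      P.spatial α y φ.q₀ + t * P.spatial α y φ.q₁ + t ^ 2 * P.spatial α y φ.q₂ := by
  rw [slice, P.spatial_add α y (φ.h₀.add (φ.h₁.smul t)) (φ.h₂.smul _),
    P.spatial_add α y φ.h₀ (φ.h₁.smul t), P.spatial_smul α y φ.h₁, P.spatial_smul α y φ.h₂]

lemma deriv_val (φ : QuadTest d) (t : ℝ) (x : Euc d) :
    deriv (fun τ => φ.val (τ, x)) t = φ.q₁ x + 2 * t * φ.q₂ x := by
  simp only [val_eq]
  have h1 : HasDerivAt (fun τ : ℝ => φ.q₀ x + τ * φ.q₁ x + τ ^ 2 * φ.q₂ x)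
      (0 + 1 * φ.q₁ x + (2 * t) * φ.q₂ x) t := by
    have h2 : HasDerivAt (fun τ : ℝ => τ ^ 2) (2 * t) t := by simpa using hasDerivAt_pow 2 t
    exact ((hasDerivAt_const t _).add ((hasDerivAt_id t).mul_const _)).add (h2.mul_const _)
  rw [h1.deriv]
  ring

end QuadTest

/-- The operator of the linear problem with a fixed control, on the space of arguments. -/
def Problem.FlinArg (P : Problem d A) (α : A) (z : Problem.Arg d) : ℝ :=
  P.Flin α z.1.1 z.1.2 z.2.1 z.2.2.1 z.2.2.2.1 z.2.2.2.2

open Classical in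
-- Casts the linear operator into time derivative, spatial part and source, mirroring the three
-- parts of a discrete row.
lemma Problem.FlinArg_jet (P : Problem d A) (α : A) (φ : QuadTest d) {t : ℝ} {y : Euc d}
    (ht : t ≠ P.T) (hyT : y ∉ interior P.Ω → y ∈ P.bdT ∪ P.bdR)
    (hyD : y ∈ P.bdT ∪ P.bdR → y ∉ P.bdD) :
    P.FlinArg α (Problem.jet φ.val (t, y) (φ.val (t, y))) =
      -(if y ∈ interior P.Ω ∪ P.bdT then φ.q₁ y + 2 * t * φ.q₂ y else 0) +
        P.spatial α y (φ.slice t) - P.source α y := by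
  have hs : (fun x => φ.val (t, x)) = φ.slice t := rfl
  have hv : φ.val (t, y) = φ.slice t y := rfl
  simp only [Problem.FlinArg, Problem.jet, Problem.Flin, if_neg ht, φ.deriv_val, hs, hv,
    Problem.spatial, Problem.source]
  by_cases hi : y ∈ interior P.Ω
  · simp only [if_pos hi, if_pos (show y ∈ interior P.Ω ∪ P.bdT from Or.inl hi)]
    ring
  · have hbd := hyT hi
    simp only [if_neg hi, if_neg (hyD hbd)]
    by_cases hT : y ∈ P.bdT
    · simp only [if_pos hT, if_pos (show y ∈ interior P.Ω ∪ P.bdT from Or.inr hT)]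
      ring
    · have hR : y ∈ P.bdR := hbd.resolve_left hT
      have : y ∉ interior P.Ω ∪ P.bdT := by
        rintro (h | h)
        · exact hi h
        · exact hT h
      simp only [if_neg hT, if_pos hR, if_neg this]
      ring

namespace Level

/-- The left-hand side of the discrete linear equation with a fixed control. -/
def row (D : Level d A) (P : Problem d A) (α : A) (u : ℕ → Euc d → ℝ) (k : ℕ) (y : Euc d) : ℝ :=
  -(D.dt P u k y) + (D.opE P α (u (k + 1)) y + D.opI P α (u k) y)

end Level

/-! ### Consistency of the full scheme on space-time quadratic test functions -/

namespace Admissible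

variable {P : Problem d A} {D : ℕ → Level d A}

lemma time_succ (i k : ℕ) : (D i).time P (k + 1) = (D i).time P k + (D i).h P := by
  simp only [Level.time]; push_cast; ring

variable {φ : QuadTest d} {p₀ p₁ p₂ : ℕ → Euc d → ℝ}

/-- The interpolation in time of the projections of the coefficients of a test function. -/
def projTest (P : Problem d A) (D : ℕ → Level d A) (p₀ p₁ p₂ : ℕ → Euc d → ℝ) (i k : ℕ) :
    Euc d → ℝ :=
  p₀ i + (D i).time P k • p₁ i + (D i).time P k ^ 2 • p₂ i

lemma projTest_mem (hp₀ : Approximates D p₀ φ.q₀) (hp₁ : Approximates D p₁ φ.q₁)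
    (hp₂ : Approximates D p₂ φ.q₂) (i k : ℕ) : projTest P D p₀ p₁ p₂ i k ∈ (D i).mesh.V :=
  Submodule.add_mem _ (Submodule.add_mem _ (hp₀.mem i) (Submodule.smul_mem _ _ (hp₁.mem i)))
    (Submodule.smul_mem _ _ (hp₂.mem i))

variable [MetricSpace A]

lemma time_M (h : Admissible P D) (i : ℕ) : (D i).time P (D i).M = P.T := by
  have : ((D i).M : ℝ) ≠ 0 := by exact_mod_cast (h.mesh.M_pos i).ne'
  simp only [Level.time, Level.h]
  field_simp

lemma time_nonneg (h : Admissible P D) (i k : ℕ) : 0 ≤ (D i).time P k :=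
  mul_nonneg (Nat.cast_nonneg _) (h.h_pos i).le

lemma time_le (h : Admissible P D) {i k : ℕ} (hk : k ≤ (D i).M) : (D i).time P k ≤ P.T := by
  rw [← h.time_M i]
  exact mul_le_mul_of_nonneg_right (by exact_mod_cast hk) (h.h_pos i).le

lemma time_lt (h : Admissible P D) {i k : ℕ} (hk : k < (D i).M) : (D i).time P k < P.T := by
  rw [← h.time_M i]
  exact mul_lt_mul_of_pos_right (by exact_mod_cast hk) (h.h_pos i)

lemma node_mem_Q (h : Admissible P D) {i k : ℕ} (hk : k ≤ (D i).M) {y : Euc d}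
    (hy : y ∈ (D i).mesh.nodes) : ((D i).time P k, y) ∈ P.Q :=
  ⟨⟨h.time_nonneg i k, h.time_le hk⟩, h.node_mem hy⟩

lemma eventually_projTest_unif (h : Admissible P D) (hp₀ : Approximates D p₀ φ.q₀)
    (hp₁ : Approximates D p₁ φ.q₁) (hp₂ : Approximates D p₂ φ.q₂) {ε : ℝ} (hε : 0 < ε) :
    ∀ᶠ i in atTop, ∀ k ≤ (D i).M, ∀ x ∈ P.Ω,
      |projTest P D p₀ p₁ p₂ i k x - φ.val ((D i).time P k, x)| ≤ ε := by
  have hT := h.standing.T_pos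
  set N := 1 + P.T + P.T ^ 2
  have hN : 0 < N := by positivity
  filter_upwards [hp₀.unif (ε / N) (by positivity), hp₁.unif (ε / N) (by positivity),
    hp₂.unif (ε / N) (by positivity)] with i h0 h1 h2 k hk x hx
  have hx' : x ∈ (D i).mesh.carrier := (h.mesh.carrier_eq i).symm ▸ hx
  have h0 := h0 x hx'
  have h1 := h1 x hx'
  have h2 := h2 x hx'
  set t := (D i).time P k
  have ht0 : 0 ≤ t := h.time_nonneg i k
  have htT : t ≤ P.T := h.time_le hk
  have e : projTest P D p₀ p₁ p₂ i k x - φ.val (t, x) =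
      (p₀ i x - φ.q₀ x) + t * (p₁ i x - φ.q₁ x) + t ^ 2 * (p₂ i x - φ.q₂ x) := by
    simp only [projTest, φ.val_eq, Pi.add_apply, Pi.smul_apply, smul_eq_mul]
    ring
  have e1 : |t * (p₁ i x - φ.q₁ x)| ≤ P.T * (ε / N) := by
    rw [abs_mul, abs_of_nonneg ht0]
    exact mul_le_mul htT h1 (abs_nonneg _) hT.le
  have e2 : |t ^ 2 * (p₂ i x - φ.q₂ x)| ≤ P.T ^ 2 * (ε / N) := by
    rw [abs_mul, abs_of_nonneg (sq_nonneg t)]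
    exact mul_le_mul (pow_le_pow_left₀ ht0 htT 2) h2 (abs_nonneg _) (sq_nonneg _)
  have e3 : ε / N + P.T * (ε / N) + P.T ^ 2 * (ε / N) = ε := by
    have : ε / N * N = ε := div_mul_cancel₀ _ hN.ne'
    calc _ = ε / N * N := by simp only [N]; ring
      _ = ε := this
  rw [e, ← e3]
  exact (abs_add_le _ _).trans (add_le_add ((abs_add_le _ _).trans (add_le_add h0 e1)) e2)

open Classical in
/-- Consistency of the scheme on quadratic test functions. -/
theorem eventually_consistent [CompactSpace A] (h : Admissible P D)
    (hp₀ : Approximates D p₀ φ.q₀) (hp₁ : Approximates D p₁ φ.q₁) (hp₂ : Approximates D p₂ φ.q₂)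
    {ε : ℝ} (hε : 0 < ε) :
    ∀ᶠ i in atTop, ∀ k < (D i).M, ∀ y ∈ (D i).mesh.nodes, y ∉ P.bdD → ∀ α,
      |(D i).row P α (projTest P D p₀ p₁ p₂ i) k y - (D i).rhs P α y -
        P.FlinArg α (Problem.jet φ.val ((D i).time P k, y) (φ.val ((D i).time P k, y)))| ≤ ε := by
  have hT := h.standing.T_pos
  obtain ⟨W, hW⟩ := h.exists_bound_quad φ.h₂
  -- In order: the spatial rows of the three coefficients, the discrete time derivative (two terms),
  -- the lag of the explicit operator, and the source.
  set N := (1 + P.T + P.T ^ 2) + (1 + 2 * P.T) + 1 + (1 + 2 * P.T) + 1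
  have hN : 0 < N := by positivity
  set η := ε / N with hη
  have hηpos : 0 < η := by positivity
  filter_upwards [h.eventually_rows hp₀ hηpos, h.eventually_rows hp₁ hηpos,
    h.eventually_rows hp₂ hηpos, h.eventually_h_mul_opE_le hp₁ hηpos,
    h.eventually_h_mul_opE_le hp₂ hηpos, hp₁.unif η hηpos, hp₂.unif η hηpos,
    h.eventually_rhs hηpos, h.h_lt (δ := η / (|W| + 1)) (by positivity)]
    with i r0 r1 r2 x1 x2 u1 u2 hrhs hh k hk y hy hyD α
  have hyΩ := h.node_mem hy
  have hyΩ' : y ∈ (D i).mesh.carrier := (h.mesh.carrier_eq i).symm ▸ hyΩ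
  have r0 := r0 α y hy hyD
  have r1 := r1 α y hy hyD
  have r2 := r2 α y hy hyD
  have x1 := x1 α y hy
  have x2 := x2 α y hy
  have u1 := u1 y hyΩ'
  have u2 := u2 y hyΩ'
  have hrhs := hrhs α y hy
  have hh0 := h.h_pos i
  set t := (D i).time P k with ht
  have ht0 : 0 ≤ t := h.time_nonneg i k
  have htT : t < P.T := h.time_lt hk
  set τ := (D i).h P with hτ
  have htτ : t + τ ≤ P.T := by
    rw [ht, hτ, ← time_succ]; exact h.time_le hk
  have hE := h.isMonoRow_opE i α hy
  have hI := h.isMonoRow_opI i α hy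
  rw [P.FlinArg_jet α φ htT.ne (fun hi => h.mem_bd hyΩ hi hyD) (fun _ => hyD), φ.spatial_slice]
  have E1 : (D i).opE P α (projTest P D p₀ p₁ p₂ i (k + 1)) y =
      (D i).opE P α (p₀ i) y + (t + τ) * (D i).opE P α (p₁ i) y +
        (t + τ) ^ 2 * (D i).opE P α (p₂ i) y := by
    rw [projTest, time_succ, hE.add _ (Submodule.add_mem _ (hp₀.mem i)
      (Submodule.smul_mem _ _ (hp₁.mem i))) _ (Submodule.smul_mem _ _ (hp₂.mem i)),
      hE.add _ (hp₀.mem i) _ (Submodule.smul_mem _ _ (hp₁.mem i)), hE.smul _ _ (hp₁.mem i),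
      hE.smul _ _ (hp₂.mem i)]
  have I1 : (D i).opI P α (projTest P D p₀ p₁ p₂ i k) y =
      (D i).opI P α (p₀ i) y + t * (D i).opI P α (p₁ i) y + t ^ 2 * (D i).opI P α (p₂ i) y := by
    rw [projTest, hI.add _ (Submodule.add_mem _ (hp₀.mem i)
      (Submodule.smul_mem _ _ (hp₁.mem i))) _ (Submodule.smul_mem _ _ (hp₂.mem i)),
      hI.add _ (hp₀.mem i) _ (Submodule.smul_mem _ _ (hp₁.mem i)), hI.smul _ _ (hp₁.mem i),
      hI.smul _ _ (hp₂.mem i)]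
  have dt1 : |(D i).dt P (projTest P D p₀ p₁ p₂ i) k y -
      (if y ∈ interior P.Ω ∪ P.bdT then φ.q₁ y + 2 * t * φ.q₂ y else 0)| ≤
      (1 + 2 * P.T) * η + η := by
    rw [Level.dt]
    split_ifs with hyT
    -- The difference quotient of `t ^ 2` is `2 * t + τ`, so besides the projection errors only `τ *
    -- φ.q₂ y` remains.
    · have e : (projTest P D p₀ p₁ p₂ i (k + 1) y - projTest P D p₀ p₁ p₂ i k y) / (D i).h P -
          (φ.q₁ y + 2 * t * φ.q₂ y) =
          (p₁ i y - φ.q₁ y) + (2 * t + τ) * (p₂ i y - φ.q₂ y) + τ * φ.q₂ y := by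
        rw [projTest, projTest, time_succ, ← ht, ← hτ]
        simp only [Pi.add_apply, Pi.smul_apply, smul_eq_mul]
        field_simp
        ring
      have e1 : |(2 * t + τ) * (p₂ i y - φ.q₂ y)| ≤ 2 * P.T * η := by
        rw [abs_mul, abs_of_nonneg (by positivity)]
        exact mul_le_mul (by linarith) u2 (abs_nonneg _) (by positivity)
      have e2 : |τ * φ.q₂ y| ≤ η := by
        rw [abs_mul, abs_of_nonneg hh0.le]
        calc τ * |φ.q₂ y| ≤ η / (|W| + 1) * (|W| + 1) :=
              mul_le_mul hh.le (((hW y hyΩ).trans (le_abs_self W)).trans (by linarith))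
                (abs_nonneg _) (by positivity)
          _ = η := div_mul_cancel₀ _ (by positivity)
      rw [e]
      refine (abs_add_le _ _).trans (add_le_add ((abs_add_le _ _).trans ?_) e2)
      linarith
    · rw [sub_zero, abs_zero]; positivity
  -- Expanding the explicit operator at time `t + τ` about `t` isolates `τ E p₁` and `(2 t + τ) τ E
  -- p₂`. Consistency does not bound these, since it concerns only the sum of the explicit and
  -- implicit operators; they vanish by `eventually_h_mul_opE_le`.
  have e : (D i).row P α (projTest P D p₀ p₁ p₂ i) k y - (D i).rhs P α y -
      (-(if y ∈ interior P.Ω ∪ P.bdT then φ.q₁ y + 2 * t * φ.q₂ y else 0) +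
        (P.spatial α y φ.q₀ + t * P.spatial α y φ.q₁ + t ^ 2 * P.spatial α y φ.q₂) -
          P.source α y) =
      -((D i).dt P (projTest P D p₀ p₁ p₂ i) k y -
        (if y ∈ interior P.Ω ∪ P.bdT then φ.q₁ y + 2 * t * φ.q₂ y else 0)) +
      ((D i).opE P α (p₀ i) y + (D i).opI P α (p₀ i) y - P.spatial α y φ.q₀) +
      t * ((D i).opE P α (p₁ i) y + (D i).opI P α (p₁ i) y - P.spatial α y φ.q₁) +
      t ^ 2 * ((D i).opE P α (p₂ i) y + (D i).opI P α (p₂ i) y - P.spatial α y φ.q₂) +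
      τ * (D i).opE P α (p₁ i) y + (2 * t + τ) * (τ * (D i).opE P α (p₂ i) y) -
      ((D i).rhs P α y - P.source α y) := by
    rw [Level.row, E1, I1]
    ring
  rw [e]
  have f1 : |t * ((D i).opE P α (p₁ i) y + (D i).opI P α (p₁ i) y - P.spatial α y φ.q₁)| ≤
      P.T * η := by
    rw [abs_mul, abs_of_nonneg ht0]
    exact mul_le_mul htT.le r1 (abs_nonneg _) hT.le
  have f2 : |t ^ 2 * ((D i).opE P α (p₂ i) y + (D i).opI P α (p₂ i) y - P.spatial α y φ.q₂)| ≤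
      P.T ^ 2 * η := by
    rw [abs_mul, abs_of_nonneg (sq_nonneg t)]
    exact mul_le_mul (pow_le_pow_left₀ ht0 htT.le 2) r2 (abs_nonneg _) (sq_nonneg _)
  have f3 : |τ * (D i).opE P α (p₁ i) y| ≤ η := by
    rw [abs_mul, abs_of_nonneg hh0.le]; exact x1
  have f4 : |(2 * t + τ) * (τ * (D i).opE P α (p₂ i) y)| ≤ 2 * P.T * η := by
    rw [abs_mul, abs_mul τ, abs_of_nonneg hh0.le, abs_of_nonneg (by positivity)]
    exact mul_le_mul (by linarith) x2 (by positivity) (by positivity)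
  have hNη : η * N = ε := div_mul_cancel₀ _ hN.ne'
  have hNe : η * N = (1 + 2 * P.T) * η + η + η + P.T * η + P.T ^ 2 * η + η + 2 * P.T * η + η := by
    simp only [N]; ring
  rw [abs_le] at *
  constructor <;> linarith [dt1.1, dt1.2, r0.1, r0.2, f1.1, f1.2, f2.1, f2.2, f3.1, f3.2, f4.1,
    f4.2, hrhs.1, hrhs.2]

end Admissible

end HJB

namespace HJB

variable {d : ℕ} {A : Type*}

/-! ## Boundedness of the rows with respect to the control -/

namespace Mesh

variable {T : Mesh d} {y : Euc d}

/-- An upper bound uniform in the control is indispensable: the real supremum over an unbounded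
family would be the default value zero and would dominate no individual row. -/
lemma exists_domRow_le {a : A → Euc d → ℝ} {b : A → Euc d → Euc d} {c : A → Euc d → ℝ}
    (hy : y ∈ T.nodes) (hb : ∀ α, ContinuousOn (b α) T.carrier)
    (hc : ∀ α, ContinuousOn (c α) T.carrier) {Ca Cb Cc : ℝ} (ha' : ∀ α, ‖a α y‖ ≤ Ca)
    (hb' : ∀ α, ∀ x ∈ T.carrier, ‖b α x‖ ≤ Cb) (hc' : ∀ α, ∀ x ∈ T.carrier, ‖c α x‖ ≤ Cc)
    {w : Euc d → ℝ} (hw : w ∈ T.V) :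
    ∃ C, ∀ α, domRow T.carrier T (a α) (b α) (c α) w y ≤ C := by
  obtain ⟨G, hG⟩ := exists_gradient_bound hw
  obtain ⟨W, hW⟩ := exists_bound (continuousOn_carrier hw)
  set I := ∫ x in T.carrier, inner ℝ (gradient w x) (gradient (T.nhat y) x)
  refine ⟨Ca * |I| + (Cb * G + Cc * W), fun α => ?_⟩
  rw [domRow]
  refine add_le_add ?_ ?_
  · calc a α y * I ≤ |a α y * I| := le_abs_self _
      _ ≤ _ := by rw [abs_mul]; exact mul_le_mul_of_nonneg_right (ha' α) (abs_nonneg _)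
  · have := abs_integral_mul_nhat_sub_le (r := 0) (ε := Cb * G + Cc * W) hy
      (integrableOn_lower (hb α) (hc α) hw (nhat_mem_V (T := T) y)) fun K hK _ x hx => ?_
    · rw [sub_zero] at this
      exact (le_abs_self _).trans this
    · have hx' := hull_subset_carrier hK (interior_subset hx)
      rw [sub_zero]
      refine (abs_add_le _ _).trans (add_le_add ?_ ?_)
      · rw [abs_neg]
        exact (abs_real_inner_le_norm _ _).trans (mul_le_mul (hb' α x hx') (hG K hK x hx)
          (norm_nonneg _) ((norm_nonneg _).trans (hb' α x hx')))
      · rw [abs_mul]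
        exact mul_le_mul (hc' α x hx') (hW x hx') (abs_nonneg _)
          ((norm_nonneg _).trans (hc' α x hx'))

lemma exists_bdRow_le {b : A → Euc d → Euc d} {c : A → Euc d → ℝ}
    (hy : y ∈ T.nodes) (hb : ∀ α, b α y ∈ tangentCone T.carrier y) {Cb Cc : ℝ}
    (hb' : ∀ α, ‖b α y‖ ≤ Cb) (hc' : ∀ α, ‖c α y‖ ≤ Cc) {w : Euc d → ℝ} (hw : w ∈ T.V) :
    ∃ C, ∀ α, bdRow (b α) (c α) w y ≤ C := by
  obtain ⟨G, hG⟩ := exists_gradient_bound hw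
  refine ⟨Cb * |G| + Cc * |w y|, fun α => ?_⟩
  rw [bdRow]
  refine add_le_add ?_ ?_
  · have := abs_diniDeriv_add_inner_le (g := 0) (ε := |G|) hy (hb α) hw fun K hK _ => by
      obtain ⟨x, hx⟩ := interior_hull_nonempty hK
      exact ⟨x, hx, by rw [sub_zero]; exact (hG K hK x hx).trans (le_abs_self G)⟩
    rw [inner_zero_right, add_zero] at this
    exact (le_abs_self _).trans
      (this.trans (mul_le_mul_of_nonneg_right (hb' α) (abs_nonneg _)))
  · calc c α y * w y ≤ |c α y * w y| := le_abs_self _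
      _ ≤ _ := by rw [abs_mul]; exact mul_le_mul_of_nonneg_right (hc' α) (abs_nonneg _)

end Mesh

namespace Admissible

variable {P : Problem d A} {D : ℕ → Level d A} {v : ℕ → ℕ → Euc d → ℝ}

lemma FlinArg_final (α : A) (φ : ℝ × Euc d → ℝ) (y : Euc d) (s : ℝ) :
    P.FlinArg α (Problem.jet φ (P.T, y) s) = s - P.vT y := by
  simp [Problem.FlinArg, Problem.Flin, Problem.jet]

/-- Some control comes within `ε` of the supremum in the scheme; attainment is not needed. -/
lemma exists_row_sub_rhs_gt [Nonempty A] (hv : ∀ i, (D i).IsNumericalSolution P (v i)) {i k : ℕ}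
    (hk : k < (D i).M) {y : Euc d} (hy : y ∈ (D i).mesh.nodes) {ε : ℝ} (hε : 0 < ε) :
    ∃ α, -ε < (D i).row P α (v i) k y - (D i).rhs P α y := by
  have h2 := (hv i).scheme k hk y hy
  obtain ⟨α, hα⟩ := exists_lt_of_lt_ciSup (f := fun α => (D i).opE P α (v i (k + 1)) y +
    (D i).opI P α (v i k) y - (D i).rhs P α y) (b := (D i).dt P (v i) k y - ε) (by linarith)
  refine ⟨α, ?_⟩
  rw [Level.row]
  linarith

variable [MetricSpace A]

lemma exists_opE_le [CompactSpace A] (h : Admissible P D) (i : ℕ) {y : Euc d}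
    (hy : y ∈ (D i).mesh.nodes) {w : Euc d → ℝ} (hw : w ∈ (D i).mesh.V) :
    ∃ C, ∀ α, (D i).opE P α w y ≤ C := by
  have hcar := h.mesh.carrier_eq i
  have hΩ := h.isCompact_Ω
  have hr := h.reg i
  have hyΩ := h.node_mem hy
  by_cases hi : y ∈ interior P.Ω
  · simp only [Level.opE, if_pos hi]
    obtain ⟨Ca, ha⟩ := exists_bound_family (S := P.Ω)
      (fun α => hΩ.exists_bound_of_continuousOn (hr.aE_cont α)) hr.aE_dep
    obtain ⟨Cb, hb⟩ := exists_bound_family (S := P.Ω)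
      (fun α => hΩ.exists_bound_of_continuousOn (hr.bE_cont α)) hr.bE_dep
    obtain ⟨Cc, hc⟩ := exists_bound_family (S := P.Ω)
      (fun α => hΩ.exists_bound_of_continuousOn (hr.cE_cont α)) hr.cE_dep
    rw [← hcar] at hb hc ⊢
    exact Mesh.exists_domRow_le hy (hcar ▸ hr.bE_cont) (hcar ▸ hr.cE_cont)
      (fun α => ha α y hyΩ) hb hc hw
  · by_cases hD : y ∈ P.bdD
    · simp only [Level.opE, if_neg hi, if_pos hD]
      exact ⟨0, fun _ => le_rfl⟩
    · simp only [Level.opE, if_neg hi, if_neg hD]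
      obtain ⟨Cb, hb⟩ := exists_bound_family (fun α => (hr.bBE_pc α).1) hr.bBE_dep
      obtain ⟨Cc, hc⟩ := exists_bound_family (fun α => (hr.cBE_pc α).1) hr.cBE_dep
      have hyf := mem_frontier hyΩ hi
      refine Mesh.exists_bdRow_le hy (fun α => ?_) (fun α => hb α y hyf) (fun α => hc α y hyf) hw
      rw [hcar]
      exact (h.sign i).bBE_cone α y hy (h.mem_bd hyΩ hi hD)

lemma exists_opI_le [CompactSpace A] (h : Admissible P D) (i : ℕ) {y : Euc d}
    (hy : y ∈ (D i).mesh.nodes) {w : Euc d → ℝ} (hw : w ∈ (D i).mesh.V) :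
    ∃ C, ∀ α, (D i).opI P α w y ≤ C := by
  have hcar := h.mesh.carrier_eq i
  have hΩ := h.isCompact_Ω
  have hr := h.reg i
  have hyΩ := h.node_mem hy
  by_cases hi : y ∈ interior P.Ω
  · simp only [Level.opI, if_pos hi]
    obtain ⟨Ca, ha⟩ := exists_bound_family (S := P.Ω)
      (fun α => hΩ.exists_bound_of_continuousOn (hr.aI_cont α)) hr.aI_dep
    obtain ⟨Cb, hb⟩ := exists_bound_family (S := P.Ω)
      (fun α => hΩ.exists_bound_of_continuousOn (hr.bI_cont α)) hr.bI_dep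
    obtain ⟨Cc, hc⟩ := exists_bound_family (S := P.Ω)
      (fun α => hΩ.exists_bound_of_continuousOn (hr.cI_cont α)) hr.cI_dep
    rw [← hcar] at hb hc ⊢
    exact Mesh.exists_domRow_le hy (hcar ▸ hr.bI_cont) (hcar ▸ hr.cI_cont)
      (fun α => ha α y hyΩ) hb hc hw
  · by_cases hD : y ∈ P.bdD
    · simp only [Level.opI, if_neg hi, if_pos hD]
      exact ⟨w y, fun _ => le_rfl⟩
    · simp only [Level.opI, if_neg hi, if_neg hD]
      obtain ⟨Cb, hb⟩ := exists_bound_family (fun α => (hr.bBI_pc α).1) hr.bBI_dep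
      obtain ⟨Cc, hc⟩ := exists_bound_family (fun α => (hr.cBI_pc α).1) hr.cBI_dep
      have hyf := mem_frontier hyΩ hi
      refine Mesh.exists_bdRow_le hy (fun α => ?_) (fun α => hb α y hyf) (fun α => hc α y hyf) hw
      rw [hcar]
      exact (h.sign i).bBI_cone α y hy (h.mem_bd hyΩ hi hD)

lemma rhs_nonneg (h : Admissible P D) (i : ℕ) (α : A) {y : Euc d}
    (hy : y ∈ (D i).mesh.nodes) : 0 ≤ (D i).rhs P α y := by
  have hyΩ := h.node_mem hy
  rw [Level.rhs]
  split_ifs with hi hD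
  · rw [← h.mesh.carrier_eq i]
    refine setIntegral_nonneg (Mesh.measurableSet_carrier _) fun x hx =>
      mul_nonneg ((h.sign i).f_nonneg α x ?_) (Mesh.nhat_nonneg hy x)
    rwa [← h.mesh.carrier_eq i]
  · exact h.standing.g_nonneg y (mem_frontier hyΩ hi)
  · exact (h.sign i).gB_nonneg α y (mem_frontier hyΩ hi)

/-- Each control contributes at most the supremum, which the scheme equates with the discrete time
derivative; nonnegative data and bounded rows make this supremum genuine. -/
lemma row_sub_rhs_nonpos [CompactSpace A] (h : Admissible P D)
    (hv : ∀ i, (D i).IsNumericalSolution P (v i)) {i k : ℕ} (hk : k < (D i).M) {y : Euc d}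
    (hy : y ∈ (D i).mesh.nodes) (α : A) : (D i).row P α (v i) k y - (D i).rhs P α y ≤ 0 := by
  obtain ⟨C, hC⟩ := h.exists_opE_le i hy ((hv i).mem (k + 1) hk)
  obtain ⟨C', hC'⟩ := h.exists_opI_le i hy ((hv i).mem k hk.le)
  have hbdd : BddAbove (range fun α => (D i).opE P α (v i (k + 1)) y + (D i).opI P α (v i k) y -
      (D i).rhs P α y) := by
    refine ⟨C + C', ?_⟩
    rintro _ ⟨β, rfl⟩
    have := h.rhs_nonneg i β hy
    linarith [hC β, hC' β]
  have h1 := le_ciSup hbdd α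
  have h2 := (hv i).scheme k hk y hy
  rw [Level.row]
  linarith

/-! ## Local maxima of grid functions -/

lemma row_sub (h : Admissible P D) (i : ℕ) (α : A) {u w : ℕ → Euc d → ℝ} {k : ℕ} {y : Euc d}
    (hy : y ∈ (D i).mesh.nodes) (hu : u k ∈ (D i).mesh.V) (hu' : u (k + 1) ∈ (D i).mesh.V)
    (hw : w k ∈ (D i).mesh.V) (hw' : w (k + 1) ∈ (D i).mesh.V) :
    (D i).row P α (fun k => u k - w k) k y = (D i).row P α u k y - (D i).row P α w k y := by
  rw [Level.row, Level.row, Level.row, (h.isMonoRow_opE i α hy).sub hu' hw',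
    (h.isMonoRow_opI i α hy).sub hu hw]
  have : (D i).dt P (fun k => u k - w k) k y = (D i).dt P u k y - (D i).dt P w k y := by
    simp only [Level.dt, Pi.sub_apply]
    split_ifs <;> ring
  rw [this]
  ring

/-- At a nonnegative maximum over the neighbouring space-time nodes, every row is nonnegative. -/
lemma row_nonneg (h : Admissible P D) (i : ℕ) (α : A) {u : ℕ → Euc d → ℝ} {k : ℕ} {y : Euc d}
    (hy : y ∈ (D i).mesh.nodes) (hu : u k ∈ (D i).mesh.V) (hu' : u (k + 1) ∈ (D i).mesh.V)
    (h0 : 0 ≤ u k y) (hk : ∀ z, (D i).mesh.Nbr y z → u k z ≤ u k y)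
    (hk' : ∀ z, (D i).mesh.Nbr y z → u (k + 1) z ≤ u k y) : 0 ≤ (D i).row P α u k y := by
  have hI := (h.isMonoRow_opI i α hy).le hy hu h0 hk
  have hE := (h.isMonoRow_opE i α hy).le hy hu' h0 hk'
  rw [sub_self, zero_mul] at hI
  rw [Level.row, Level.dt]
  split_ifs with hT
  · have ht := (h.mono i).timestep α y hy hT
    have hpos := h.h_pos i
    have h1 : u (k + 1) y - u k y ≤ 0 := sub_nonpos.2 (hk' y (Mesh.Nbr.refl hy))
    have h2 : (D i).opE P α ((D i).mesh.hat y) y ≤ 1 / (D i).h P := by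
      rw [le_div_iff₀ hpos]; linarith
    have h3 := mul_le_mul_of_nonpos_left h2 h1
    rw [mul_one_div] at h3
    linarith
  · rw [h.opE_eq_zero i α _ hT (h.node_mem hy)]
    linarith

/-- A strict nonnegative local maximum of a grid function in a ball is attained at a node at which
all rows are nonnegative. -/
lemma exists_local_max (h : Admissible P D) {i : ℕ} {u : ℕ → Euc d → ℝ}
    (hu : ∀ k ≤ (D i).M, u k ∈ (D i).mesh.V) {z₀ : ℝ × Euc d} {r : ℝ}
    (hh : (D i).h P < r / 2) (hs : (D i).mesh.meshSize < r / 2) {k₀ : ℕ} {y₀ : Euc d}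
    (hk₀ : k₀ ≤ (D i).M) (hy₀ : y₀ ∈ (D i).mesh.nodes)
    (hd₀ : dist ((D i).time P k₀, y₀) z₀ < r / 2) (h0 : 0 ≤ u k₀ y₀)
    (hann : ∀ k ≤ (D i).M, ∀ y ∈ (D i).mesh.nodes, r / 2 ≤ dist ((D i).time P k, y) z₀ →
      dist ((D i).time P k, y) z₀ < r → u k y < u k₀ y₀) :
    ∃ k ≤ (D i).M, ∃ y ∈ (D i).mesh.nodes, dist ((D i).time P k, y) z₀ < r / 2 ∧ 0 ≤ u k y ∧
      (k < (D i).M → ∀ α, 0 ≤ (D i).row P α u k y) := by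
  have hr : 0 < r := by linarith [h.h_pos i]
  set S : Set (ℕ × Euc d) := {q | q.1 ≤ (D i).M ∧ q.2 ∈ (D i).mesh.nodes ∧
    dist ((D i).time P q.1, q.2) z₀ < r} with hS
  have hSfin : S.Finite :=
    ((finite_Iic (D i).M).prod (D i).mesh.finite_nodes).subset fun q hq => ⟨hq.1, hq.2.1⟩
  have hq₀ : (k₀, y₀) ∈ S := ⟨hk₀, hy₀, hd₀.trans (by linarith)⟩
  obtain ⟨⟨k, y⟩, ⟨hk, hy, hd⟩, hmax⟩ :=
    hSfin.exists_maximalFor (fun q => u q.1 q.2) S ⟨_, hq₀⟩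
  have hmax' : ∀ k' y', (k', y') ∈ S → u k' y' ≤ u k y := fun k' y' hq => by
    by_contra! hlt
    exact (lt_irrefl _ (hlt.trans_le (hmax hq hlt.le)))
  have h1 := hmax' k₀ y₀ hq₀
  -- The maximiser over the ball cannot lie in the outer annulus, where all values are below the one
  -- at the given node.
  have hd2 : dist ((D i).time P k, y) z₀ < r / 2 := by
    by_contra! hge
    exact absurd h1 (not_le.2 (hann k hk y hy hge hd))
  -- Time step and mesh size are below `r / 2`, so space-time neighbours of the maximiser still lie
  -- in the ball over which it is maximal.
  have hnear : ∀ k' y', k' ≤ (D i).M → |(D i).time P k' - (D i).time P k| ≤ (D i).h P →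
      (D i).mesh.Nbr y y' → u k' y' ≤ u k y := by
    intro k' y' hk' ht hn
    refine hmax' k' y' ⟨hk', hn.mem_nodes, ?_⟩
    have h2 : dist ((D i).time P k', y') ((D i).time P k, y) < r / 2 := by
      rw [Prod.dist_eq]
      refine max_lt ?_ ?_
      · rw [Real.dist_eq]; exact ht.trans_lt hh
      · rw [dist_comm]; exact hn.dist_le.trans_lt hs
    linarith [dist_triangle ((D i).time P k', y') ((D i).time P k, y) z₀]
  refine ⟨k, hk, y, hy, hd2, h0.trans h1, fun hkM α => ?_⟩
  refine h.row_nonneg i α hy (hu k hk) (hu (k + 1) hkM) (h0.trans h1) (fun z hz => ?_)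
    fun z hz => ?_
  · exact hnear k z hk (by rw [sub_self, abs_zero]; exact (h.h_pos i).le) hz
  · exact hnear (k + 1) z hkM (by rw [time_succ, add_sub_cancel_left,
      abs_of_pos (h.h_pos i)]) hz

/-! ## Passage to the limit at local extrema -/

lemma FlinArg_dirichlet (h : Admissible P D) (α : A) (φ : ℝ × Euc d → ℝ) {t : ℝ} {y : Euc d}
    (ht : t ≠ P.T) (hy : y ∈ P.bdD) (s : ℝ) :
    P.FlinArg α (Problem.jet φ (t, y) s) = s - P.g y := by
  have h1 : y ∉ interior P.Ω := h.notMem_interior (Or.inl (Or.inl hy))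
  have h2 : y ∉ P.bdT := fun hT => h.standing.disj_DT.le_bot ⟨hy, hT⟩
  have h3 : y ∉ P.bdR := fun hR => h.standing.disj_DR.le_bot ⟨hy, hR⟩
  simp [Problem.FlinArg, Problem.Flin, Problem.jet, ht, h1, h2, h3]

/-- At a discrete maximum of `v` minus the projected test function, the rows of `v` exceed those of
the projection, while by the Bellman equation they are at most the right-hand side; consistency
turns this into an upper bound for every linear operator. At final-time and Dirichlet nodes `v`
equals the data, and nonnegativity of the maximum bounds the test function by them. -/
theorem eventually_local_max [CompactSpace A] (h : Admissible P D)
    (hproj : HasEllipticProjections P D) (hv : ∀ i, (D i).IsNumericalSolution P (v i))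
    (φ : QuadTest d) (z₀ : ℝ × Euc d) {r η ε : ℝ} (hr : 0 < r) (hη : 0 < η) (hε : 0 < ε) :
    ∀ᶠ i in atTop, ∀ k₀ ≤ (D i).M, ∀ y₀ ∈ (D i).mesh.nodes,
      dist ((D i).time P k₀, y₀) z₀ < r / 2 → η ≤ v i k₀ y₀ - φ.val ((D i).time P k₀, y₀) →
      (∀ k ≤ (D i).M, ∀ y ∈ (D i).mesh.nodes, r / 2 ≤ dist ((D i).time P k, y) z₀ →
        dist ((D i).time P k, y) z₀ < r → v i k y - φ.val ((D i).time P k, y) ≤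
          v i k₀ y₀ - φ.val ((D i).time P k₀, y₀) - η) →
      ∃ z ∈ P.Q, dist z z₀ < r / 2 ∧ ∀ α, P.FlinArg α (Problem.jet φ.val z (φ.val z)) ≤ ε := by
  obtain ⟨p₀, hp₀⟩ := exists_approximates h.mesh.carrier_eq hproj φ.h₀
  obtain ⟨p₁, hp₁⟩ := exists_approximates h.mesh.carrier_eq hproj φ.h₁
  obtain ⟨p₂, hp₂⟩ := exists_approximates h.mesh.carrier_eq hproj φ.h₂
  -- Projection errors of `η / 3` at two nodes leave part of the gap `η`, so the maximum stays
  -- strict and nonnegative; the bound `ε` serves the nodes where the data are prescribed.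
  filter_upwards [h.eventually_projTest_unif hp₀ hp₁ hp₂ (ε := min (η / 3) ε) (by positivity),
    h.eventually_consistent hp₀ hp₁ hp₂ hε, h.h_lt (half_pos hr), h.meshSize_lt (half_pos hr)]
    with i hu hc hh hs k₀ hk₀ y₀ hy₀ hd₀ h0 hann
  set w := projTest P D p₀ p₁ p₂ i with hw
  have hu' : ∀ k ≤ (D i).M, ∀ y ∈ (D i).mesh.nodes, |w k y - φ.val ((D i).time P k, y)| ≤ η / 3 :=
    fun k hk y hy => (hu k hk y (h.node_mem hy)).trans (min_le_left _ _)
  have hu₀ := abs_le.1 (hu' k₀ hk₀ y₀ hy₀)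
  have hwV : ∀ k, w k ∈ (D i).mesh.V := fun k => projTest_mem hp₀ hp₁ hp₂ i k
  obtain ⟨k, hk, y, hy, hd, hpos, hrow⟩ := h.exists_local_max (i := i) (u := fun k => v i k - w k)
    (fun k hk => Submodule.sub_mem _ ((hv i).mem k hk) (hwV k)) (z₀ := z₀) hh hs hk₀ hy₀ hd₀
    (by simp only [Pi.sub_apply]; linarith) (fun k hk y hy hd1 hd2 => by
      have h1 := hann k hk y hy hd1 hd2
      have h2 := abs_le.1 (hu' k hk y hy)
      simp only [Pi.sub_apply]
      linarith)
  refine ⟨((D i).time P k, y), h.node_mem_Q hk hy, hd, fun α => ?_⟩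
  have hwy := abs_le.1 ((hu k hk y (h.node_mem hy)).trans (min_le_right _ _))
  rw [Pi.sub_apply] at hpos
  rcases hk.eq_or_lt with rfl | hk
  · rw [h.time_M] at hwy ⊢
    rw [FlinArg_final, ← (hv i).final y hy]
    linarith
  · by_cases hD : y ∈ P.bdD
    · rw [h.FlinArg_dirichlet α _ (h.time_lt hk).ne hD, ← (hv i).dirichlet k hk.le y hy hD]
      linarith
    · have h1 := hrow hk α
      rw [h.row_sub i α hy ((hv i).mem k hk.le) ((hv i).mem (k + 1) hk) (hwV k) (hwV _)] at h1
      have h2 := h.row_sub_rhs_nonpos hv hk hy α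
      have h3 := abs_le.1 (hc k hk y hy hD α)
      linarith

/-- The roles of `v` and the projection are exchanged. Only one nearly optimal control is available,
which suffices for a lower bound of a supremum; `ε` is shared between consistency and
near-optimality. -/
theorem eventually_local_min [CompactSpace A] [Nonempty A] (h : Admissible P D)
    (hproj : HasEllipticProjections P D) (hv : ∀ i, (D i).IsNumericalSolution P (v i))
    (φ : QuadTest d) (z₀ : ℝ × Euc d) {r η ε : ℝ} (hr : 0 < r) (hη : 0 < η) (hε : 0 < ε) :
    ∀ᶠ i in atTop, ∀ k₀ ≤ (D i).M, ∀ y₀ ∈ (D i).mesh.nodes,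
      dist ((D i).time P k₀, y₀) z₀ < r / 2 → v i k₀ y₀ - φ.val ((D i).time P k₀, y₀) ≤ -η →
      (∀ k ≤ (D i).M, ∀ y ∈ (D i).mesh.nodes, r / 2 ≤ dist ((D i).time P k, y) z₀ →
        dist ((D i).time P k, y) z₀ < r →
          v i k₀ y₀ - φ.val ((D i).time P k₀, y₀) + η ≤ v i k y - φ.val ((D i).time P k, y)) →
      ∃ z ∈ P.Q, dist z z₀ < r / 2 ∧ ∃ α, -ε ≤ P.FlinArg α (Problem.jet φ.val z (φ.val z)) := by
  obtain ⟨p₀, hp₀⟩ := exists_approximates h.mesh.carrier_eq hproj φ.h₀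
  obtain ⟨p₁, hp₁⟩ := exists_approximates h.mesh.carrier_eq hproj φ.h₁
  obtain ⟨p₂, hp₂⟩ := exists_approximates h.mesh.carrier_eq hproj φ.h₂
  filter_upwards [h.eventually_projTest_unif hp₀ hp₁ hp₂ (ε := min (η / 3) ε) (by positivity),
    h.eventually_consistent hp₀ hp₁ hp₂ (half_pos hε), h.h_lt (half_pos hr),
    h.meshSize_lt (half_pos hr)] with i hu hc hh hs k₀ hk₀ y₀ hy₀ hd₀ h0 hann
  set w := projTest P D p₀ p₁ p₂ i with hw
  have hu' : ∀ k ≤ (D i).M, ∀ y ∈ (D i).mesh.nodes, |w k y - φ.val ((D i).time P k, y)| ≤ η / 3 :=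
    fun k hk y hy => (hu k hk y (h.node_mem hy)).trans (min_le_left _ _)
  have hu₀ := abs_le.1 (hu' k₀ hk₀ y₀ hy₀)
  have hwV : ∀ k, w k ∈ (D i).mesh.V := fun k => projTest_mem hp₀ hp₁ hp₂ i k
  obtain ⟨k, hk, y, hy, hd, hpos, hrow⟩ := h.exists_local_max (i := i) (u := fun k => w k - v i k)
    (fun k hk => Submodule.sub_mem _ (hwV k) ((hv i).mem k hk)) (z₀ := z₀) hh hs hk₀ hy₀ hd₀
    (by simp only [Pi.sub_apply]; linarith) (fun k hk y hy hd1 hd2 => by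
      have h1 := hann k hk y hy hd1 hd2
      have h2 := abs_le.1 (hu' k hk y hy)
      simp only [Pi.sub_apply]
      linarith)
  refine ⟨((D i).time P k, y), h.node_mem_Q hk hy, hd, ?_⟩
  have hwy := abs_le.1 ((hu k hk y (h.node_mem hy)).trans (min_le_right _ _))
  rw [Pi.sub_apply] at hpos
  rcases hk.eq_or_lt with rfl | hk
  · refine ⟨Classical.arbitrary A, ?_⟩
    rw [h.time_M] at hwy ⊢
    rw [FlinArg_final, ← (hv i).final y hy]
    linarith
  · by_cases hD : y ∈ P.bdD
    · refine ⟨Classical.arbitrary A, ?_⟩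
      rw [h.FlinArg_dirichlet _ _ (h.time_lt hk).ne hD, ← (hv i).dirichlet k hk.le y hy hD]
      linarith
    · obtain ⟨α, h2⟩ := exists_row_sub_rhs_gt hv hk hy (half_pos hε)
      refine ⟨α, ?_⟩
      have h1 := hrow hk α
      rw [h.row_sub i α hy (hwV k) (hwV _) ((hv i).mem k hk.le) ((hv i).mem (k + 1) hk)] at h1
      have h3 := abs_le.1 (hc k hk y hy hD α)
      linarith

end Admissible

end HJB

namespace HJB

variable {d : ℕ}

/-! ## Jets of twice continuously differentiable functions -/

/-- The jet, expressed with the derivatives in time and space. -/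
lemma jet_eq {ψ : ℝ × Euc d → ℝ} (hψ : ContDiff ℝ 2 ψ) (z : ℝ × Euc d) (s : ℝ) :
    Problem.jet ψ z s = (z, ∑ j, fderiv ℝ (fderiv ℝ ψ) z
        (0, EuclideanSpace.basisFun (Fin d) ℝ j) (0, EuclideanSpace.basisFun (Fin d) ℝ j),
      (InnerProductSpace.toDual ℝ (Euc d)).symm
        ((fderiv ℝ ψ z).comp (ContinuousLinearMap.inr ℝ ℝ (Euc d))),
      fderiv ℝ ψ z (1, 0), s) := by
  obtain ⟨t, x⟩ := z
  have hd : Differentiable ℝ ψ := hψ.differentiable (by simp)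
  have hd2 : Differentiable ℝ (fderiv ℝ ψ) :=
    (hψ.fderiv_right (m := 1) (by norm_num)).differentiable (by simp)
  have hin : ∀ x : Euc d, HasFDerivAt (fun x : Euc d => (t, x))
      (ContinuousLinearMap.inr ℝ ℝ (Euc d)) x := fun x => hasFDerivAt_prodMk_right t x
  have h1 : ∀ x, HasFDerivAt (fun x => ψ (t, x))
      ((fderiv ℝ ψ (t, x)).comp (ContinuousLinearMap.inr ℝ ℝ (Euc d))) x := fun x =>
    (hd (t, x)).hasFDerivAt.comp x (hin x)
  have h2 : fderiv ℝ (fun x => ψ (t, x)) =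
      fun x => (fderiv ℝ ψ (t, x)).comp (ContinuousLinearMap.inr ℝ ℝ (Euc d)) :=
    funext fun x => (h1 x).fderiv
  have h3 : ∀ v, fderiv ℝ (fderiv ℝ fun x => ψ (t, x)) x v =
      (fderiv ℝ (fderiv ℝ ψ) (t, x) (0, v)).comp (ContinuousLinearMap.inr ℝ ℝ (Euc d)) := by
    intro v
    have h4 : HasFDerivAt (fun x => fderiv ℝ ψ (t, x))
        ((fderiv ℝ (fderiv ℝ ψ) (t, x)).comp (ContinuousLinearMap.inr ℝ ℝ (Euc d))) x :=
      (hd2 (t, x)).hasFDerivAt.comp x (hin x)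
    rw [h2, (h4.clm_comp (hasFDerivAt_const _ x)).fderiv]
    ext u
    simp
  have h5 : HasDerivAt (fun τ => ψ (τ, x)) (fderiv ℝ ψ (t, x) (1, 0)) t := by
    have h6 : HasDerivAt (fun τ : ℝ => (τ, x)) ((1 : ℝ), (0 : Euc d)) t :=
      (hasDerivAt_id t).prodMk (hasDerivAt_const t x)
    exact (hd (t, x)).hasFDerivAt.comp_hasDerivAt t h6
  simp only [Problem.jet, laplacian_eq_sum_fderiv, h3, h5.deriv, gradient, (h1 x).fderiv]
  simp

lemma continuous_jet {ψ : ℝ × Euc d → ℝ} (hψ : ContDiff ℝ 2 ψ) :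
    Continuous fun p : (ℝ × Euc d) × ℝ => Problem.jet ψ p.1 p.2 := by
  have h1 : Continuous (fderiv ℝ ψ) := hψ.continuous_fderiv (by simp)
  have h2 : Continuous (fderiv ℝ (fderiv ℝ ψ)) :=
    (hψ.fderiv_right (m := 1) (by norm_num)).continuous_fderiv (by simp)
  have e : (fun p : (ℝ × Euc d) × ℝ => Problem.jet ψ p.1 p.2) = fun p => _ :=
    funext fun p => jet_eq hψ p.1 p.2
  rw [e]
  refine continuous_fst.prodMk (Continuous.prodMk ?_ (Continuous.prodMk ?_
    (Continuous.prodMk ?_ continuous_snd)))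
  · fun_prop
  · exact (InnerProductSpace.toDual ℝ (Euc d)).symm.continuous.comp
      ((h1.comp continuous_fst).clm_comp continuous_const)
  · fun_prop

/-- Reflection of jets, by which the construction of test functions at maxima serves for minima too.
-/
lemma jet_neg (ψ : ℝ × Euc d → ℝ) (z : ℝ × Euc d) (s : ℝ) :
    Problem.jet (-ψ) z (-s) = ((Problem.jet ψ z s).1, -(Problem.jet ψ z s).2) := by
  have h1 : (fun x => (-ψ) (z.1, x)) = -fun x => ψ (z.1, x) := rfl
  have h2 : (fun τ => (-ψ) (τ, z.2)) = -fun τ => ψ (τ, z.2) := rfl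
  have h3 : Laplacian.laplacian (-fun x => ψ (z.1, x)) = -Laplacian.laplacian fun x => ψ (z.1, x) :=
    InnerProductSpace.laplacian_neg
  have h4 : fderiv ℝ (-fun x => ψ (z.1, x)) z.2 = -fderiv ℝ (fun x => ψ (z.1, x)) z.2 := fderiv_neg
  have h5 : deriv (-fun τ => ψ (τ, z.2)) z.1 = -deriv (fun τ => ψ (τ, z.2)) z.1 := deriv.neg
  unfold Problem.jet gradient
  rw [h1, h2, h3, h4, h5, map_neg]
  rfl

/-! ## Second-order Taylor expansion -/

/-- The derivative of the remainder is the first-order remainder of `fderiv ℝ ψ`, hence `o(‖z -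
z₀‖)`; the mean value inequality on a ball integrates it. -/
lemma eventually_taylor_le {E : Type*} [NormedAddCommGroup E] [NormedSpace ℝ E] {ψ : E → ℝ}
    (hψ : ContDiff ℝ 2 ψ) (z₀ : E) {δ : ℝ} (hδ : 0 < δ) :
    ∀ᶠ z in 𝓝 z₀, |ψ z - (ψ z₀ + fderiv ℝ ψ z₀ (z - z₀) +
      (1 / 2) * fderiv ℝ (fderiv ℝ ψ) z₀ (z - z₀) (z - z₀))| ≤ δ * ‖z - z₀‖ ^ 2 := by
  have hd : Differentiable ℝ ψ := hψ.differentiable (by simp)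
  have hd2 : Differentiable ℝ (fderiv ℝ ψ) :=
    (hψ.fderiv_right (m := 1) (by norm_num)).differentiable (by simp)
  set l := fderiv ℝ ψ z₀
  set B := fderiv ℝ (fderiv ℝ ψ) z₀ with hB
  -- Symmetry of the second derivative merges the two terms from differentiating the quadratic form
  -- and cancels the factor `1 / 2`.
  have hsymm : ∀ u v, B u v = B v u := fun u v =>
    (hψ.contDiffAt.isSymmSndFDerivAt (x := z₀) (by simp)) u v
  set r : E → ℝ := fun z => ψ z - (ψ z₀ + l (z - z₀) + (1 / 2) * B (z - z₀) (z - z₀)) with hr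
  have hsub : ∀ z, HasFDerivAt (fun z => z - z₀) (.id ℝ E) z := fun z =>
    (hasFDerivAt_id z).sub_const z₀
  have hrd : ∀ z, HasFDerivAt r (fderiv ℝ ψ z - l - B (z - z₀)) z := by
    intro z
    have h1 : HasFDerivAt (fun z => B (z - z₀) (z - z₀))
        ((B (z - z₀)).comp (.id ℝ E) + (B.comp (.id ℝ E)).flip (z - z₀)) z :=
      (B.hasFDerivAt.comp z (hsub z)).clm_apply (hsub z)
    have h2 := (hd z).hasFDerivAt.sub (((hasFDerivAt_const (ψ z₀) z).add
      (l.hasFDerivAt.comp z (hsub z))).add (h1.const_mul (1 / 2)))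
    refine h2.congr_fderiv ?_
    ext v
    simp only [ContinuousLinearMap.comp_id, zero_add, sub_apply, add_apply, smul_apply,
      ContinuousLinearMap.flip_apply, smul_eq_mul]
    rw [hsymm v]
    ring
  have hev : ∀ᶠ z in 𝓝 z₀, ‖fderiv ℝ ψ z - l - B (z - z₀)‖ ≤ δ * ‖z - z₀‖ :=
    (hd2 z₀).hasFDerivAt.isLittleO.def hδ
  obtain ⟨ρ, hρ, hball⟩ := Metric.eventually_nhds_iff_ball.1 hev
  filter_upwards [Metric.ball_mem_nhds z₀ hρ] with z hz
  have hr0 : r z₀ = 0 := by simp [hr]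
  have hz' : ‖z - z₀‖ < ρ := by rwa [← dist_eq_norm]
  have := (convex_closedBall z₀ ‖z - z₀‖).norm_image_sub_le_of_norm_hasFDerivWithin_le
    (f := r) (C := δ * ‖z - z₀‖) (x := z₀) (y := z) (fun y _ => (hrd y).hasFDerivWithinAt)
    (fun y hy => by
      have hy : ‖y - z₀‖ ≤ ‖z - z₀‖ := by
        rw [← dist_eq_norm]; exact hy
      refine (hball y ?_).trans (mul_le_mul_of_nonneg_left hy hδ.le)
      rw [Metric.mem_ball, dist_eq_norm]
      exact hy.trans_lt hz') (Metric.mem_closedBall_self (norm_nonneg _))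
    (by rw [Metric.mem_closedBall, dist_eq_norm])
  rw [hr0, sub_zero, Real.norm_eq_abs] at this
  calc |r z| ≤ δ * ‖z - z₀‖ * ‖z - z₀‖ := this
    _ = _ := by ring

/-! ## Quadratic functions touching a given function -/

namespace QuadTest

lemma contDiff_val (φ : QuadTest d) {n : WithTop ℕ∞} : ContDiff ℝ n φ.val := by
  have : φ.val = fun z => φ.q₀ z.2 + z.1 * φ.q₁ z.2 + z.1 ^ 2 * φ.q₂ z.2 :=
    funext fun z => φ.val_eq z.1 z.2
  rw [this]
  have h0 := (φ.h₀.contDiff (n := n)).comp (contDiff_snd (𝕜 := ℝ) (E := ℝ) (F := Euc d))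
  have h1 := (φ.h₁.contDiff (n := n)).comp (contDiff_snd (𝕜 := ℝ) (E := ℝ) (F := Euc d))
  have h2 := (φ.h₂.contDiff (n := n)).comp (contDiff_snd (𝕜 := ℝ) (E := ℝ) (F := Euc d))
  exact (h0.add (contDiff_fst.mul h1)).add ((contDiff_fst.pow 2).mul h2)

/-- Addition of a constant. -/
def addConst (φ : QuadTest d) (c : ℝ) : QuadTest d :=
  ⟨φ.q₀ + fun _ => c, φ.q₁, φ.q₂, φ.h₀.add (IsQuad.const c), φ.h₁, φ.h₂⟩

lemma val_addConst (φ : QuadTest d) (c : ℝ) (z : ℝ × Euc d) :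
    (φ.addConst c).val z = φ.val z + c := by
  obtain ⟨t, x⟩ := z
  simp only [val_eq, addConst, Pi.add_apply]
  ring

lemma jet_addConst (φ : QuadTest d) (c : ℝ) (z : ℝ × Euc d) (s : ℝ) :
    Problem.jet (φ.addConst c).val z s = Problem.jet φ.val z s := by
  have h : (φ.addConst c).val = fun z => φ.val z + c := funext fun z => φ.val_addConst c z
  have h1 : fderiv ℝ (φ.addConst c).val = fderiv ℝ φ.val := by
    rw [h]; ext1 z; rw [fderiv_add_const]
  rw [jet_eq (contDiff_val _), jet_eq (contDiff_val _), h1]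

/-- The opposite test function. -/
def neg (φ : QuadTest d) : QuadTest d :=
  ⟨(-1 : ℝ) • φ.q₀, (-1 : ℝ) • φ.q₁, (-1 : ℝ) • φ.q₂, φ.h₀.smul _, φ.h₁.smul _, φ.h₂.smul _⟩

lemma val_neg (φ : QuadTest d) : φ.neg.val = -φ.val := by
  ext ⟨t, x⟩
  simp only [val_eq, neg, Pi.smul_apply, Pi.neg_apply, smul_eq_mul]
  ring

/-- Every space-time polynomial of degree two without constant term at `z₀` is an admissible test
function, after sorting its expansion by powers of time. -/
lemma exists_val_eq (z₀ : ℝ × Euc d) (l : ℝ × Euc d →L[ℝ] ℝ)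
    (B : ℝ × Euc d →L[ℝ] ℝ × Euc d →L[ℝ] ℝ) :
    ∃ φ : QuadTest d, ∀ z, φ.val z = l (z - z₀) + B (z - z₀) (z - z₀) := by
  set l' : ℝ × Euc d →L[ℝ] ℝ := l - B z₀ - B.flip z₀ with hl'
  set c : ℝ := -l z₀ + B z₀ z₀ with hc
  set I := ContinuousLinearMap.inr ℝ ℝ (Euc d)
  set e : ℝ × Euc d := (1, 0)
  -- With `(t, x) = t • e + I x`, these are the coefficients of `1`, `t` and `t ^ 2`; the `compL`
  -- expression is `B (I x) (I x)` as a bilinear map in `x`.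
  refine ⟨⟨(fun _ => c) + (fun x => l'.comp I x) +
      fun x => (((ContinuousLinearMap.compL ℝ (Euc d) (ℝ × Euc d) ℝ).flip I).comp (B.comp I)) x x,
    (fun _ => l' e) + (fun x => ((B e).comp I + (B.flip e).comp I) x), fun _ => B e e,
    ((IsQuad.const c).add (IsQuad.clm _)).add (IsQuad.bilin _),
    (IsQuad.const _).add (IsQuad.clm _), IsQuad.const _⟩, ?_⟩
  rintro ⟨t, x⟩
  have hz : ((t, x) : ℝ × Euc d) = t • e + I x := by
    simp [e, I]
  rw [val_eq, hz]
  simp only [Pi.add_apply, ContinuousLinearMap.comp_apply, add_apply, sub_apply, map_add, map_sub,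
    map_smul, smul_apply, smul_eq_mul, ContinuousLinearMap.flip_apply,
    ContinuousLinearMap.compL_apply, hl', hc]
  ring

/-- The Euclidean inner product of space-time. -/
def form (d : ℕ) : ℝ × Euc d →L[ℝ] ℝ × Euc d →L[ℝ] ℝ :=
  (ContinuousLinearMap.mul ℝ ℝ).bilinearComp (ContinuousLinearMap.fst ℝ ℝ (Euc d))
      (ContinuousLinearMap.fst ℝ ℝ (Euc d)) +
    (isBoundedBilinearMap_inner (𝕜 := ℝ) (E := Euc d)).toContinuousLinearMap.bilinearComp (ContinuousLinearMap.snd ℝ ℝ (Euc d))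
      (ContinuousLinearMap.snd ℝ ℝ (Euc d))

lemma form_apply (u v : ℝ × Euc d) : form d u v = u.1 * v.1 + inner ℝ u.2 v.2 := by
  simp [form]

lemma sq_norm_le_form (u : ℝ × Euc d) : ‖u‖ ^ 2 ≤ form d u u := by
  rw [form_apply, real_inner_self_eq_norm_sq]
  rcases le_total ‖u.1‖ ‖u.2‖ with h | h
  · rw [Prod.norm_def, max_eq_right h]
    nlinarith [sq_nonneg u.1]
  · rw [Prod.norm_def, max_eq_left h, Real.norm_eq_abs, sq_abs]
    nlinarith [sq_nonneg ‖u.2‖]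

/-- A `C²` function is touched from above by quadratic functions with nearby jets. -/
lemma exists_touching {ψ : ℝ × Euc d → ℝ} (hψ : ContDiff ℝ 2 ψ) (z₀ : ℝ × Euc d) {δ : ℝ}
    (hδ : 0 < δ) : ∃ φ : QuadTest d, φ.val z₀ = 0 ∧
      (∀ᶠ z in 𝓝 z₀, ψ z - ψ z₀ + δ * ‖z - z₀‖ ^ 2 ≤ φ.val z) ∧
      ∀ s, Problem.jet φ.val z₀ s =
        Problem.jet ψ z₀ s + (0, (4 * δ * d, (0, (0, 0)))) := by
  set l := fderiv ℝ ψ z₀ with hl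
  set H := fderiv ℝ (fderiv ℝ ψ) z₀ with hH
  have hsymm : ∀ u v, H u v = H v u := fun u v =>
    (hψ.contDiffAt.isSymmSndFDerivAt (x := z₀) (by simp)) u v
  -- One `δ` absorbs the Taylor remainder, the other leaves the strict gap. The spatial second
  -- derivative changes by `4 * δ` in each coordinate direction, which yields the shift `4 * δ * d`
  -- of the Laplacian.
  set B := (1 / 2 : ℝ) • H + (2 * δ) • form d with hB
  obtain ⟨φ, hφ⟩ := exists_val_eq z₀ l B
  refine ⟨φ, by rw [hφ]; simp, ?_, fun s => ?_⟩
  · filter_upwards [eventually_taylor_le hψ z₀ hδ] with z hz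
    have h1 := (abs_le.1 hz).2
    have h2 := sq_norm_le_form (z - z₀)
    rw [hφ, hB]
    simp only [add_apply, smul_apply, smul_eq_mul]
    nlinarith
  · have hsub : ∀ z, HasFDerivAt (fun z => z - z₀) (.id ℝ (ℝ × Euc d)) z := fun z =>
      (hasFDerivAt_id z).sub_const z₀
    have hd1 : ∀ z, HasFDerivAt φ.val (l + (B + B.flip) (z - z₀)) z := by
      intro z
      have h1 : HasFDerivAt (fun z => B (z - z₀) (z - z₀))
          ((B (z - z₀)).comp (.id ℝ _) + (B.comp (.id ℝ _)).flip (z - z₀)) z :=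
        (B.hasFDerivAt.comp z (hsub z)).clm_apply (hsub z)
      have h2 := (l.hasFDerivAt.comp z (hsub z)).add h1
      rw [funext hφ]
      refine h2.congr_fderiv ?_
      ext v <;> simp
    have hd : fderiv ℝ φ.val = fun z => l + (B + B.flip) (z - z₀) :=
      funext fun z => (hd1 z).fderiv
    have hd2 : fderiv ℝ (fderiv ℝ φ.val) z₀ = B + B.flip := by
      rw [hd]
      exact (((B + B.flip).hasFDerivAt.comp z₀ (hsub z₀)).const_add l).fderiv
    rw [jet_eq φ.contDiff_val, jet_eq hψ, hd2, hd, ← hl, ← hH]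
    have hBe : ∀ j, (B + B.flip) (0, EuclideanSpace.basisFun (Fin d) ℝ j)
        (0, EuclideanSpace.basisFun (Fin d) ℝ j) =
        H (0, EuclideanSpace.basisFun (Fin d) ℝ j)
          (0, EuclideanSpace.basisFun (Fin d) ℝ j) + 4 * δ := fun j => by
      simp only [hB, add_apply, smul_apply, ContinuousLinearMap.flip_apply, form_apply,
        smul_eq_mul, real_inner_self_eq_norm_sq, OrthonormalBasis.norm_eq_one]
      ring
    simp only [hBe, Finset.sum_add_distrib, Finset.sum_const, Finset.card_univ, Fintype.card_fin,
      nsmul_eq_mul, sub_self, map_zero, add_zero, Prod.mk_add_mk]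
    congr 2
    ring

/-- The quadratic test functions used at a local maximum. -/
lemma exists_test {ψ : ℝ × Euc d → ℝ} (hψ : ContDiff ℝ 2 ψ) (z₀ : ℝ × Euc d) (s₀ : ℝ)
    {U : Set (Problem.Arg d)} (hU : U ∈ 𝓝 (Problem.jet ψ z₀ s₀))
    {W : Set (ℝ × Euc d)} (hW : W ∈ 𝓝 z₀) :
    ∃ (φ : QuadTest d) (r η : ℝ), 0 < r ∧ 0 < η ∧ Metric.closedBall z₀ r ⊆ W ∧
      (∀ z, dist z z₀ < r → Problem.jet φ.val z (φ.val z) ∈ U) ∧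
      (∀ z, r / 2 ≤ dist z z₀ → dist z z₀ ≤ r → s₀ + (ψ z - ψ z₀) ≤ φ.val z - 3 * η) ∧
      ∀ᶠ z in 𝓝 z₀, φ.val z ≤ s₀ + (ψ z - ψ z₀) - 3 / 2 * η := by
  obtain ⟨δ, hδ, hδU⟩ : ∃ δ : ℝ, 0 < δ ∧
      Problem.jet ψ z₀ s₀ + (0, (4 * δ * d, (0, (0, 0)))) ∈ interior U := by
    have hc : Continuous fun δ : ℝ =>
        Problem.jet ψ z₀ s₀ + ((0, (4 * δ * d, (0, (0, 0)))) : Problem.Arg d) := by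
      fun_prop
    have h0 : ∀ᶠ δ in 𝓝 (0 : ℝ),
        Problem.jet ψ z₀ s₀ + ((0, (4 * δ * d, (0, (0, 0)))) : Problem.Arg d) ∈ interior U := by
      refine hc.continuousAt.eventually (isOpen_interior.mem_nhds ?_)
      have : ((0, (4 * (0 : ℝ) * d, (0, (0, 0)))) : Problem.Arg d) = 0 := by
        rw [mul_zero, zero_mul]; rfl
      beta_reduce
      rw [this, add_zero]
      exact mem_interior_iff_mem_nhds.2 hU
    have h1 : ∀ᶠ δ in 𝓝[>] (0 : ℝ), _ := nhdsWithin_le_nhds h0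
    obtain ⟨δ, h2, h3⟩ := (h1.and self_mem_nhdsWithin).exists
    exact ⟨δ, h3, h2⟩
  obtain ⟨φ, hφ0, hφψ, hφj⟩ := exists_touching hψ z₀ hδ
  have hval : Continuous φ.val := (φ.contDiff_val (n := 0)).continuous
  have hcont : Continuous fun p : (ℝ × Euc d) × ℝ =>
      Problem.jet φ.val p.1 (φ.val p.1 + p.2) :=
    (continuous_jet φ.contDiff_val).comp
      (continuous_fst.prodMk ((hval.comp continuous_fst).add continuous_snd))
  have hmem : ∀ᶠ p in 𝓝 (z₀, s₀), Problem.jet φ.val p.1 (φ.val p.1 + p.2) ∈ interior U := by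
    refine hcont.continuousAt.eventually (isOpen_interior.mem_nhds ?_)
    simp only [hφ0, zero_add, hφj]
    exact hδU
  rw [nhds_prod_eq] at hmem
  obtain ⟨pa, hpa, pb, hpb, hpab⟩ := eventually_prod_iff.1 hmem
  obtain ⟨r, hr, hball⟩ := Metric.nhds_basis_closedBall.mem_iff.1
    (Filter.inter_mem (Filter.inter_mem hpa hφψ) hW)
  obtain ⟨ρ, hρ, hρb⟩ := Metric.eventually_nhds_iff_ball.1 hpb
  -- The bound `ρ / 4` keeps the value, lowered by `2 * η`, within `ρ` of `s₀`. The other bound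
  -- makes the quadratic gap at least `5 * η` for distances from `r / 2` on, so `3 * η` remain after
  -- lowering.
  set η := min (ρ / 4) (δ * (r / 2) ^ 2 / 5) with hη
  have hηpos : 0 < η := by positivity
  have hη1 : η ≤ ρ / 4 := min_le_left _ _
  have hη2 : η ≤ δ * (r / 2) ^ 2 / 5 := min_le_right _ _
  refine ⟨φ.addConst (s₀ - 2 * η), r, η, hr, hηpos, fun z hz => (hball hz).2, fun z hz => ?_,
    fun z hz1 hz2 => ?_, ?_⟩
  · rw [jet_addConst, val_addConst]
    refine interior_subset (hpab (hball (Metric.mem_closedBall.2 hz.le)).1.1 (hρb _ ?_))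
    rw [Metric.mem_ball, Real.dist_eq, abs_lt]
    constructor <;> linarith
  · have h1 : ψ z - ψ z₀ + δ * ‖z - z₀‖ ^ 2 ≤ φ.val z := (hball (Metric.mem_closedBall.2 hz2)).1.2
    have h2 : (r / 2) ^ 2 ≤ ‖z - z₀‖ ^ 2 := by
      rw [← dist_eq_norm]
      exact pow_le_pow_left₀ (by positivity) hz1 2
    have h3 := mul_le_mul_of_nonneg_left h2 hδ.le
    rw [val_addConst]
    linarith
  · have hψc : Continuous ψ := hψ.continuous
    have hcc : Continuous fun z => φ.val z - (ψ z - ψ z₀) := by fun_prop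
    have h0 : φ.val z₀ - (ψ z₀ - ψ z₀) < η / 2 := by
      rw [hφ0]; linarith
    filter_upwards [hcc.continuousAt.eventually (gt_mem_nhds h0)] with z hz
    rw [val_addConst]
    linarith

end QuadTest

end HJB

namespace HJB

variable {d : ℕ} {A : Type*}

namespace Mesh.IsMonoRow

variable {T : Mesh d} {y : Euc d} {L : (Euc d → ℝ) → ℝ}

/-- A row at a node at which the minimum is attained. -/
lemma le_of_min (h : IsMonoRow T y L) (hy : y ∈ T.nodes) {w : Euc d → ℝ} (hw : w ∈ T.V)
    (hmin : ∀ z ∈ T.nodes, w y ≤ w z) : L w ≤ w y * L T.one := by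
  have h1 : T.one ∈ T.V := one_mem_V
  have huV : w y • T.one - w ∈ T.V := T.V.sub_mem (T.V.smul_mem _ h1) hw
  have hval : ∀ z ∈ T.nodes, (w y • T.one - w) z = w y - w z := fun z hz => by
    simp [one_apply (nodes_subset_carrier hz)]
  have h2 := h.le hy huV le_rfl fun z hz => by
    rw [hval z hz.mem_nodes]; linarith [hmin z hz.mem_nodes]
  rw [hval y hy, sub_self, sub_self, zero_mul, h.sub (T.V.smul_mem _ h1) hw, h.smul _ _ h1] at h2
  linarith

end Mesh.IsMonoRow

/-! ## Compactness -/

/-- A property of the space-time nodes that holds locally for large levels holds on compact sets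
for large levels. -/
lemma eventually_of_locally {P : Problem d A} {D : ℕ → Level d A} {S : Set (ℝ × Euc d)} (hS : IsCompact S)
    {p : ℕ → ℕ → Euc d → Prop} (hp : ∀ z ∈ S, ∃ W ∈ 𝓝 z, ∀ᶠ i in atTop, ∀ k ≤ (D i).M,
      ∀ y ∈ (D i).mesh.nodes, ((D i).time P k, y) ∈ W → p i k y) :
    ∀ᶠ i in atTop, ∀ k ≤ (D i).M, ∀ y ∈ (D i).mesh.nodes, ((D i).time P k, y) ∈ S → p i k y := by
  refine hS.induction_on (p := fun S => ∀ᶠ i in atTop, ∀ k ≤ (D i).M, ∀ y ∈ (D i).mesh.nodes,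
    ((D i).time P k, y) ∈ S → p i k y) ?_ ?_ ?_ ?_
  · simp
  · exact fun s t hst ht => ht.mono fun i hi k hk y hy hz => hi k hk y hy (hst hz)
  · intro s t hs ht
    filter_upwards [hs, ht] with i h1 h2 k hk y hy hz
    exact hz.elim (h1 k hk y hy) (h2 k hk y hy)
  · intro z hz
    obtain ⟨W, hW, h⟩ := hp z hz
    exact ⟨W, mem_nhdsWithin_of_mem_nhds hW, h⟩

/-! ## Bounds of the numerical solutions -/

section

variable [MetricSpace A] {P : Problem d A} {D : ℕ → Level d A} {v : ℕ → ℕ → Euc d → ℝ}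

namespace Admissible

/-- Positivity for each control becomes uniform by compactness; otherwise a supremum of strictly
negative terms could still be zero. -/
lemma exists_pos_le_cBI [CompactSpace A] [Nonempty A] (h : Admissible P D) (i : ℕ) {y : Euc d}
    (hy : y ∈ P.bdR) : ∃ c : ℝ, 0 < c ∧ ∀ α, c ≤ (D i).cBI α y := by
  have hyf : y ∈ frontier P.Ω := by
    rw [← h.standing.bd_union]; exact Or.inl (Or.inr hy)
  have hc : Continuous fun α => (D i).cBI α y := continuous_iff_continuousAt.2 fun α₀ =>
    ((h.reg i).cBI_dep α₀).tendsto_at hyf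
  obtain ⟨α₀, -, hα₀⟩ := isCompact_univ.exists_isMinOn univ_nonempty hc.continuousOn
  exact ⟨_, (h.sign i).cBI_R α₀ y hy, fun α => hα₀ (mem_univ α)⟩

/-- The numerical solutions are nonnegative. -/
theorem solution_nonneg [CompactSpace A] [Nonempty A] (h : Admissible P D)
    (hv : ∀ i, (D i).IsNumericalSolution P (v i)) (i : ℕ) {k : ℕ} (hk : k ≤ (D i).M) {y : Euc d}
    (hy : y ∈ (D i).mesh.nodes) : 0 ≤ v i k y := by
  revert y
  refine Nat.decreasingInduction' (P := fun k => ∀ {y : Euc d}, y ∈ (D i).mesh.nodes → 0 ≤ v i k y)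
    (fun k hkM _ ih y' hy' => ?_) hk fun {y} hy => ?_
  · by_contra! hneg
    -- At a negative minimum over all nodes the implicit rows are nonpositive, while the next time
    -- level is nonnegative by the induction hypothesis.
    obtain ⟨y, hy, hmin⟩ := exists_min_image _ (v i k) (D i).mesh.finite_nodes ⟨y', hy'⟩
    have hlt : v i k y < 0 := (hmin y' hy').trans_lt hneg
    have hyΩ := h.node_mem hy
    have hV := (hv i).mem k hkM.le
    have hV' := (hv i).mem (k + 1) hkM
    have hsch := (hv i).scheme k hkM y hy
    have hI : ∀ α, (D i).opI P α (v i k) y ≤ v i k y * (D i).opI P α (D i).mesh.one y := fun α =>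
      (h.isMonoRow_opI i α hy).le_of_min hy hV hmin
    have hone : ∀ α, 0 ≤ (D i).opI P α (D i).mesh.one y := fun α =>
      (h.isMonoRow_opI i α hy).one_nonneg
    by_cases hT : y ∈ interior P.Ω ∪ P.bdT
    · have hpos := h.h_pos i
      -- The maximum principle for minus the later solution, with the time step restriction, bounds
      -- each explicit row by `v (k+1) y / h`. The scheme would require the larger value `(v (k+1) y
      -- - v k y) / h`.
      have hsup : ⨆ α, ((D i).opE P α (v i (k + 1)) y + (D i).opI P α (v i k) y -
          (D i).rhs P α y) ≤ v i (k + 1) y / (D i).h P := by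
        refine ciSup_le fun α => ?_
        have hE := (h.isMonoRow_opE i α hy).le hy ((D i).mesh.V.neg_mem hV') le_rfl fun z hz => by
          rw [Pi.neg_apply]; linarith [ih hz.mem_nodes]
        rw [(h.isMonoRow_opE i α hy).neg hV', Pi.neg_apply] at hE
        have ht := (h.mono i).timestep α y hy hT
        have h2 : (D i).opE P α ((D i).mesh.hat y) y ≤ 1 / (D i).h P := by
          rw [le_div_iff₀ hpos]; linarith
        have h3 := mul_le_mul_of_nonneg_left h2 (ih hy)
        rw [mul_one_div] at h3
        have h4 := mul_nonpos_of_nonpos_of_nonneg hlt.le (hone α)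
        linarith [hI α, h.rhs_nonneg i α hy]
      rw [Level.dt, if_pos hT, sub_div] at hsch
      have := div_neg_of_neg_of_pos hlt hpos
      linarith
    · rw [Level.dt, if_neg hT] at hsch
      have hi : y ∉ interior P.Ω := fun hi => hT (Or.inl hi)
      by_cases hD : y ∈ P.bdD
      · rw [(hv i).dirichlet k hkM.le y hy hD] at hlt
        exact absurd (h.standing.g_nonneg y (mem_frontier hyΩ hi)) (not_le.2 hlt)
      · have hR : y ∈ P.bdR := (h.mem_bd hyΩ hi hD).resolve_left fun hT' => hT (Or.inr hT')
        obtain ⟨c, hc, hcα⟩ := h.exists_pos_le_cBI i hR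
        -- Without a time derivative the scheme requires the supremum to vanish, but the
        -- zeroth-order coefficient pushes it strictly below zero.
        have hsup : ⨆ α, ((D i).opE P α (v i (k + 1)) y + (D i).opI P α (v i k) y -
            (D i).rhs P α y) ≤ v i k y * c := by
          refine ciSup_le fun α => ?_
          have h1 : (D i).opI P α (D i).mesh.one y = (D i).cBI α y := by
            rw [Level.opI, if_neg hi, if_neg hD, Mesh.bdRow_one hy]
            rw [h.mesh.carrier_eq i]
            exact (h.sign i).bBI_cone α y hy (Or.inr hR)
          have h2 := mul_le_mul_of_nonpos_left (hcα α) hlt.le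
          have h3 := hI α
          rw [h1] at h3
          linarith [h.opE_eq_zero i α (v i (k + 1)) hT hyΩ, h.rhs_nonneg i α hy]
        have := mul_neg_of_neg_of_pos hlt hc
        linarith
  · rw [(hv i).final y hy]
    exact h.standing.vT_nonneg y (h.node_mem hy)

lemma isCompact_Q (h : Admissible P D) : IsCompact P.Q := isCompact_Icc.prod h.isCompact_Ω

/-- Both arguments sit at the same space-time point, so bounded coefficients suffice and the jumps
of the operator across the boundary do no harm. The summand `1` accounts for the time derivative and
for the bare value in the Dirichlet and final conditions. -/
lemma exists_FlinArg_sub_le (h : Admissible P D) (α : A) : ∃ C : ℝ, 0 < C ∧ ∀ z ∈ P.Q,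
    ∀ j j' : ℝ × Euc d × ℝ × ℝ, P.FlinArg α (z, j) - P.FlinArg α (z, j') ≤ C * ‖j - j'‖ := by
  have hΩ := h.isCompact_Ω
  have hs := h.standing
  obtain ⟨Ca, ha⟩ := hΩ.exists_bound_of_continuousOn (hs.a_cont α)
  obtain ⟨Cb, hb⟩ := hΩ.exists_bound_of_continuousOn (hs.b_cont α)
  obtain ⟨Cc, hc⟩ := hΩ.exists_bound_of_continuousOn (hs.c_cont α)
  obtain ⟨Cb', hb'⟩ := (hs.bB_pc α).1
  obtain ⟨Cc', hc'⟩ := (hs.cB_pc α).1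
  refine ⟨1 + |Ca| + |Cb| + |Cc| + |Cb'| + |Cc'|, by positivity, ?_⟩
  rintro ⟨t, x⟩ ⟨-, hx⟩ ⟨q, p, r, s⟩ ⟨q', p', r', s'⟩
  change x ∈ P.Ω at hx
  have hN : 0 ≤ ‖((q, p, r, s) : ℝ × Euc d × ℝ × ℝ) - (q', p', r', s')‖ := norm_nonneg _
  set N := ‖((q, p, r, s) : ℝ × Euc d × ℝ × ℝ) - (q', p', r', s')‖ with hNd
  simp only [Prod.mk_sub_mk, Prod.norm_mk] at hNd
  have hq : |q - q'| ≤ N := by rw [hNd]; exact le_max_left _ _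
  have hp : ‖p - p'‖ ≤ N := by rw [hNd]; exact (le_max_left _ _).trans (le_max_right _ _)
  have hr : |r - r'| ≤ N := by
    rw [hNd]; exact ((le_max_left _ _).trans (le_max_right _ _)).trans (le_max_right _ _)
  have hs : |s - s'| ≤ N := by
    rw [hNd]; exact ((le_max_right _ _).trans (le_max_right _ _)).trans (le_max_right _ _)
  have hmul : ∀ {u C e : ℝ}, |u| ≤ C → |e| ≤ N → |u * e| ≤ |C| * N := fun {u C e} hu he => by
    rw [abs_mul]
    exact mul_le_mul (hu.trans (le_abs_self C)) he (abs_nonneg _) (abs_nonneg _)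
  have hinn : ∀ {u : Euc d} {C : ℝ}, ‖u‖ ≤ C → |inner ℝ u (p - p')| ≤ |C| * N := fun hu =>
    (abs_real_inner_le_norm _ _).trans
      (mul_le_mul (hu.trans (le_abs_self _)) hp (norm_nonneg _) (abs_nonneg _))
  have n1 := mul_nonneg (abs_nonneg Ca) hN
  have n2 := mul_nonneg (abs_nonneg Cb) hN
  have n3 := mul_nonneg (abs_nonneg Cc) hN
  have n4 := mul_nonneg (abs_nonneg Cb') hN
  have n5 := mul_nonneg (abs_nonneg Cc') hN
  have e1 := abs_le.1 (hmul (ha x hx) hq)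
  have e2 := abs_le.1 (hinn (hb x hx))
  have e3 := abs_le.1 (hmul (hc x hx) hs)
  rw [inner_sub_right] at e2
  have er := abs_le.1 hr
  have es := abs_le.1 hs
  simp only [Problem.FlinArg, Problem.Flin, Problem.L, Problem.LB]
  by_cases hi : x ∈ interior P.Ω
  · simp only [if_pos hi]
    split_ifs <;> linarith
  · have hxf := mem_frontier hx hi
    have e4 := abs_le.1 (hinn (hb' x hxf))
    have e5 := abs_le.1 (hmul (hc' x hxf) hs)
    rw [inner_sub_right] at e4
    simp only [if_neg hi]
    split_ifs <;> linarith

/-- The numerical solutions lie eventually below a strict supersolution. -/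
theorem eventually_lt_supersolution [CompactSpace A] (h : Admissible P D)
    (hproj : HasEllipticProjections P D) (hv : ∀ i, (D i).IsNumericalSolution P (v i)) {α : A}
    {w : ℝ × Euc d → ℝ} (hw : ContDiff ℝ 2 w) {ε : ℝ} (hε : 0 < ε)
    (hsup : ∀ z ∈ P.Q, ε ≤ P.FlinArg α (Problem.jet w z (w z))) :
    ∀ᶠ i in atTop, ∀ k ≤ (D i).M, ∀ y ∈ (D i).mesh.nodes, v i k y < w ((D i).time P k, y) := by
  -- It is shown that no node with a nonnegative difference can be a global maximum; the statement
  -- is local, so compactness of `P.Q` makes it uniform in the node.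
  have key : ∀ᶠ i in atTop, ∀ k ≤ (D i).M, ∀ y ∈ (D i).mesh.nodes, ((D i).time P k, y) ∈ P.Q →
      0 ≤ v i k y - w ((D i).time P k, y) →
      ¬ ∀ k' ≤ (D i).M, ∀ y' ∈ (D i).mesh.nodes,
        v i k' y' - w ((D i).time P k', y') ≤ v i k y - w ((D i).time P k, y) := by
    refine eventually_of_locally h.isCompact_Q fun z₀ hz₀ => ?_
    obtain ⟨C, hC, hlip⟩ := h.exists_FlinArg_sub_le α
    -- Both jets lie within `δ` of the jet of `w` at `z₀`, so the operators differ by at most `C *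
    -- (2 * δ) = ε / 2`. Being at most `ε / 4` on the quadratic then contradicts being at least `ε`
    -- on `w`.
    set δ := ε / (4 * C) with hδ
    have hδ0 : 0 < δ := by positivity
    have hjc : Continuous fun z => Problem.jet w z (w z) :=
      (continuous_jet hw).comp (continuous_id.prodMk hw.continuous)
    obtain ⟨φ, r, η, hr, hη, hW, hU, hann, hnear⟩ := QuadTest.exists_test hw z₀ (w z₀)
      (Metric.ball_mem_nhds _ hδ0) (hjc.continuousAt.preimage_mem_nhds (Metric.ball_mem_nhds _ hδ0))
    refine ⟨_, Filter.inter_mem hnear (Metric.ball_mem_nhds z₀ (half_pos hr)), ?_⟩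
    filter_upwards [h.eventually_local_max hproj hv φ z₀ hr hη (ε := ε / 4) (by positivity)]
      with i hi k hk y hy hz h0 hmax
    have h1 : φ.val ((D i).time P k, y) ≤ w z₀ + (w ((D i).time P k, y) - w z₀) - 3 / 2 * η := hz.1
    obtain ⟨z, hzQ, hzd, hzF⟩ := hi k hk y hy hz.2 (by linarith) fun k' hk' y' hy' hd1 hd2 => by
      have h2 := hann _ hd1 hd2.le
      have h3 := hmax k' hk' y' hy'
      linarith
    have hzr : dist z z₀ < r := hzd.trans (by linarith)
    have h2 : Problem.jet φ.val z (φ.val z) ∈ Metric.ball (Problem.jet w z₀ (w z₀)) δ := hU z hzr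
    have h3 : Problem.jet w z (w z) ∈ Metric.ball (Problem.jet w z₀ (w z₀)) δ :=
      hW (Metric.mem_closedBall.2 hzr.le)
    have h4 : ‖(Problem.jet w z (w z)).2 - (Problem.jet φ.val z (φ.val z)).2‖ ≤ 2 * δ := by
      rw [← dist_eq_norm]
      have h5 := dist_triangle_right (Problem.jet w z (w z)) (Problem.jet φ.val z (φ.val z))
        (Problem.jet w z₀ (w z₀))
      rw [Metric.mem_ball] at h2 h3
      exact (le_max_right _ _).trans (h5.trans (by linarith))
    have h5 := hlip z hzQ (Problem.jet w z (w z)).2 (Problem.jet φ.val z (φ.val z)).2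
    have h6 := hsup z hzQ
    have h7 := hzF α
    have h8 : C * (2 * δ) = ε / 2 := by rw [hδ]; field_simp; norm_num
    have h9 := mul_le_mul_of_nonneg_left h4 hC.le
    have h10 : P.FlinArg α (Problem.jet w z (w z)) - P.FlinArg α (Problem.jet φ.val z (φ.val z)) ≤
      C * ‖(Problem.jet w z (w z)).2 - (Problem.jet φ.val z (φ.val z)).2‖ := h5
    linarith
  filter_upwards [key] with i hi k hk y hy
  by_contra! hle
  have hfin : {q : ℕ × Euc d | q.1 ≤ (D i).M ∧ q.2 ∈ (D i).mesh.nodes}.Finite :=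
    ((finite_Iic (D i).M).prod (D i).mesh.finite_nodes).subset fun q hq => hq
  obtain ⟨⟨k', y'⟩, ⟨hk', hy'⟩, hmax⟩ := exists_max_image _
    (fun q : ℕ × Euc d => v i q.1 q.2 - w ((D i).time P q.1, q.2)) hfin ⟨(k, y), hk, hy⟩
  have h1 := hmax (k, y) ⟨hk, hy⟩
  exact hi k' hk' y' hy' (h.node_mem_Q hk' hy') (by simp only at h1; linarith)
    fun k'' hk'' y'' hy'' => hmax (k'', y'') ⟨hk'', hy''⟩

end Admissible

end

end HJB

namespace HJB

variable {d : ℕ} {A : Type*} {P : Problem d A} {D : ℕ → Level d A}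

/-! ## The filter of space-time nodes -/

lemma eventually_nodeFilter_iff {z : ℝ × Euc d} {p : ℕ × ℕ × Euc d → Prop} :
    (∀ᶠ q in nodeFilter P D z, p q) ↔ ∃ W ∈ 𝓝 z, ∀ᶠ i in atTop, ∀ k ≤ (D i).M,
      ∀ y ∈ (D i).mesh.nodes, ((D i).time P k, y) ∈ W → p (i, k, y) := by
  rw [nodeFilter, eventually_inf_principal]
  constructor
  · intro hp
    obtain ⟨s, ⟨I, hI, hIs⟩, t, ⟨W, hW, hWt⟩, hst⟩ := mem_inf_iff.1 hp
    refine ⟨W, hW, ?_⟩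
    filter_upwards [hI] with i hi k hk y hy hz
    have : (i, k, y) ∈ s ∩ t := ⟨hIs hi, hWt hz⟩
    rw [← hst] at this
    exact this ⟨hk, hy⟩
  · rintro ⟨W, hW, h⟩
    filter_upwards [Filter.inter_mem (mem_inf_of_left (preimage_mem_comap h))
      (mem_inf_of_right (preimage_mem_comap hW))] with q hq hq'
    exact hq.1 _ hq'.1 _ hq'.2 hq.2

lemma frequently_nodes {z : ℝ × Euc d} {p : ℕ × ℕ × Euc d → Prop}
    (hp : ∃ᶠ q in nodeFilter P D z, p q) {W : Set (ℝ × Euc d)} (hW : W ∈ 𝓝 z) :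
    ∃ᶠ i in atTop, ∃ k ≤ (D i).M, ∃ y ∈ (D i).mesh.nodes,
      ((D i).time P k, y) ∈ W ∧ p (i, k, y) := by
  by_contra hcon
  rw [not_frequently] at hcon
  refine hp (eventually_nodeFilter_iff.2 ⟨W, hW, hcon.mono fun i hi k hk y hy hz hq => ?_⟩)
  exact hi ⟨k, hk, y, hy, hz, hq⟩

section Standing

variable [MetricSpace A]

/-- Rounding the time down to the grid and taking any vertex of an element containing the point
approximates every point of `P.Q`; without this the envelopes could be trivially infinite. -/
lemma Admissible.neBot_nodeFilter (h : Admissible P D) {z : ℝ × Euc d} (hz : z ∈ P.Q) :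
    (nodeFilter P D z).NeBot := by
  rw [← frequently_true_iff_neBot]
  intro hcon
  obtain ⟨W, hW, hev⟩ := eventually_nodeFilter_iff.1 hcon
  obtain ⟨ρ, hρ, hball⟩ := Metric.mem_nhds_iff.1 hW
  obtain ⟨i, hi, hh, hs⟩ := (hev.and ((h.h_lt hρ).and (h.meshSize_lt hρ))).exists
  obtain ⟨t, x⟩ := z
  obtain ⟨⟨ht0, htT⟩, hx⟩ := hz
  change 0 ≤ t at ht0
  change t ≤ P.T at htT
  change x ∈ P.Ω at hx
  rw [← h.mesh.carrier_eq i] at hx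
  obtain ⟨K, hK, hx⟩ := Mesh.mem_carrier_iff.1 hx
  obtain ⟨y, hy⟩ : K.Nonempty := Finset.card_pos.1 (by rw [(D i).mesh.card_eq K hK]; omega)
  have hpos := h.h_pos i
  have h1 : (⌊t / (D i).h P⌋₊ : ℝ) * (D i).h P ≤ t :=
    (le_div_iff₀ hpos).1 (Nat.floor_le (div_nonneg ht0 hpos.le))
  have h2 : t < (⌊t / (D i).h P⌋₊ + 1 : ℝ) * (D i).h P := (div_lt_iff₀ hpos).1 (Nat.lt_floor_add_one _)
  have hM : ⌊t / (D i).h P⌋₊ ≤ (D i).M := by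
    refine Nat.floor_le_of_le ((div_le_iff₀ hpos).2 ?_)
    have := h.time_M i
    rw [Level.time] at this
    rwa [this]
  refine hi ⌊t / (D i).h P⌋₊ hM y ⟨K, hK, hy⟩ (hball ?_) trivial
  rw [Metric.mem_ball, Prod.dist_eq]
  refine max_lt ?_ ((Mesh.dist_le_meshSize hK (Mesh.mem_hull_of_mem hy) hx).trans_lt hs)
  rw [Real.dist_eq, Level.time, abs_lt]
  constructor <;> linarith

end Standing

/-! ## Envelopes of grid functions -/

/-- A uniform bound of a grid function on all fine levels. -/
def EventuallyBounded (D : ℕ → Level d A) (u : ℕ → ℕ → Euc d → ℝ) (C : ℝ) : Prop :=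
  ∀ᶠ i in atTop, ∀ k ≤ (D i).M, ∀ y ∈ (D i).mesh.nodes, |u i k y| ≤ C

variable {u : ℕ → ℕ → Euc d → ℝ} {C : ℝ} {z z₀ : ℝ × Euc d}

lemma EventuallyBounded.neg (hu : EventuallyBounded D u C) :
    EventuallyBounded D (fun i k y => -u i k y) C := by
  filter_upwards [hu] with i hi k hk y hy
  rw [abs_neg]
  exact hi k hk y hy

lemma upperEnvelope_neg (P : Problem d A) (D : ℕ → Level d A) (u : ℕ → ℕ → Euc d → ℝ)
    (z : ℝ × Euc d) :
    upperEnvelope P D (fun i k y => -u i k y) z = -lowerEnvelope P D u z := by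
  rw [upperEnvelope, lowerEnvelope, ← EReal.limsup_neg]
  rfl

namespace EventuallyBounded

lemma eventually_le (hu : EventuallyBounded D u C) (P : Problem d A) (z : ℝ × Euc d) :
    ∀ᶠ q in nodeFilter P D z, |u q.1 q.2.1 q.2.2| ≤ C :=
  eventually_nodeFilter_iff.2 ⟨univ, univ_mem, hu.mono fun _ hi k hk y hy _ => hi k hk y hy⟩

lemma upperEnvelope_le (hu : EventuallyBounded D u C) : upperEnvelope P D u z ≤ C :=
  limsup_le_of_le (h := (hu.eventually_le P z).mono fun _ hq =>
    EReal.coe_le_coe_iff.2 (abs_le.1 hq).2)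

lemma le_upperEnvelope [MetricSpace A] (hu : EventuallyBounded D u C) (h : Admissible P D)
    (hz : z ∈ P.Q) : ((-C : ℝ) : EReal) ≤ upperEnvelope P D u z := by
  have := h.neBot_nodeFilter hz
  exact le_limsup_of_frequently_le' ((hu.eventually_le P z).mono fun _ hq =>
    EReal.coe_le_coe_iff.2 (abs_le.1 hq).1).frequently

lemma upperEnvelope_ne_top (hu : EventuallyBounded D u C) : upperEnvelope P D u z ≠ ⊤ :=
  (hu.upperEnvelope_le.trans_lt (EReal.coe_lt_top C)).ne

lemma upperEnvelope_ne_bot [MetricSpace A] (hu : EventuallyBounded D u C) (h : Admissible P D)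
    (hz : z ∈ P.Q) : upperEnvelope P D u z ≠ ⊥ :=
  ((EReal.bot_lt_coe (-C)).trans_le (hu.le_upperEnvelope h hz)).ne'

lemma coe_upperEnvelope [MetricSpace A] (hu : EventuallyBounded D u C) (h : Admissible P D)
    (hz : z ∈ P.Q) : ((upperEnvelope P D u z).toReal : EReal) = upperEnvelope P D u z :=
  EReal.coe_toReal hu.upperEnvelope_ne_top (hu.upperEnvelope_ne_bot h hz)

lemma abs_upperEnvelope_le [MetricSpace A] (hu : EventuallyBounded D u C) (h : Admissible P D)
    (hz : z ∈ P.Q) : |(upperEnvelope P D u z).toReal| ≤ C := by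
  rw [abs_le, ← EReal.coe_le_coe_iff, ← EReal.coe_le_coe_iff, hu.coe_upperEnvelope h hz]
  exact ⟨hu.le_upperEnvelope h hz, hu.upperEnvelope_le⟩

variable [MetricSpace A]

lemma exists_nhds_lt (hu : EventuallyBounded D u C) (h : Admissible P D) (hz : z ∈ P.Q) {c : ℝ}
    (hc : (upperEnvelope P D u z).toReal < c) : ∃ W ∈ 𝓝 z, ∀ᶠ i in atTop, ∀ k ≤ (D i).M,
      ∀ y ∈ (D i).mesh.nodes, ((D i).time P k, y) ∈ W → u i k y < c := by
  rw [← EReal.coe_lt_coe_iff, hu.coe_upperEnvelope h hz] at hc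
  exact eventually_nodeFilter_iff.1 ((eventually_lt_of_limsup_lt hc).mono fun _ hq =>
    EReal.coe_lt_coe_iff.1 hq)

lemma eventually_upperEnvelope_le (hu : EventuallyBounded D u C) (h : Admissible P D)
    (hz : z ∈ P.Q) {c : ℝ} (hc : (upperEnvelope P D u z).toReal < c) :
    ∀ᶠ z' in 𝓝 z, upperEnvelope P D u z' ≤ c := by
  obtain ⟨W, hW, hev⟩ := hu.exists_nhds_lt h hz hc
  filter_upwards [eventually_mem_nhds_iff.2 hW] with z' hz'
  exact limsup_le_of_le (h := eventually_nodeFilter_iff.2 ⟨W, hz', hev.mono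
    fun i hi k hk y hy hz => EReal.coe_le_coe_iff.2 (hi k hk y hy hz).le⟩)

/-- The upper envelope is upper semicontinuous. -/
lemma uscEnv_upperEnvelope (hu : EventuallyBounded D u C) (h : Admissible P D) (hz : z ∈ P.Q) :
    uscEnv P.Q (fun z => (upperEnvelope P D u z).toReal) z = (upperEnvelope P D u z).toReal := by
  refine le_antisymm (EReal.le_of_forall_lt_iff_le.1 fun c hc => ?_) ?_
  · rw [EReal.coe_lt_coe_iff] at hc
    refine limsup_le_of_le (h := ?_)
    filter_upwards [nhdsWithin_le_nhds (hu.eventually_upperEnvelope_le h hz hc),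
      self_mem_nhdsWithin] with z' h1 h2
    rwa [hu.coe_upperEnvelope h h2]
  -- The neighbourhood filter is not punctured, so the envelope dominates the value at the point
  -- itself.
  · refine le_limsup_of_frequently_le' (Frequently.filter_mono ?_ (pure_le_nhdsWithin hz))
    exact frequently_pure.2 le_rfl

/-- A strict pointwise bound of the envelope holds for grid values in a neighbourhood of each point;
compactness makes the level uniform. -/
lemma eventually_lt_on_compact (hu : EventuallyBounded D u C) (h : Admissible P D)
    {S : Set (ℝ × Euc d)} (hS : IsCompact S) (hSQ : S ⊆ P.Q) {θ : ℝ × Euc d → ℝ}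
    (hθ : Continuous θ) (hlt : ∀ z ∈ S, (upperEnvelope P D u z).toReal < θ z) :
    ∀ᶠ i in atTop, ∀ k ≤ (D i).M, ∀ y ∈ (D i).mesh.nodes, ((D i).time P k, y) ∈ S →
      u i k y < θ ((D i).time P k, y) := by
  refine eventually_of_locally hS fun z hz => ?_
  obtain ⟨c, hc1, hc2⟩ := exists_between (hlt z hz)
  obtain ⟨W, hW, hev⟩ := hu.exists_nhds_lt h (hSQ hz) hc1
  refine ⟨_, Filter.inter_mem hW (hθ.continuousAt.eventually (lt_mem_nhds hc2)), ?_⟩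
  exact hev.mono fun i hi k hk y hy hz => (hi k hk y hy hz.1).trans hz.2

/-- At a local maximum of the upper envelope minus a test function, the grid functions minus a
nearby quadratic test function have strict local maxima. -/
theorem exists_test (hu : EventuallyBounded D u C) (h : Admissible P D) {ψ : ℝ × Euc d → ℝ}
    (hψ : ContDiff ℝ 2 ψ) (hz₀ : z₀ ∈ P.Q)
    (hmax : IsLocalMaxOn (fun z => (upperEnvelope P D u z).toReal - ψ z) P.Q z₀)
    {U : Set (Problem.Arg d)}
    (hU : U ∈ 𝓝 (Problem.jet ψ z₀ (upperEnvelope P D u z₀).toReal)) :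
    ∃ (φ : QuadTest d) (r η : ℝ), 0 < r ∧ 0 < η ∧
      (∀ z, dist z z₀ < r → Problem.jet φ.val z (φ.val z) ∈ U) ∧
      ∃ᶠ i in atTop, ∃ k₀ ≤ (D i).M, ∃ y₀ ∈ (D i).mesh.nodes,
        dist ((D i).time P k₀, y₀) z₀ < r / 2 ∧ η ≤ u i k₀ y₀ - φ.val ((D i).time P k₀, y₀) ∧
        ∀ k ≤ (D i).M, ∀ y ∈ (D i).mesh.nodes, r / 2 ≤ dist ((D i).time P k, y) z₀ →
          dist ((D i).time P k, y) z₀ < r → u i k y - φ.val ((D i).time P k, y) ≤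
            u i k₀ y₀ - φ.val ((D i).time P k₀, y₀) - η := by
  set Us : ℝ × Euc d → ℝ := fun z => (upperEnvelope P D u z).toReal with hUs
  have hW : {z | z ∈ P.Q → Us z - ψ z ≤ Us z₀ - ψ z₀} ∈ 𝓝 z₀ :=
    eventually_nhdsWithin_iff.1 hmax
  obtain ⟨φ, r, η, hr, hη, hrW, hφU, hann, hnear⟩ := QuadTest.exists_test hψ z₀ (Us z₀) hU hW
  refine ⟨φ, r, η, hr, hη, hφU, ?_⟩
  have hφc : Continuous φ.val := (φ.contDiff_val (n := 0)).continuous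
  have hS : IsCompact (P.Q ∩ (Metric.closedBall z₀ r ∩ {z | r / 2 ≤ dist z z₀})) :=
    h.isCompact_Q.inter_right (Metric.isClosed_closedBall.inter
      (isClosed_le continuous_const (continuous_id.dist continuous_const)))
  -- On the annulus the envelope is at most `φ - 3 * η`; giving up one `η` yields the strict
  -- inequality that passes to the grid functions.
  have hev := hu.eventually_lt_on_compact h hS inter_subset_left
    (θ := fun z => φ.val z - 2 * η) (by fun_prop) fun z hz => by
      have h1 := hann z hz.2.2 hz.2.1
      have h2 := hrW hz.2.1 hz.1
      change Us z < φ.val z - 2 * η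
      linarith
  -- Losing `η / 4` on the grid value and `η / 4` on the variation of `ψ` leaves exactly `η` of the
  -- margin `3 / 2 * η` by which the test function was lowered.
  have hfreq : ∃ᶠ q in nodeFilter P D z₀, Us z₀ - η / 4 < u q.1 q.2.1 q.2.2 := by
    have h1 : ((Us z₀ - η / 4 : ℝ) : EReal) < upperEnvelope P D u z₀ := by
      rw [← hu.coe_upperEnvelope h hz₀, EReal.coe_lt_coe_iff]
      change Us z₀ - η / 4 < Us z₀
      linarith
    exact (frequently_lt_of_lt_limsup (h := h1)).mono fun _ hq => EReal.coe_lt_coe_iff.1 hq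
  have hψ' : ∀ᶠ z in 𝓝 z₀, ψ z < ψ z₀ + η / 4 :=
    hψ.continuous.continuousAt.eventually (gt_mem_nhds (by linarith))
  refine ((frequently_nodes hfreq (Filter.inter_mem (Filter.inter_mem hnear hψ')
    (Metric.ball_mem_nhds z₀ (half_pos hr)))).and_eventually hev).mono ?_
  rintro i ⟨⟨k₀, hk₀, y₀, hy₀, ⟨⟨h1, h2⟩, h3⟩, h4⟩, hi⟩
  have h1 : φ.val ((D i).time P k₀, y₀) ≤ Us z₀ + (ψ ((D i).time P k₀, y₀) - ψ z₀) - 3 / 2 * η := h1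
  have h2 : ψ ((D i).time P k₀, y₀) < ψ z₀ + η / 4 := h2
  have h4 : Us z₀ - η / 4 < u i k₀ y₀ := h4
  refine ⟨k₀, hk₀, y₀, hy₀, h3, by linarith, fun k hk y hy hd1 hd2 => ?_⟩
  have h5 := hi k hk y hy ⟨h.node_mem_Q hk hy, hd2.le, hd1⟩
  linarith

end EventuallyBounded

/-! ## The operator and its linear parts -/

lemma Problem.Farg_le [Nonempty A] {ε : ℝ} {z : Problem.Arg d} (h : ∀ α, P.FlinArg α z ≤ ε) :
    P.Farg z ≤ ε := by
  have h0 := h (Classical.arbitrary A)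
  have hsup : ∀ {X : A → ℝ} {r : ℝ}, (∀ α, -r + X α ≤ ε) → -r + ⨆ α, X α ≤ ε := fun {X r} hX => by
    have : ⨆ α, X α ≤ ε + r := ciSup_le fun α => by linarith [hX α]
    linarith
  simp only [Problem.FlinArg, Problem.Flin] at h h0
  simp only [Problem.Farg, Problem.F]
  split_ifs at * with h1 h2 h3 h4
  · exact h0
  · exact hsup h
  · exact hsup h
  · exact ciSup_le h
  · exact h0

/-- The supremum dominates each control only once the family is known to be bounded above, which
follows from compactness of the control set. -/
lemma Admissible.FlinArg_le_Farg [MetricSpace A] [CompactSpace A] (h : Admissible P D) (α : A)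
    {z : Problem.Arg d} (hz : z ∈ P.argSet) : P.FlinArg α z ≤ P.Farg z := by
  obtain ⟨⟨t, x⟩, q, p, r, s⟩ := z
  have hx : x ∈ P.Ω := hz.2
  have hΩ := h.isCompact_Ω
  have hst := h.standing
  have hmul : ∀ {u C : ℝ} (e : ℝ), ‖u‖ ≤ C → |u * e| ≤ C * |e| := fun e hu => by
    rw [abs_mul]; exact mul_le_mul_of_nonneg_right hu (abs_nonneg _)
  have hinn : ∀ {b : Euc d} {C : ℝ}, ‖b‖ ≤ C → |inner ℝ b p| ≤ C * ‖p‖ := fun hb =>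
    (abs_real_inner_le_norm _ _).trans (mul_le_mul_of_nonneg_right hb (norm_nonneg _))
  simp only [Problem.FlinArg, Problem.Flin, Problem.Farg, Problem.F]
  by_cases hT : t = P.T
  · simp only [if_pos hT]; exact le_rfl
  by_cases hi : x ∈ interior P.Ω
  · simp only [if_neg hT, if_pos hi]
    obtain ⟨Ca, ha⟩ := exists_bound_family
      (fun α => hΩ.exists_bound_of_continuousOn (hst.a_cont α)) hst.a_dep
    obtain ⟨Cb, hb⟩ := exists_bound_family
      (fun α => hΩ.exists_bound_of_continuousOn (hst.b_cont α)) hst.b_dep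
    obtain ⟨Cc, hc⟩ := exists_bound_family
      (fun α => hΩ.exists_bound_of_continuousOn (hst.c_cont α)) hst.c_dep
    obtain ⟨Cf, hf⟩ := exists_bound_family
      (fun α => hΩ.exists_bound_of_continuousOn (hst.f_cont α)) hst.f_dep
    refine add_le_add_right (le_ciSup (f := fun α => P.L α x q p s - P.f α x)
      ⟨Ca * |q| + Cb * ‖p‖ + Cc * |s| + Cf, ?_⟩ α) _
    rintro _ ⟨β, rfl⟩
    have e1 := abs_le.1 (hmul q (ha β x hx))
    have e2 := abs_le.1 (hinn (hb β x hx))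
    have e3 := abs_le.1 (hmul s (hc β x hx))
    have e4 := abs_le.1 (hf β x hx)
    simp only [Problem.L]
    linarith
  · have hxf := mem_frontier hx hi
    obtain ⟨Cb, hb⟩ := exists_bound_family (fun α => (hst.bB_pc α).1) hst.bB_dep
    obtain ⟨Cc, hc⟩ := exists_bound_family (fun α => (hst.cB_pc α).1) hst.cB_dep
    have hle : P.LB α x p s - P.gB α x ≤ ⨆ α, (P.LB α x p s - P.gB α x) := by
      refine le_ciSup (f := fun α => P.LB α x p s - P.gB α x) ⟨Cb * ‖p‖ + Cc * |s|, ?_⟩ α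
      rintro _ ⟨β, rfl⟩
      have e2 := abs_le.1 (hinn (hb β x hxf))
      have e3 := abs_le.1 (hmul s (hc β x hxf))
      have e4 := hst.gB_nonneg β x hxf
      simp only [Problem.LB]
      linarith
    simp only [if_neg hT, if_neg hi]
    split_ifs
    · linarith
    · exact hle
    · exact le_rfl

/-! ## Viscosity properties of the envelopes -/

section Viscosity

variable [MetricSpace A] [CompactSpace A] [Nonempty A] {v : ℕ → ℕ → Euc d → ℝ}

/-- The lower envelope of `F` is a limit inferior, so it suffices to find, in every neighbourhood of
the jet, one argument where `F` is at most `ε`. The discrete maximum provides it as a jet of the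
nearby quadratic at a point of `P.Q`. -/
theorem Admissible.isViscositySubsolution (h : Admissible P D) (hproj : HasEllipticProjections P D)
    (hv : ∀ i, (D i).IsNumericalSolution P (v i)) (hC : EventuallyBounded D v C) :
    P.IsViscositySubsolution fun z => (upperEnvelope P D v z).toReal := by
  refine ⟨⟨C, fun z hz => hC.abs_upperEnvelope_le h hz⟩, fun ψ hψ z₀ hz₀ hmax => ?_⟩
  have hup : ∀ z ∈ P.Q, P.upper (fun z => (upperEnvelope P D v z).toReal) z =
      (upperEnvelope P D v z).toReal := fun z hz => by
    rw [Problem.upper, hC.uscEnv_upperEnvelope h hz, EReal.toReal_coe]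
  have hmax' : IsLocalMaxOn (fun z => (upperEnvelope P D v z).toReal - ψ z) P.Q z₀ := by
    filter_upwards [hmax, self_mem_nhdsWithin] with z h1 h2
    rwa [hup z h2, hup z₀ hz₀] at h1
  rw [hup z₀ hz₀]
  refine EReal.le_of_forall_lt_iff_le.1 fun ε hε => ?_
  have hε : 0 < ε := EReal.coe_pos.1 hε
  refine liminf_le_of_frequently_le' (frequently_iff.2 fun {U} hU => ?_)
  obtain ⟨U', hU', hsub⟩ := mem_nhdsWithin_iff_exists_mem_nhds_inter.1 hU
  obtain ⟨φ, r, η, hr, hη, hφU, hfreq⟩ := hC.exists_test h hψ hz₀ hmax' hU'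
  obtain ⟨i, ⟨k₀, hk₀, y₀, hy₀, hd, h0, hann⟩, hi⟩ :=
    (hfreq.and_eventually (h.eventually_local_max hproj hv φ z₀ hr hη hε)).exists
  obtain ⟨z, hzQ, hzd, hzF⟩ := hi k₀ hk₀ y₀ hy₀ hd h0 hann
  exact ⟨Problem.jet φ.val z (φ.val z), hsub ⟨hφU z (hzd.trans (half_lt_self hr)), hzQ⟩,
    EReal.coe_le_coe_iff.2 (Problem.Farg_le hzF)⟩

/-- The upper envelope of `-v` is minus the lower envelope of `v`, so the construction of test
functions applies to `-v` and `-ψ`. Negating the quadratic gives a local minimum for the original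
solutions; the nonlinear operator itself is not reflected. -/
theorem Admissible.isViscositySupersolution (h : Admissible P D)
    (hproj : HasEllipticProjections P D) (hv : ∀ i, (D i).IsNumericalSolution P (v i))
    (hC : EventuallyBounded D v C) :
    P.IsViscositySupersolution fun z => (lowerEnvelope P D v z).toReal := by
  set u : ℕ → ℕ → Euc d → ℝ := fun i k y => -v i k y with hu
  have hCu : EventuallyBounded D u C := hC.neg
  have hneg : (fun z => (upperEnvelope P D u z).toReal) =
      -fun z => (lowerEnvelope P D v z).toReal := by
    ext z
    rw [hu, upperEnvelope_neg, EReal.toReal_neg_eq, Pi.neg_apply]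
  have hneg' : ∀ z, (lowerEnvelope P D v z).toReal = -(upperEnvelope P D u z).toReal := fun z => by
    have := congrFun hneg z
    simp only [Pi.neg_apply] at this
    rw [this, neg_neg]
  refine ⟨⟨C, fun z hz => ?_⟩, fun ψ hψ z₀ hz₀ hmin => ?_⟩
  · rw [hneg', abs_neg]
    exact hCu.abs_upperEnvelope_le h hz
  have hlow : ∀ z ∈ P.Q, P.lower (fun z => (lowerEnvelope P D v z).toReal) z =
      -(upperEnvelope P D u z).toReal := fun z hz => by
    have h1 := hCu.uscEnv_upperEnvelope h hz
    have h2 : uscEnv P.Q (-fun z => (lowerEnvelope P D v z).toReal) z =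
        -lscEnv P.Q (fun z => (lowerEnvelope P D v z).toReal) z := by
      rw [uscEnv, lscEnv, ← EReal.limsup_neg]
      rfl
    rw [hneg, h2] at h1
    rw [Problem.lower, ← neg_neg (lscEnv _ _ _), h1, EReal.toReal_neg_eq, EReal.toReal_coe]
  have hmax : IsLocalMaxOn (fun z => (upperEnvelope P D u z).toReal - (-ψ) z) P.Q z₀ := by
    filter_upwards [hmin, self_mem_nhdsWithin] with z h1 h2
    rw [hlow z h2, hlow z₀ hz₀] at h1
    simp only [Pi.neg_apply]
    linarith
  rw [hlow z₀ hz₀, ← EReal.neg_le_neg_iff, neg_zero]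
  refine EReal.le_of_forall_lt_iff_le.1 fun ε hε => EReal.neg_le.1 ?_
  have hε : 0 < ε := EReal.coe_pos.1 hε
  rw [← EReal.coe_neg]
  refine le_limsup_of_frequently_le' (frequently_iff.2 fun {U} hU => ?_)
  obtain ⟨U', hU', hsub⟩ := mem_nhdsWithin_iff_exists_mem_nhds_inter.1 hU
  have hσ : Continuous fun a : Problem.Arg d => ((a.1, -a.2) : Problem.Arg d) := by fun_prop
  -- The neighbourhood is reflected in the jet variables but not in the space-time point.
  have hU'' : (fun a : Problem.Arg d => ((a.1, -a.2) : Problem.Arg d)) ⁻¹' U' ∈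
      𝓝 (Problem.jet (-ψ) z₀ (upperEnvelope P D u z₀).toReal) := by
    refine hσ.continuousAt.preimage_mem_nhds ?_
    have := jet_neg (-ψ) z₀ (upperEnvelope P D u z₀).toReal
    rw [neg_neg] at this
    rwa [← this]
  obtain ⟨φ, r, η, hr, hη, hφU, hfreq⟩ := hCu.exists_test h hψ.neg hz₀ hmax hU''
  obtain ⟨i, ⟨k₀, hk₀, y₀, hy₀, hd, h0, hann⟩, hi⟩ :=
    (hfreq.and_eventually (h.eventually_local_min hproj hv φ.neg z₀ hr hη hε)).exists
  simp only [hu] at h0 hann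
  obtain ⟨z, hzQ, hzd, α, hzF⟩ := hi k₀ hk₀ y₀ hy₀ hd
    (by rw [φ.val_neg, Pi.neg_apply]; linarith) fun k hk y hy hd1 hd2 => by
      rw [φ.val_neg, Pi.neg_apply, Pi.neg_apply]
      linarith [hann k hk y hy hd1 hd2]
  refine ⟨Problem.jet φ.neg.val z (φ.neg.val z), hsub ⟨?_, hzQ⟩,
    EReal.coe_le_coe_iff.2 (hzF.trans (h.FlinArg_le_Farg α hzQ))⟩
  have h1 := hφU z (hzd.trans (half_lt_self hr))
  rw [φ.val_neg, Pi.neg_apply, jet_neg]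
  exact h1

/-- The solutions are squeezed between zero and the strict supersolution, which is bounded on the
compact cylinder. -/
theorem Admissible.exists_eventuallyBounded (h : Admissible P D)
    (hproj : HasEllipticProjections P D) (hv : ∀ i, (D i).IsNumericalSolution P (v i))
    (hsup : P.HasStrictSupersolution) : ∃ C, EventuallyBounded D v C := by
  obtain ⟨α, w, hw, ε, hε, hF⟩ := hsup
  obtain ⟨C, hC⟩ := h.isCompact_Q.exists_bound_of_continuousOn hw.continuous.continuousOn
  refine ⟨C, ?_⟩
  filter_upwards [h.eventually_lt_supersolution hproj hv hw hε hF] with i hi k hk y hy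
  rw [abs_of_nonneg (h.solution_nonneg hv i hk hy)]
  exact (hi k hk y hy).le.trans ((le_abs_self _).trans (hC _ (h.node_mem_Q hk hy)))

end Viscosity

end HJB

end

theorem theorem8p1 {d : ℕ} (hd : 2 ≤ d) {A : Type*} [MetricSpace A] [CompactSpace A] [Nonempty A]
    (P : HJB.Problem d A) (hP : P.Standing) (hsup : P.HasStrictSupersolution)
    (D : ℕ → HJB.Level d A) (hmesh : HJB.MeshSequence P D) (hreg : ∀ i, (D i).Regular P)
    (hsign : ∀ i, (D i).SignsAndCone P) (hcons : HJB.Consistent P D)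
    (hmono : ∀ i, (D i).Monotone P) (hproj : HJB.HasEllipticProjections P D)
    (v : ℕ → ℕ → HJB.Euc d → ℝ) (hv : ∀ i, (D i).IsNumericalSolution P (v i)) :
    (∀ z ∈ P.Q, (HJB.upperEnvelope P D v z ≠ ⊤ ∧ HJB.upperEnvelope P D v z ≠ ⊥) ∧
      (HJB.lowerEnvelope P D v z ≠ ⊤ ∧ HJB.lowerEnvelope P D v z ≠ ⊥)) ∧
    P.IsViscositySubsolution (fun z => (HJB.upperEnvelope P D v z).toReal) ∧
    P.IsViscositySupersolution (fun z => (HJB.lowerEnvelope P D v z).toReal) := by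
  have h : HJB.Admissible P D := ⟨hP, hmesh, hreg, hsign, hcons, hmono⟩
  obtain ⟨C, hC⟩ := h.exists_eventuallyBounded hproj hv hsup
  refine ⟨fun z hz => ⟨⟨hC.upperEnvelope_ne_top, hC.upperEnvelope_ne_bot h hz⟩, ?_, ?_⟩,
    h.isViscositySubsolution hproj hv hC, h.isViscositySupersolution hproj hv hC⟩
  · have h1 := hC.neg.upperEnvelope_ne_bot h hz
    rwa [HJB.upperEnvelope_neg, ne_eq, EReal.neg_eq_bot_iff] at h1
  · have h1 := hC.neg.upperEnvelope_ne_top (P := P) (z := z)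
    rwa [HJB.upperEnvelope_neg, ne_eq, EReal.neg_eq_top_iff] at h1
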